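/- **Model.** Let $K\le d$ and $M$ be natural numbers. For $1\le k\le K$ let $A^{(k)},W^{(k)}\in\mathbb R^{d\times d}$ with $W^{(k)}$ symmetric positive definite, and assume there are $\kappa_A\ge1$, $0\le\rho<1$ and $\Gamma_{\max}$ such that $\|(A^{(k)})^t\|\le\kappa_A\rho^t$ for all $k$ and $t\ge1$, and $\|\Gamma^{(k)}\|\le\Gamma_{\max}$ for all $k$, where $\|\cdot\|$ is the spectral norm, $\Gamma^{(k)}=\sum_{t\ge0}(A^{(k)})^tW^{(k)}((A^{(k)})^t)^\top$ and $Y^{(k)}=A^{(k)}\Gamma^{(k)}$. The index set $\{1,\dots,M\}$ is the disjoint union of $\mathcal M_{\rm subspace},\mathcal M_{\rm clustering},\mathcal M_{\rm classification}$; all trajectories of group $o$ have the same length $T_m=T_o$, with $T_{\rm subspace}\ge1$. The $m$-th trajectory $x_{m,0},\dots,x_{m,T_m}\in\mathbb R^d$ has a fixed label $k_m\in\{1,\dots,K\}$ and satisfies $x_{m,t+1}=A^{(k_m)}x_{m,t}+w_{m,t}$ for $0\le t<T_m$, where all $w_{m,t}\sim\mathcal N(0,W^{(k_m)})$ are independent.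 The initial states satisfy one of the following: (Case 0) $x_{m,0}=0$ for all $m$; (Case 1) $x_{1,0}=0$ and $x_{m+1,0}=x_{m,T_m}$ for $1\le m<M$, and $T_m\ge\frac{1}{1-\rho}\log(2\kappa_A)$ for every $m\notin\mathcal M_{\rm subspace}$ that precedes some element of $\mathcal M_{\rm subspace}$. Let $T_{\rm total}=\sum_mT_m$, $T_{\rm total,subspace}=T_{\rm subspace}\cdot|\mathcal M_{\rm subspace}|$, and let $p_{\min}>0$ satisfy $p_{\min}\le|\{m\in\mathcal M_{\rm subspace}:k_m=k\}|/|\mathcal M_{\rm subspace}|$ for all $k$. For $0<\delta<1$ put $t_{\rm mix}=\frac1{1-\rho}\log\frac{d\,\kappa_AT_{\rm total}}{\delta}$. **Algorithm (subspace estimation).** Let $N=\lfloor(T_{\rm subspace}-1)/4\rfloor$, $\Omega_1=\{N+1,\dots,2N\}$, $\Omega_2=\{3N+1,\dots,4N\}$. For $m\in\mathcal M_{\rm subspace}$, $1\le i\le d$, $j\in\{1,2\}$ compute $h_{m,i,j}=\frac1{|\Omega_j|}\sum_{t\in\Omega_j}(x_{m,t})_i\,x_{m,t}$ and $g_{m,i,j}=\frac1{|\Omega_j|}\sum_{t\in\Omega_j}(x_{m,t+1})_i\,x_{m,t}$;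 then $\hat H_i=\frac1{|\mathcal M_{\rm subspace}|}\sum_{m\in\mathcal M_{\rm subspace}}h_{m,i,1}h_{m,i,2}^\top$ and $\hat G_i=\frac1{|\mathcal M_{\rm subspace}|}\sum_{m\in\mathcal M_{\rm subspace}}g_{m,i,1}g_{m,i,2}^\top$. Output matrices $V_i,U_i\in\mathbb R^{d\times K}$ with orthonormal columns spanning a top-$K$ eigenspace of $\hat H_i+\hat H_i^\top$, respectively $\hat G_i+\hat G_i^\top$. **Theorem.** There exist universal constants $C_1,C_2,C_3>0$ such that the following holds in this setting. If $$T_{\rm subspace}\ge C_1\,t_{\rm mix},\qquad T_{\rm total,subspace}\ge C_2\,t_{\rm mix}\,d\,\log\frac{T_{\rm total}d}{\delta},$$ then with probability at least $1-\delta$ (for every choice of the top-$K$ eigenspaces when they are not unique) the output satisfies, for all $1\le k\le K$ and $1\le i\le d$, $$\max\Big\{\|(\Gamma^{(k)})_i-V_iV_i^\top(\Gamma^{(k)})_i\|_2,\ \|(Y^{(k)})_i-U_iU_i^\top(Y^{(k)})_i\|_2\Big\}\le C_3\,\Gamma_{\max}\Big(\frac K{p_{\min}}\Big)^{1/2}\Big(\frac{t_{\rm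 mix}\,d}{T_{\rm total,subspace}}\log^3\frac{T_{\rm total}d}{\delta}\Big)^{1/4},$$ where $(B)_i$ denotes the transpose of the $i$-th row of $B$. The bound involves no eigengap. -/

import Mathlib

open MeasureTheory ProbabilityTheory Matrix
open scoped BigOperators

noncomputable section

namespace MixedLDS

/-- Spectral norm of a real square matrix. -/
def specNorm {d : ℕ} (B : Matrix (Fin d) (Fin d) ℝ) : ℝ :=
  ‖Matrix.toEuclideanCLM (n := Fin d) (𝕜 := ℝ) B‖

/-- The order-0 stationary autocovariance matrix `∑ t ≥ 0, A ^ t W (A ^ t)ᵀ` of the linear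
dynamical system `(A, W)`. -/
def autocovZero {d : ℕ} (A W : Matrix (Fin d) (Fin d) ℝ) : Matrix (Fin d) (Fin d) ℝ :=
  ∑' t : ℕ, A ^ t * W * (A ^ t)ᵀ

/-- The order-1 stationary autocovariance matrix of the linear dynamical system `(A, W)`. -/
def autocovOne {d : ℕ} (A W : Matrix (Fin d) (Fin d) ℝ) : Matrix (Fin d) (Fin d) ℝ :=
  A * autocovZero A W

/-- Ground-truth models: positive definite noise covariances, exponential stability of the
transition matrices, bounded stationary covariances. -/
structure ModelAssumptions {d K : ℕ} (A W : Fin K → Matrix (Fin d) (Fin d) ℝ)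
    (κ ρ Γmax : ℝ) : Prop where
  posDef : ∀ k, (W k).PosDef
  one_le_kappa : 1 ≤ κ
  rho_nonneg : 0 ≤ ρ
  rho_lt_one : ρ < 1
  stable : ∀ k, ∀ t : ℕ, 1 ≤ t → specNorm (A k ^ t) ≤ κ * ρ ^ t
  bounded : ∀ k, specNorm (autocovZero (A k) (W k)) ≤ Γmax

/-- The three disjoint groups into which the trajectories are divided. -/
inductive Stage where
  | subspace
  | clustering
  | classification
deriving DecidableEq

/-- The trajectory `x m 0, …, x m (T m)` is generated by the linear dynamical system with index
`label m`, driven by the noise vectors `w m 0, …, w m (T m - 1)`; all noise vectors are independent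
centered Gaussian vectors. Values of `x` and `w` at later times are unconstrained. -/
structure IsMixedLDS {Ω : Type*} [MeasurableSpace Ω] (μ : Measure Ω) {d K M : ℕ}
    (A W : Fin K → Matrix (Fin d) (Fin d) ℝ) (label : Fin M → Fin K) (T : Fin M → ℕ)
    (x w : Fin M → ℕ → Ω → EuclideanSpace ℝ (Fin d)) : Prop where
  law : ∀ m t, t < T m → HasLaw (w m t) (multivariateGaussian 0 (W (label m))) μ
  indep : iIndepFun (fun p : (Σ m : Fin M, Fin (T m)) => w p.1 p.2) μ
  step : ∀ m t, t < T m → ∀ ω,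
    x m (t + 1) ω = Matrix.toEuclideanCLM (n := Fin d) (𝕜 := ℝ) (A (label m)) (x m t ω) + w m t ω

/-- Initial states: every trajectory starts at zero. -/
def ZeroStart {Ω : Type*} {d M : ℕ} (x : Fin M → ℕ → Ω → EuclideanSpace ℝ (Fin d)) : Prop :=
  ∀ m ω, x m 0 ω = 0

/-- Initial states: the trajectories are consecutive segments of one continuous trajectory
which starts at zero. -/
def ContinuousStart {Ω : Type*} {d M : ℕ} (T : Fin M → ℕ)
    (x : Fin M → ℕ → Ω → EuclideanSpace ℝ (Fin d)) : Prop :=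
  (∀ m : Fin M, (m : ℕ) = 0 → ∀ ω, x m 0 ω = 0) ∧
    ∀ m m' : Fin M, (m' : ℕ) = (m : ℕ) + 1 → ∀ ω, x m' 0 ω = x m (T m) ω

/-- The matrix `V`, with orthonormal columns, spans a top-`K` eigenspace of the symmetric matrix
`S`: its column space is the span of the first `K` vectors of an orthonormal eigenbasis of `S` whose
eigenvalues are sorted in descending order. -/
def IsTopEigenspace {d K : ℕ} (S : Matrix (Fin d) (Fin d) ℝ) (V : Matrix (Fin d) (Fin K) ℝ) :
    Prop :=
  Vᵀ * V = 1 ∧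
    ∃ (hK : K ≤ d) (b : OrthonormalBasis (Fin d) ℝ (EuclideanSpace ℝ (Fin d))) (lam : Fin d → ℝ),
      Antitone lam ∧
      (∀ j, Matrix.toEuclideanCLM (n := Fin d) (𝕜 := ℝ) S (b j) = lam j • b j) ∧
      Submodule.span ℝ (Set.range fun k : Fin K => WithLp.toLp 2 (V.col k)) =
        Submodule.span ℝ (Set.range fun k : Fin K => b (Fin.castLE hK k))

/-- Common length of the two averaging windows for trajectories `x 0, …, x T`. It is `⌊T / 4⌋`,
except that when `4` divides `T` it is one less, so that the last state used, `x (4 N + 1)`, belongs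
to the trajectory. -/
def windowLength (T : ℕ) : ℕ := (T - 1) / 4

/-- First window `{N + 1, …, 2 N}`. -/
def windowOne (T : ℕ) : Finset ℕ := Finset.Icc (windowLength T + 1) (2 * windowLength T)

/-- Second window `{3 N + 1, …, 4 N}`. -/
def windowTwo (T : ℕ) : Finset ℕ := Finset.Icc (3 * windowLength T + 1) (4 * windowLength T)

/-- Average of `(x t)_i • x t` over the window `s`. -/
def hVec {d : ℕ} (s : Finset ℕ) (x : ℕ → EuclideanSpace ℝ (Fin d)) (i : Fin d) :
    EuclideanSpace ℝ (Fin d) :=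
  (s.card : ℝ)⁻¹ • ∑ t ∈ s, (x t i) • x t

/-- Average of `(x (t + 1))_i • x t` over the window `s`. -/
def gVec {d : ℕ} (s : Finset ℕ) (x : ℕ → EuclideanSpace ℝ (Fin d)) (i : Fin d) :
    EuclideanSpace ℝ (Fin d) :=
  (s.card : ℝ)⁻¹ • ∑ t ∈ s, (x (t + 1) i) • x t

/-- The matrix `Ĥ_i` computed from the trajectories `x m 0, …, x m T`, `m ∈ S`. -/
def Hhat {d M : ℕ} (S : Finset (Fin M)) (T : ℕ) (x : Fin M → ℕ → EuclideanSpace ℝ (Fin d))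
    (i : Fin d) : Matrix (Fin d) (Fin d) ℝ :=
  (S.card : ℝ)⁻¹ • ∑ m ∈ S, Matrix.vecMulVec (hVec (windowOne T) (x m) i).ofLp
    (hVec (windowTwo T) (x m) i).ofLp

/-- The matrix `Ĝ_i` computed from the trajectories `x m 0, …, x m T`, `m ∈ S`. -/
def Ghat {d M : ℕ} (S : Finset (Fin M)) (T : ℕ) (x : Fin M → ℕ → EuclideanSpace ℝ (Fin d))
    (i : Fin d) : Matrix (Fin d) (Fin d) ℝ :=
  (S.card : ℝ)⁻¹ • ∑ m ∈ S, Matrix.vecMulVec (gVec (windowOne T) (x m) i).ofLp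
    (gVec (windowTwo T) (x m) i).ofLp

/-- `(V i, U i)` is a possible output of the subspace estimation algorithm run on the trajectories
`x m 0, …, x m T`, `m ∈ S` (eigenspaces need not be unique when eigenvalues are repeated). -/
def IsSubspaceOutput {d K M : ℕ} (S : Finset (Fin M)) (T : ℕ)
    (x : Fin M → ℕ → EuclideanSpace ℝ (Fin d)) (V U : Fin d → Matrix (Fin d) (Fin K) ℝ) : Prop :=
  ∀ i, IsTopEigenspace (Hhat S T x i + (Hhat S T x i)ᵀ) (V i) ∧
    IsTopEigenspace (Ghat S T x i + (Ghat S T x i)ᵀ) (U i)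

/-- The Euclidean distance `‖v - V Vᵀ v‖₂`. -/
def projError {d K : ℕ} (V : Matrix (Fin d) (Fin K) ℝ) (v : Fin d → ℝ) : ℝ :=
  ‖(WithLp.toLp 2 (v - (V * Vᵀ) *ᵥ v) : EuclideanSpace ℝ (Fin d))‖

/-- The mixing time `log (d κ T / δ) / (1 - ρ)`, where `Ttot` is the total trajectory length. -/
def mixingTime (d : ℕ) (κ ρ Ttot δ : ℝ) : ℝ :=
  1 / (1 - ρ) * Real.log (d * κ * Ttot / δ)

end MixedLDS

end

/-! Fix a coordinate `i`, and let `y k` be the `i`-th row of the order-0 or order-1 autocovariance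
of model `k`. The two window averages of one trajectory are nearly independent, because a gap of
about `N` steps separates the windows, and each has mean close to `y k`. Hence the averaged
symmetrized product is close, as a quadratic form, to `2 ∑ p k • y k (y k)ᵀ`, a matrix of rank at
most `K` whose range contains every row of interest.

No eigengap is needed (`mul_projError_sq_le`). If the forms differ by at most `ε`, the first
discarded eigenvalue is at most `ε`, by testing on a combination of the top `K + 1` eigenvectors
orthogonal to all `y k`. The residual `r` of `y k` lies in the discarded eigenspaces, so `2 p k ‖r‖⁴
≤ rᵀ S r + ε ‖r‖² ≤ 2 ε ‖r‖²`, that is, `p k ‖r‖² ≤ ε`. As `ε` is a square root of the statistical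
rate, the error is a fourth root.

It remains to bound `ε`. First, decoupling: each trajectory is replaced by two zero-started systems
driven by disjoint blocks of noise (`windowPair`), which are exactly independent and Gaussian. The
replacement error is damped by at least `N` applications of the transition matrix, and is negligible
once the states involved are bounded; second moments and Chebyshev suffice for that
(`StableSystem.abs_windows_sub_windowPair_le`, `exists_bounded_states_event`). For consecutive
segments the initial states are controlled by a contracting recursion for their second moments
(`exists_bound_initial_state`).

Second, tails: a window average tested against a vector is a bilinear Gaussian chaos. Its
exponential moments follow by diagonalization, with variance proxy of order `G² τ / N`, where `τ` is
a correlation time comparable to the mixing time (`IsGaussianNoise.hasChaosMGF`).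

Third, concentration over trajectories: the vectors are truncated at a logarithmic level, recentred,
and fed into a matrix Bernstein inequality (`exists_sum_mul_concentration`). Its proof bounds the
trace of the exponential one summand at a time by Golden–Thompson. The outcome is `ε` of order `G²
√η`, with `η` the quantity under the fourth root of the theorem. If `η ≥ 1` or `d = 1` the claim is
elementary. -/

namespace MixedLDS

/-! ### Trace inequalities for powers of products. -/

section GoldenThompson

variable {n : Type*} [Fintype n]

theorem trace_mul_le_trace_mul_transpose (A B : Matrix n n ℝ) :
    (A * B).trace ≤ ((A * Aᵀ).trace + (B * Bᵀ).trace) / 2 := by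
  have h : 0 ≤ ((A - Bᵀ) * (A - Bᵀ)ᵀ).trace := by
    simp only [Matrix.trace, Matrix.diag, Matrix.mul_apply, Matrix.transpose_apply]
    exact Finset.sum_nonneg fun i _ => Finset.sum_nonneg fun j _ => mul_self_nonneg _
  rw [Matrix.transpose_sub, Matrix.transpose_transpose, Matrix.sub_mul, Matrix.mul_sub,
    Matrix.mul_sub, Matrix.trace_sub, Matrix.trace_sub, Matrix.trace_sub,
    ← Matrix.trace_transpose (Bᵀ * Aᵀ), Matrix.transpose_mul, Matrix.transpose_transpose,
    Matrix.transpose_transpose, Matrix.trace_mul_comm Bᵀ B] at h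
  linarith

variable [DecidableEq n]

theorem trace_mul_pow_comm (A B : Matrix n n ℝ) (k : ℕ) :
    ((A * B) ^ k).trace = ((B * A) ^ k).trace := by
  cases k with
  | zero => simp
  | succ k =>
    rw [pow_succ', Matrix.mul_assoc, Matrix.trace_mul_comm, Matrix.mul_assoc,
      mul_pow_mul, ← Matrix.mul_assoc, ← pow_succ']

/-- The two families feed each other. The second with `X = A * B` reduces the first at the next
level to the first for `B * B` and `A * A`. The second advances by applying it to `X * X`, cycling
the trace, using the first for `X * Xᵀ` and `Xᵀ * X`, and finishing with Cauchy–Schwarz for the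
trace. -/
theorem trace_pow_two_pow_le_aux (k : ℕ) :
    (∀ A B : Matrix n n ℝ, A.IsSymm → B.IsSymm →
      ((A * B) ^ 2 ^ k).trace ≤ (A ^ 2 ^ k * B ^ 2 ^ k).trace) ∧
    ∀ X : Matrix n n ℝ, (X ^ 2 ^ (k + 1)).trace ≤ ((X * Xᵀ) ^ 2 ^ k).trace := by
  induction k with
  | zero =>
    refine ⟨fun A B _ _ => by simp, fun X => ?_⟩
    have := trace_mul_le_trace_mul_transpose X X
    simp only [zero_add, pow_one, pow_zero, pow_two]
    linarith
  | succ k ih =>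
    obtain ⟨hI, hJ⟩ := ih
    refine ⟨fun A B hA hB => ?_, fun X => ?_⟩
    · calc ((A * B) ^ 2 ^ (k + 1)).trace ≤ ((A * B * (A * B)ᵀ) ^ 2 ^ k).trace := hJ _
        _ = ((A * (B * B * A)) ^ 2 ^ k).trace := by
          rw [Matrix.transpose_mul, hA.eq, hB.eq]; simp only [Matrix.mul_assoc]
        _ = (((B * B) * (A * A)) ^ 2 ^ k).trace := by
          rw [trace_mul_pow_comm]; simp only [Matrix.mul_assoc]
        _ ≤ ((B * B) ^ 2 ^ k * (A * A) ^ 2 ^ k).trace := by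
          refine hI _ _ ?_ ?_
          · rw [Matrix.IsSymm, Matrix.transpose_mul, hB.eq]
          · rw [Matrix.IsSymm, Matrix.transpose_mul, hA.eq]
        _ = _ := by
          rw [Matrix.trace_mul_comm, ← pow_two, ← pow_two, ← pow_mul, ← pow_mul, ← pow_succ']
    · have hs : (X * Xᵀ).IsSymm := by simp [Matrix.IsSymm, Matrix.transpose_mul]
      have hs' : (Xᵀ * X).IsSymm := by simp [Matrix.IsSymm, Matrix.transpose_mul]
      calc (X ^ 2 ^ (k + 1 + 1)).trace = ((X * X) ^ 2 ^ (k + 1)).trace := by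
            rw [← pow_two X, ← pow_mul, ← pow_succ']
        _ ≤ ((X * X * (X * X)ᵀ) ^ 2 ^ k).trace := hJ _
        _ = ((X * (X * (Xᵀ * Xᵀ))) ^ 2 ^ k).trace := by
          rw [Matrix.transpose_mul]; simp only [Matrix.mul_assoc]
        _ = ((X * Xᵀ * (Xᵀ * X)) ^ 2 ^ k).trace := by
          rw [trace_mul_pow_comm]; simp only [Matrix.mul_assoc]
        _ ≤ ((X * Xᵀ) ^ 2 ^ k * (Xᵀ * X) ^ 2 ^ k).trace := hI _ _ hs hs'
        _ ≤ _ := by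
          refine (trace_mul_le_trace_mul_transpose _ _).trans (le_of_eq ?_)
          rw [(hs.pow _).eq, (hs'.pow _).eq, ← pow_add, ← pow_add, ← two_mul, ← pow_succ',
            trace_mul_pow_comm Xᵀ X]
          ring

theorem trace_mul_pow_two_pow_le {A B : Matrix n n ℝ} (hA : A.IsSymm) (hB : B.IsSymm) (k : ℕ) :
    ((A * B) ^ 2 ^ k).trace ≤ (A ^ 2 ^ k * B ^ 2 ^ k).trace :=
  (trace_pow_two_pow_le_aux k).1 A B hA hB

end GoldenThompson

/-! ### The Lie–Trotter product formula. -/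

section LieTrotter

open Filter Topology

/-- Telescoping: replacing `x` by `y` one factor at a time costs at most `M ^ k * ‖x - y‖` for each
of the `k` factors. -/
theorem norm_pow_sub_pow_le {𝔸 : Type*} [NormedRing 𝔸] [NormOneClass 𝔸] {x y : 𝔸} {M : ℝ}
    (hx : ‖x‖ ≤ M) (hy : ‖y‖ ≤ M) (hM : 1 ≤ M)
    (k : ℕ) : ‖x ^ k - y ^ k‖ ≤ k * M ^ k * ‖x - y‖ := by
  have hM0 : (0 : ℝ) ≤ M := by linarith
  induction k with
  | zero => simp
  | succ k ih =>
    have h : x ^ (k + 1) - y ^ (k + 1) = x ^ k * (x - y) + (x ^ k - y ^ k) * y := by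
      rw [pow_succ, pow_succ]; noncomm_ring
    have h1 : ‖x ^ k‖ ≤ M ^ k := (norm_pow_le x k).trans (pow_le_pow_left₀ (norm_nonneg _) hx k)
    have h2 : M ^ k ≤ M ^ (k + 1) := pow_le_pow_right₀ hM (Nat.le_succ k)
    calc ‖x ^ (k + 1) - y ^ (k + 1)‖ ≤ ‖x ^ k‖ * ‖x - y‖ + ‖x ^ k - y ^ k‖ * ‖y‖ := by
          rw [h]; exact (norm_add_le _ _).trans (add_le_add (norm_mul_le _ _) (norm_mul_le _ _))
      _ ≤ M ^ (k + 1) * ‖x - y‖ + (k * M ^ k * ‖x - y‖) * M := by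
          gcongr
          exact h1.trans h2
      _ = _ := by push_cast; ring

/-- The Lie–Trotter product formula. -/
theorem tendsto_exp_mul_exp_pow {𝔸 : Type*} [NormedRing 𝔸] [NormedAlgebra ℝ 𝔸] [CompleteSpace 𝔸]
    [NormOneClass 𝔸] (a b : 𝔸) :
    Tendsto (fun k : ℕ => (NormedSpace.exp ((k : ℝ)⁻¹ • a) * NormedSpace.exp ((k : ℝ)⁻¹ • b)) ^ k)
      atTop (𝓝 (NormedSpace.exp (a + b))) := by
  let X : ℝ → 𝔸 := fun t => NormedSpace.exp (t • a) * NormedSpace.exp (t • b)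
  let Z : ℝ → 𝔸 := fun t => NormedSpace.exp (t • (a + b))
  have hX : HasDerivAt X (a + b) 0 := by
    have := (hasDerivAt_exp_smul_const (𝕂 := ℝ) a 0).mul (hasDerivAt_exp_smul_const (𝕂 := ℝ) b 0)
    simp only [zero_smul, NormedSpace.exp_zero, one_mul, mul_one] at this
    exact this
  have hZ : HasDerivAt Z (a + b) 0 := by
    have := hasDerivAt_exp_smul_const (𝕂 := ℝ) (a + b) 0
    simp only [zero_smul, NormedSpace.exp_zero, one_mul] at this
    exact this
  -- Both curves pass through `1` with derivative `a + b`, so their difference at `1 / k` is `o(1 /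
  -- k)`; this outweighs the factor `k` of the telescoping bound.
  have hXZ : (fun t => X t - Z t) =o[𝓝 0] (fun t : ℝ => t) := by
    have := (hX.sub hZ).isLittleO
    simpa [X, Z] using this
  obtain ⟨c, hc⟩ := hX.isBigO_sub.bound
  obtain ⟨c', hc'⟩ := hZ.isBigO_sub.bound
  set C := max (max c c') 0 with hC
  have hC0 : 0 ≤ C := le_max_right _ _
  have hinv : Tendsto (fun k : ℕ => (k : ℝ)⁻¹) atTop (𝓝 0) := tendsto_inv_atTop_nhds_zero_nat
  have hbound : ∀ᶠ k : ℕ in atTop, ‖X (k : ℝ)⁻¹ ^ k - Z (k : ℝ)⁻¹ ^ k‖ ≤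
      Real.exp C * (‖X (k : ℝ)⁻¹ - Z (k : ℝ)⁻¹‖ / ‖(k : ℝ)⁻¹‖) := by
    filter_upwards [hinv.eventually hc, hinv.eventually hc', eventually_gt_atTop 0]
      with k hk hk' hk0
    have hk0' : (0 : ℝ) < k := by exact_mod_cast hk0
    have hX0 : X 0 = 1 := by simp [X]
    have hZ0 : Z 0 = 1 := by simp [Z]
    have hnk : ‖(k : ℝ)⁻¹‖ = (k : ℝ)⁻¹ := by rw [Real.norm_of_nonneg]; positivity
    have key : ∀ (y : 𝔸) (e : ℝ), e ≤ C → ‖y - 1‖ ≤ e * ‖(k : ℝ)⁻¹ - 0‖ →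
        ‖y‖ ≤ 1 + C * (k : ℝ)⁻¹ := by
      intro y e he hy
      rw [sub_zero, hnk] at hy
      have h1 : ‖y‖ ≤ ‖y - 1‖ + 1 := by
        simpa using norm_add_le (y - 1) (1 : 𝔸)
      have : e * (k : ℝ)⁻¹ ≤ C * (k : ℝ)⁻¹ := by gcongr
      linarith
    have h1 := key (X (k : ℝ)⁻¹) c ((le_max_left _ _).trans (le_max_left _ _)) (by simpa [hX0] using hk)
    have h2 := key (Z (k : ℝ)⁻¹) c' ((le_max_right _ _).trans (le_max_left _ _)) (by simpa [hZ0] using hk')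
    have hM : (1 : ℝ) ≤ 1 + C * (k : ℝ)⁻¹ := by
      have : 0 ≤ C * (k : ℝ)⁻¹ := by positivity
      linarith
    refine (norm_pow_sub_pow_le h1 h2 hM k).trans ?_
    -- Factors of size `1 + C / k` have `k`-th powers bounded uniformly in `k`.
    have hMk : (1 + C * (k : ℝ)⁻¹) ^ k ≤ Real.exp C := by
      have : (1 + C * (k : ℝ)⁻¹) ≤ Real.exp (C * (k : ℝ)⁻¹) := by
        linarith [Real.add_one_le_exp (C * (k : ℝ)⁻¹)]
      refine (pow_le_pow_left₀ (by linarith) this k).trans (le_of_eq ?_)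
      rw [← Real.exp_nat_mul]; congr 1; field_simp
    rw [hnk, div_inv_eq_mul]
    calc (k : ℝ) * (1 + C * (k : ℝ)⁻¹) ^ k * ‖X (k : ℝ)⁻¹ - Z (k : ℝ)⁻¹‖
        ≤ k * Real.exp C * ‖X (k : ℝ)⁻¹ - Z (k : ℝ)⁻¹‖ := by gcongr
      _ = _ := by ring
  have hlim : Tendsto (fun k : ℕ => Real.exp C * (‖X (k : ℝ)⁻¹ - Z (k : ℝ)⁻¹‖ / ‖(k : ℝ)⁻¹‖))
      atTop (𝓝 0) := by
    have := (hXZ.norm_norm.tendsto_div_nhds_zero.comp hinv).const_mul (Real.exp C)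
    simpa using this
  have hdiff := squeeze_zero_norm' hbound hlim
  have hZk : ∀ᶠ k : ℕ in atTop, Z (k : ℝ)⁻¹ ^ k = NormedSpace.exp (a + b) := by
    filter_upwards [eventually_gt_atTop 0] with k hk
    have hk0 : (k : ℝ) ≠ 0 := by exact_mod_cast hk.ne'
    let : NormedAlgebra ℚ 𝔸 := NormedAlgebra.restrictScalars ℚ ℝ 𝔸
    simp only [Z]
    rw [← NormedSpace.exp_nsmul, ← Nat.cast_smul_eq_nsmul ℝ, smul_smul, mul_inv_cancel₀ hk0, one_smul]
  have := hdiff.add (tendsto_const_nhds (x := NormedSpace.exp (a + b)))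
  rw [zero_add] at this
  refine this.congr' ?_
  filter_upwards [hZk] with k hk
  rw [← hk]; simp [X]

end LieTrotter

/-! ### The Golden–Thompson inequality. -/

section

variable {n : Type*} [Fintype n] [DecidableEq n]

open Filter Topology

attribute [local instance] Matrix.linftyOpNormedRing Matrix.linftyOpNormedAlgebra in
/-- The Golden–Thompson inequality for real symmetric matrices. -/
theorem trace_exp_add_le {A B : Matrix n n ℝ} (hA : A.IsSymm) (hB : B.IsSymm) :
    (NormedSpace.exp (A + B)).trace ≤ (NormedSpace.exp A * NormedSpace.exp B).trace := by
  rcases isEmpty_or_nonempty n with hn | hn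
  · simp [Matrix.trace]
  have : NormOneClass (Matrix n n ℝ) := Matrix.linfty_opNormOneClass
  -- Along the exponents `2 ^ k` the trace inequality for powers applies before passing to the
  -- limit.
  have h1 := (tendsto_exp_mul_exp_pow A B).comp (tendsto_pow_atTop_atTop_of_one_lt one_lt_two)
  have h2 := ((Continuous.matrix_trace continuous_id).tendsto
    (NormedSpace.exp (A + B) : Matrix n n ℝ)).comp h1
  refine le_of_tendsto h2 (Eventually.of_forall fun k => ?_)
  simp only [Function.comp_apply, id]
  have hpow : ∀ C : Matrix n n ℝ, NormedSpace.exp (((2 ^ k : ℕ) : ℝ)⁻¹ • C) ^ 2 ^ k =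
      NormedSpace.exp C := by
    intro C
    rw [← Matrix.exp_nsmul, ← Nat.cast_smul_eq_nsmul ℝ, smul_smul, mul_inv_cancel₀ (by positivity),
      one_smul]
  refine (trace_mul_pow_two_pow_le (Matrix.IsSymm.exp (hA.smul _))
    (Matrix.IsSymm.exp (hB.smul _)) k).trans (le_of_eq ?_)
  rw [hpow, hpow]

end

end MixedLDS

namespace MixedLDS

/-! ### Quadratic forms and exponentials of symmetric matrices. -/

section Spectral

variable {n : Type*} [Fintype n] [DecidableEq n]

theorem exists_orthonormalBasis_diagonalization {B : Matrix n n ℝ} (hB : B.IsSymm) :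
    ∃ (b : OrthonormalBasis n ℝ (EuclideanSpace ℝ n)) (U : Matrix n n ℝ) (l : n → ℝ),
      (∀ i j, U i j = b j i) ∧ Uᵀ * U = 1 ∧ U * Uᵀ = 1 ∧ B = U * diagonal l * Uᵀ := by
  have hH : B.IsHermitian := by
    rw [Matrix.IsHermitian, conjTranspose_eq_transpose_of_trivial]; exact hB
  refine ⟨hH.eigenvectorBasis, hH.eigenvectorUnitary, hH.eigenvalues,
    hH.eigenvectorUnitary_apply, ?_, ?_, ?_⟩
  · have := Unitary.coe_star_mul_self hH.eigenvectorUnitary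
    rwa [star_eq_conjTranspose, conjTranspose_eq_transpose_of_trivial] at this
  · have := Unitary.coe_mul_star_self hH.eigenvectorUnitary
    rwa [Unitary.coe_star, star_eq_conjTranspose, conjTranspose_eq_transpose_of_trivial] at this
  · have := hH.spectral_theorem
    rw [Unitary.conjStarAlgAut_apply, star_eq_conjTranspose,
      conjTranspose_eq_transpose_of_trivial] at this
    simpa using this

theorem exists_orthogonal_diagonalization {B : Matrix n n ℝ} (hB : B.IsSymm) :
    ∃ (U : Matrix n n ℝ) (l : n → ℝ), Uᵀ * U = 1 ∧ U * Uᵀ = 1 ∧ B = U * diagonal l * Uᵀ := by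
  obtain ⟨-, U, l, -, h⟩ := exists_orthonormalBasis_diagonalization hB
  exact ⟨U, l, h⟩

theorem dotProduct_conj_diagonal (U : Matrix n n ℝ) (l u : n → ℝ) :
    u ⬝ᵥ (U * diagonal l * Uᵀ) *ᵥ u = ∑ i, l i * (Uᵀ *ᵥ u) i ^ 2 := by
  rw [← mulVec_mulVec, ← mulVec_mulVec, dotProduct_mulVec, ← mulVec_transpose]
  simp only [dotProduct, mulVec_diagonal]
  exact Finset.sum_congr rfl fun i _ => by ring

theorem dotProduct_transpose_mulVec_self {U : Matrix n n ℝ} (hU : U * Uᵀ = 1) (u : n → ℝ) :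
    ∑ i, (Uᵀ *ᵥ u) i ^ 2 = u ⬝ᵥ u := by
  have h := dotProduct_conj_diagonal U 1 u
  have h1 : (diagonal 1 : Matrix n n ℝ) = 1 := diagonal_one
  rw [h1, Matrix.mul_one, hU, one_mulVec] at h
  simpa using h.symm

theorem exp_conj_diagonal {U : Matrix n n ℝ} (hU : Uᵀ * U = 1) (l : n → ℝ) :
    NormedSpace.exp (U * diagonal l * Uᵀ) = U * diagonal (fun i => Real.exp (l i)) * Uᵀ := by
  have hinv : U⁻¹ = Uᵀ := inv_eq_left_inv hU
  have hunit : IsUnit U := IsUnit.of_mul_eq_one_right _ hU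
  have := Matrix.exp_conj U (diagonal l) hunit
  rw [hinv, Matrix.exp_diagonal] at this
  rw [this]
  congr
  funext i
  rw [Pi.coe_exp, Real.exp_eq_exp_ℝ]

theorem abs_le_of_abs_dotProduct_conj_le {U : Matrix n n ℝ} (hU : Uᵀ * U = 1)
    (hU' : U * Uᵀ = 1) {l : n → ℝ} {R : ℝ}
    (h : ∀ u, |u ⬝ᵥ (U * diagonal l * Uᵀ) *ᵥ u| ≤ R * (u ⬝ᵥ u)) (i : n) : |l i| ≤ R := by
  have h1 := h (U *ᵥ Pi.single i 1)
  rw [dotProduct_conj_diagonal, ← dotProduct_transpose_mulVec_self hU', mulVec_mulVec, hU,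
    one_mulVec] at h1
  simpa [Pi.single_apply, Finset.sum_ite_eq] using h1

/-- In an eigenbasis this is the scalar bound `exp l ≤ 1 + l + l ^ 2` for `|l| ≤ 1`. -/
theorem dotProduct_exp_le {B : Matrix n n ℝ} (hB : B.IsSymm)
    (h : ∀ u, |u ⬝ᵥ B *ᵥ u| ≤ u ⬝ᵥ u) (u : n → ℝ) :
    u ⬝ᵥ NormedSpace.exp B *ᵥ u ≤ u ⬝ᵥ (1 + B + B * B) *ᵥ u := by
  obtain ⟨U, l, hU, hU', rfl⟩ := exists_orthogonal_diagonalization hB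
  have hl := abs_le_of_abs_dotProduct_conj_le (R := 1) hU hU' (by simpa using h)
  have h2 : (1 + U * diagonal l * Uᵀ + U * diagonal l * Uᵀ * (U * diagonal l * Uᵀ)) =
      U * diagonal (fun i => 1 + l i + l i * l i) * Uᵀ := by
    have e1 : U * diagonal l * Uᵀ * (U * diagonal l * Uᵀ) =
        U * (diagonal l * diagonal l) * Uᵀ := by
      calc _ = U * diagonal l * (Uᵀ * U) * diagonal l * Uᵀ := by simp only [Matrix.mul_assoc]
        _ = _ := by rw [hU]; simp only [Matrix.mul_assoc, Matrix.mul_one]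
    have e2 : (diagonal (fun i => 1 + l i + l i * l i) : Matrix n n ℝ) =
        1 + diagonal l + diagonal l * diagonal l := by
      rw [diagonal_mul_diagonal, ← diagonal_one, diagonal_add, diagonal_add]
    rw [e1, e2, Matrix.mul_add, Matrix.mul_add, Matrix.mul_one, Matrix.add_mul, Matrix.add_mul, hU']
  rw [exp_conj_diagonal hU, h2, dotProduct_conj_diagonal, dotProduct_conj_diagonal]
  refine Finset.sum_le_sum fun i _ => mul_le_mul_of_nonneg_right ?_ (sq_nonneg _)
  have := abs_le.1 (Real.abs_exp_sub_one_sub_id_le (hl i))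
  nlinarith [this.2]

theorem exp_eq_mul_self (S : Matrix n n ℝ) :
    NormedSpace.exp S = NormedSpace.exp ((1 / 2 : ℝ) • S) * NormedSpace.exp ((1 / 2 : ℝ) • S) := by
  rw [← Matrix.exp_add_of_commute _ _ (Commute.refl _), ← add_smul]
  norm_num

/-- Writing `exp S` as the square of the symmetric matrix `exp (S / 2)` turns both traces into sums
of the quadratic form over the columns of that root. -/
theorem trace_exp_mul_le {S C D : Matrix n n ℝ} (hS : S.IsSymm)
    (h : ∀ u, u ⬝ᵥ C *ᵥ u ≤ u ⬝ᵥ D *ᵥ u) :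
    (NormedSpace.exp S * C).trace ≤ (NormedSpace.exp S * D).trace := by
  set Q := NormedSpace.exp ((1 / 2 : ℝ) • S) with hQ
  have hQs : Qᵀ = Q := (Matrix.IsSymm.exp (hS.smul _)).eq
  have key : ∀ E : Matrix n n ℝ, (NormedSpace.exp S * E).trace =
      ∑ j, (Q *ᵥ Pi.single j 1) ⬝ᵥ E *ᵥ (Q *ᵥ Pi.single j 1) := by
    intro E
    rw [exp_eq_mul_self, ← hQ, Matrix.mul_assoc, Matrix.trace_mul_comm, Matrix.mul_assoc]
    refine Finset.sum_congr rfl fun j _ => ?_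
    rw [dotProduct_comm, mulVec_mulVec, dotProduct_mulVec, ← mulVec_transpose, hQs, mulVec_mulVec]
    simp
  rw [key, key]
  exact Finset.sum_le_sum fun j _ => h _

theorem trace_exp_nonneg {S : Matrix n n ℝ} (hS : S.IsSymm) : 0 ≤ (NormedSpace.exp S).trace := by
  have := trace_exp_mul_le (C := 0) (D := 1) hS (fun u => by
    simp only [zero_mulVec, dotProduct_zero, one_mulVec]
    exact Finset.sum_nonneg fun i _ => mul_self_nonneg _)
  simpa using this

/-- Some eigenvalue is at least `t`, and the trace of the exponential dominates the exponential of
each eigenvalue. -/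
theorem exp_le_trace_exp {B : Matrix n n ℝ} (hB : B.IsSymm) {t : ℝ} {u : n → ℝ}
    (h : t * (u ⬝ᵥ u) < u ⬝ᵥ B *ᵥ u) : Real.exp t ≤ (NormedSpace.exp B).trace := by
  obtain ⟨U, l, hU, hU', rfl⟩ := exists_orthogonal_diagonalization hB
  rw [dotProduct_conj_diagonal, ← dotProduct_transpose_mulVec_self hU', Finset.mul_sum] at h
  obtain ⟨i, -, hi⟩ := Finset.exists_lt_of_sum_lt h
  have hti : t ≤ l i := by
    by_contra hlt
    push Not at hlt
    nlinarith [sq_nonneg ((Uᵀ *ᵥ u) i)]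
  rw [exp_conj_diagonal hU, Matrix.trace_mul_comm, ← Matrix.mul_assoc, hU, Matrix.one_mul,
    trace_diagonal]
  exact (Real.exp_le_exp.2 hti).trans
    (Finset.single_le_sum (f := fun i => Real.exp (l i)) (fun j _ => (Real.exp_pos _).le)
      (Finset.mem_univ i))

/-- Polarization with two basis vectors and their sum. The constant is not sharp: only boundedness
of the entries matters, for integrability. -/
theorem abs_apply_le_of_abs_dotProduct_le {B : Matrix n n ℝ} (hB : B.IsSymm) {R : ℝ}
    (h : ∀ u, |u ⬝ᵥ B *ᵥ u| ≤ R * (u ⬝ᵥ u)) (i j : n) : |B i j| ≤ 3 * R := by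
  have hd : ∀ i, |B i i| ≤ R := fun i => by simpa using h (Pi.single i 1)
  by_cases hij : i = j
  · subst hij
    have h0 : 0 ≤ R := (abs_nonneg _).trans (hd i)
    linarith [hd i]
  have h2 := h (Pi.single i 1 + Pi.single j 1)
  have hs : B j i = B i j := hB.apply i j
  simp only [mulVec_add, dotProduct_add, add_dotProduct, mulVec_single_one, single_one_dotProduct,
    col_apply, hs, Pi.single_apply, hij, Ne.symm hij, if_true, if_false] at h2
  have h1 := abs_le.1 (hd i)
  have h3 := abs_le.1 (hd j)
  have h4 := abs_le.1 h2
  rw [abs_le]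
  constructor <;> linarith [h1.1, h1.2, h3.1, h3.2, h4.1, h4.2]

end Spectral

/-! ### Borel structure on matrices. -/

instance instMeasurableSpaceMatrix {m n : Type*} : MeasurableSpace (Matrix m n ℝ) :=
  inferInstanceAs (MeasurableSpace (m → n → ℝ))

instance instBorelSpaceMatrix {m n : Type*} [Countable m] [Countable n] :
    BorelSpace (Matrix m n ℝ) :=
  inferInstanceAs (BorelSpace (m → n → ℝ))

instance instSecondCountableTopologyMatrix {m n : Type*} [Countable m] [Countable n] :
    SecondCountableTopology (Matrix m n ℝ) :=
  inferInstanceAs (SecondCountableTopology (m → n → ℝ))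

/-! ### Matrix Bernstein inequality by the trace-exponential method. -/

section Bernstein

variable {n : Type*} [Fintype n] {Ω : Type*} [MeasurableSpace Ω] {μ : Measure Ω}

/-- The values stay in a compact cube, on which a continuous function is bounded. -/
theorem integrable_comp_of_bounded_entries [IsProbabilityMeasure μ] {X : Ω → Matrix n n ℝ}
    (hX : Measurable X) {c : ℝ} (hc : ∀ ω i j, |X ω i j| ≤ c) {f : Matrix n n ℝ → ℝ}
    (hf : Continuous f) : Integrable (fun ω => f (X ω)) μ := by
  have hcomp : IsCompact (Set.pi Set.univ fun _ : n => Set.pi Set.univ fun _ : n =>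
      Set.Icc (-c) c) := isCompact_univ_pi fun _ => isCompact_univ_pi fun _ => isCompact_Icc
  obtain ⟨C, hC⟩ := hcomp.exists_bound_of_continuousOn (f := f) hf.continuousOn
  refine Integrable.of_bound (hf.measurable.comp hX).aestronglyMeasurable C
    (Filter.Eventually.of_forall fun ω => hC _ ?_)
  exact fun i _ j _ => abs_le.1 (hc ω i j)

variable [DecidableEq n]

theorem continuous_matrix_exp :
    Continuous (fun S : Matrix n n ℝ => NormedSpace.exp S) := by
  let _ : NormedRing (Matrix n n ℝ) := Matrix.linftyOpNormedRing
  let _ : NormedAlgebra ℝ (Matrix n n ℝ) := Matrix.linftyOpNormedAlgebra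
  let _ : NormedAlgebra ℚ (Matrix n n ℝ) := NormedAlgebra.restrictScalars ℚ ℝ _
  exact NormedSpace.exp_continuous

/-- One step of the Ahlswede–Winter argument: Golden–Thompson separates `A` from `S`, `exp A` is
dominated by `1 + A + A * A`, and independence replaces this polynomial by its mean, which is at
most `1 + V` in the form order. -/
theorem integral_trace_exp_add_le [IsProbabilityMeasure μ] {S A : Ω → Matrix n n ℝ}
    (hS : Measurable S) (hA : Measurable A) (hSs : ∀ ω, (S ω).IsSymm) (hAs : ∀ ω, (A ω).IsSymm)
    {c : ℝ} (hc : ∀ ω i j, |S ω i j| ≤ c) (hb : ∀ ω u, |u ⬝ᵥ A ω *ᵥ u| ≤ u ⬝ᵥ u)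
    (hmean : ∀ i j, ∫ ω, A ω i j ∂μ = 0) {V : ℝ}
    (hvar : ∀ u, ∫ ω, (A ω *ᵥ u) ⬝ᵥ (A ω *ᵥ u) ∂μ ≤ V * (u ⬝ᵥ u)) (hind : IndepFun S A μ) :
    ∫ ω, (NormedSpace.exp (S ω + A ω)).trace ∂μ ≤
      (1 + V) * ∫ ω, (NormedSpace.exp (S ω)).trace ∂μ := by
  have hAc : ∀ ω i j, |A ω i j| ≤ 3 * 1 := fun ω =>
    abs_apply_le_of_abs_dotProduct_le (hAs ω) (by simpa using hb ω)
  have htr : Continuous fun S : Matrix n n ℝ => (NormedSpace.exp S).trace :=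
    continuous_matrix_exp.matrix_trace
  have hexp : ∀ i j, Continuous fun S : Matrix n n ℝ => NormedSpace.exp S i j := fun i j =>
    (continuous_matrix_exp).matrix_elem i j
  have hintE : ∀ i j, Integrable (fun ω => NormedSpace.exp (S ω) i j) μ := fun i j =>
    integrable_comp_of_bounded_entries hS hc (hexp i j)
  have hpoly : ∀ i j, Continuous fun A : Matrix n n ℝ => (1 + A + A * A) i j := fun i j => by
    fun_prop
  have hintA : ∀ i j, Integrable (fun ω => (1 + A ω + A ω * A ω) i j) μ := fun i j =>
    integrable_comp_of_bounded_entries hA hAc (hpoly i j)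
  have hintA1 : ∀ i j, Integrable (fun ω => A ω i j) μ := fun i j =>
    integrable_comp_of_bounded_entries hA hAc (f := fun A => A i j) (by fun_prop)
  have hintA2 : ∀ i j, Integrable (fun ω => (A ω * A ω) i j) μ := fun i j =>
    integrable_comp_of_bounded_entries hA hAc (f := fun A => (A * A) i j) (by fun_prop)
  have hindij : ∀ i j, IndepFun (fun ω => NormedSpace.exp (S ω) i j)
      (fun ω => (1 + A ω + A ω * A ω) j i) μ := fun i j =>
    hind.comp (φ := fun S : Matrix n n ℝ => NormedSpace.exp S i j)
      (ψ := fun A : Matrix n n ℝ => (1 + A + A * A) j i) (hexp i j).measurable (hpoly j i).measurable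
  -- `D` is the entrywise mean of the polynomial; the linear term vanishes and the quadratic one is
  -- controlled by `V`.
  set D : Matrix n n ℝ := Matrix.of fun i j => ∫ ω, (1 + A ω + A ω * A ω) i j ∂μ with hD
  have hDle : ∀ u, u ⬝ᵥ D *ᵥ u ≤ u ⬝ᵥ ((1 + V) • (1 : Matrix n n ℝ)) *ᵥ u := by
    intro u
    have e0 : ∀ i j, D i j = (1 : Matrix n n ℝ) i j + ∫ ω, (A ω * A ω) i j ∂μ := by
      intro i j
      simp only [hD, Matrix.of_apply, Matrix.add_apply]
      have h1 : Integrable (fun ω => (1 : Matrix n n ℝ) i j + A ω i j) μ :=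
        (integrable_const _).add (hintA1 i j)
      rw [integral_add h1 (hintA2 i j), integral_add (integrable_const _) (hintA1 i j), hmean]
      simp
    have e1 : u ⬝ᵥ D *ᵥ u = u ⬝ᵥ u + ∫ ω, (A ω *ᵥ u) ⬝ᵥ (A ω *ᵥ u) ∂μ := by
      have e2 : ∀ ω, (A ω *ᵥ u) ⬝ᵥ (A ω *ᵥ u) = ∑ i, ∑ j, u i * ((A ω * A ω) i j * u j) := by
        intro ω
        rw [dotProduct_mulVec, ← mulVec_transpose, (hAs ω).eq, mulVec_mulVec, dotProduct_comm]
        simp only [dotProduct, mulVec, Finset.mul_sum]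
      simp_rw [e2]
      rw [integral_finsetSum _ fun i _ => integrable_finsetSum _ fun j _ =>
        ((hintA2 i j).mul_const _).const_mul _]
      simp_rw [integral_finsetSum _ fun j _ => ((hintA2 _ j).mul_const _).const_mul _,
        integral_const_mul, integral_mul_const]
      have e3 : u ⬝ᵥ u = u ⬝ᵥ (1 : Matrix n n ℝ) *ᵥ u := by rw [one_mulVec]
      rw [e3]
      simp only [dotProduct, mulVec, Finset.mul_sum, e0, ← Finset.sum_add_distrib]
      exact Finset.sum_congr rfl fun i _ => Finset.sum_congr rfl fun j _ => by ring
    rw [e1, smul_mulVec, one_mulVec, dotProduct_smul, smul_eq_mul]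
    linarith [hvar u]
  have hSA : Integrable (fun ω => (NormedSpace.exp (S ω + A ω)).trace) μ := by
    refine integrable_comp_of_bounded_entries (c := c + 3 * 1) (hS.add hA) (fun ω i j => ?_) htr
    exact (abs_add_le _ _).trans (add_le_add (hc ω i j) (hAc ω i j))
  have hprod : ∀ i j, Integrable
      (fun ω => NormedSpace.exp (S ω) i j * (1 + A ω + A ω * A ω) j i) μ := fun i j =>
    (hindij i j).integrable_mul (hintE i j) (hintA j i)
  calc ∫ ω, (NormedSpace.exp (S ω + A ω)).trace ∂μ
      ≤ ∫ ω, ∑ i, ∑ j, NormedSpace.exp (S ω) i j * (1 + A ω + A ω * A ω) j i ∂μ := by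
        refine integral_mono hSA (integrable_finsetSum _ fun i _ => integrable_finsetSum _
          fun j _ => hprod i j) fun ω => ?_
        refine (trace_exp_add_le (hSs ω) (hAs ω)).trans
          ((trace_exp_mul_le (hSs ω) (dotProduct_exp_le (hAs ω) (hb ω))).trans (le_of_eq ?_))
        simp only [Matrix.trace, Matrix.diag, Matrix.mul_apply (M := NormedSpace.exp (S ω))]
    _ = ∑ i, ∑ j, (∫ ω, NormedSpace.exp (S ω) i j ∂μ) * D j i := by
        rw [integral_finsetSum _ fun i _ => integrable_finsetSum _ fun j _ => hprod i j]
        refine Finset.sum_congr rfl fun i _ => ?_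
        rw [integral_finsetSum _ fun j _ => hprod i j]
        refine Finset.sum_congr rfl fun j _ => ?_
        exact (hindij i j).integral_fun_mul_eq_mul_integral (hintE i j).aestronglyMeasurable
          (hintA j i).aestronglyMeasurable
    _ = ∫ ω, (NormedSpace.exp (S ω) * D).trace ∂μ := by
        simp only [Matrix.trace, Matrix.diag, Matrix.mul_apply]
        rw [integral_finsetSum _ fun i _ => integrable_finsetSum _ fun j _ =>
          (hintE i j).mul_const _]
        refine Finset.sum_congr rfl fun i _ => ?_
        rw [integral_finsetSum _ fun j _ => (hintE i j).mul_const _]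
        simp_rw [integral_mul_const]
    _ ≤ ∫ ω, (1 + V) * (NormedSpace.exp (S ω)).trace ∂μ := by
        refine integral_mono (integrable_comp_of_bounded_entries hS hc
          (f := fun S => (NormedSpace.exp S * D).trace)
          (continuous_matrix_exp.matrix_mul continuous_const).matrix_trace)
          ((integrable_comp_of_bounded_entries hS hc htr).const_mul _) fun ω => ?_
        refine (trace_exp_mul_le (hSs ω) hDle).trans (le_of_eq ?_)
        rw [Matrix.mul_smul, Matrix.mul_one, trace_smul, smul_eq_mul]
    _ = _ := integral_const_mul _ _

/-- Each summand costs a factor `1 + V`; the empty sum contributes the trace of the identity. -/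
theorem integral_trace_exp_sum_le [IsProbabilityMeasure μ] {ι : Type*} {A : ι → Ω → Matrix n n ℝ}
    (hA : ∀ m, Measurable (A m)) (hAs : ∀ m ω, (A m ω).IsSymm)
    (hb : ∀ m ω u, |u ⬝ᵥ A m ω *ᵥ u| ≤ u ⬝ᵥ u) (hmean : ∀ m i j, ∫ ω, A m ω i j ∂μ = 0)
    {V : ℝ} (hV : 0 ≤ V)
    (hvar : ∀ m u, ∫ ω, (A m ω *ᵥ u) ⬝ᵥ (A m ω *ᵥ u) ∂μ ≤ V * (u ⬝ᵥ u))
    (hind : iIndepFun A μ) (s : Finset ι) :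
    ∫ ω, (NormedSpace.exp (∑ m ∈ s, A m ω)).trace ∂μ ≤ (1 + V) ^ s.card * Fintype.card n := by
  classical
  induction s using Finset.induction_on with
  | empty => simp
  | insert m s hm ih =>
    have hind' : IndepFun (fun ω => ∑ m ∈ s, A m ω) (A m) μ := by
      have := iIndepFun.indepFun_finsetSum_of_notMem hind hA hm
      convert this using 1
      ext ω
      simp
    have key := integral_trace_exp_add_le (c := s.card * (3 * 1)) (V := V)
      (Finset.measurable_fun_sum s fun m _ => hA m) (hA m)
      (fun ω => by
        rw [Matrix.IsSymm, Matrix.transpose_sum]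
        exact Finset.sum_congr rfl fun m _ => hAs m ω) (hAs m)
      (fun ω i j => by
        rw [Matrix.sum_apply, ← nsmul_eq_mul]
        exact (Finset.abs_sum_le_sum_abs _ _).trans (Finset.sum_le_card_nsmul _ _ _ fun m _ =>
          abs_apply_le_of_abs_dotProduct_le (hAs m ω) (by simpa using hb m ω) i j))
      (hb m) (hmean m) (hvar m) hind'
    rw [Finset.card_insert_of_notMem hm, pow_succ']
    calc _ = ∫ ω, (NormedSpace.exp (∑ m ∈ s, A m ω + A m ω)).trace ∂μ := by
          simp_rw [Finset.sum_insert hm, add_comm]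
      _ ≤ _ := key
      _ ≤ (1 + V) * ((1 + V) ^ s.card * Fintype.card n) := by gcongr
      _ = _ := by ring

/-- Matrix Bernstein inequality (upper tail), with a free parameter `θ`. -/
theorem measure_exists_lt_dotProduct_sum_le [IsProbabilityMeasure μ] {ι : Type*}
    {A : ι → Ω → Matrix n n ℝ}
    (hA : ∀ m, Measurable (A m)) (hAs : ∀ m ω, (A m ω).IsSymm) {R : ℝ}
    (hb : ∀ m ω u, |u ⬝ᵥ A m ω *ᵥ u| ≤ R * (u ⬝ᵥ u)) (hmean : ∀ m i j, ∫ ω, A m ω i j ∂μ = 0)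
    {V : ℝ} (hV : 0 ≤ V)
    (hvar : ∀ m u, ∫ ω, (A m ω *ᵥ u) ⬝ᵥ (A m ω *ᵥ u) ∂μ ≤ V * (u ⬝ᵥ u))
    (hind : iIndepFun A μ) (s : Finset ι) {θ : ℝ} (hθ : 0 < θ) (hθR : θ * R ≤ 1) (t : ℝ) :
    μ {ω | ∃ u, t * (u ⬝ᵥ u) < u ⬝ᵥ (∑ m ∈ s, A m ω) *ᵥ u} ≤
      ENNReal.ofReal (Fintype.card n * Real.exp (θ ^ 2 * V * s.card - θ * t)) := by
  have hθm : ∀ m, Measurable fun ω => θ • A m ω := fun m => (hA m).const_smul θ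
  have key := integral_trace_exp_sum_le (A := fun m ω => θ • A m ω) (V := θ ^ 2 * V) (μ := μ)
    hθm (fun m ω => (hAs m ω).smul θ)
    (fun m ω u => by
      rw [smul_mulVec, dotProduct_smul, smul_eq_mul, abs_mul, abs_of_pos hθ]
      have h0 : 0 ≤ u ⬝ᵥ u := Finset.sum_nonneg fun i _ => mul_self_nonneg _
      calc θ * |u ⬝ᵥ A m ω *ᵥ u| ≤ θ * (R * (u ⬝ᵥ u)) := by gcongr; exact hb m ω u
        _ = (θ * R) * (u ⬝ᵥ u) := by ring
        _ ≤ 1 * (u ⬝ᵥ u) := by gcongr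
        _ = _ := one_mul _)
    (fun m i j => by simp [integral_const_mul, hmean])
    (by positivity)
    (fun m u => by
      simp_rw [smul_mulVec, smul_dotProduct, dotProduct_smul, smul_eq_mul, integral_const_mul]
      have := hvar m u
      calc _ = θ ^ 2 * ∫ ω, (A m ω *ᵥ u) ⬝ᵥ (A m ω *ᵥ u) ∂μ := by ring
        _ ≤ θ ^ 2 * (V * (u ⬝ᵥ u)) := by gcongr
        _ = _ := by ring)
    (hind.comp (fun _ B => θ • B) fun _ => measurable_const_smul θ) s
  have hsymm : ∀ ω, (∑ m ∈ s, θ • A m ω).IsSymm := fun ω => by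
    rw [Matrix.IsSymm, Matrix.transpose_sum]
    exact Finset.sum_congr rfl fun m _ => (hAs m ω).smul θ
  have hc : ∀ ω i j, |(∑ m ∈ s, θ • A m ω) i j| ≤ s.card * (θ * (3 * R)) := fun ω i j => by
    rw [Matrix.sum_apply, ← nsmul_eq_mul]
    refine (Finset.abs_sum_le_sum_abs _ _).trans (Finset.sum_le_card_nsmul _ _ _ fun m _ => ?_)
    rw [Matrix.smul_apply, smul_eq_mul, abs_mul, abs_of_pos hθ]
    have := abs_apply_le_of_abs_dotProduct_le (hAs m ω) (hb m ω) i j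
    gcongr
  have hint := integrable_comp_of_bounded_entries (μ := μ)
    (Finset.measurable_fun_sum s fun m _ => hθm m) hc continuous_matrix_exp.matrix_trace
  have hmarkov := mul_meas_ge_le_integral_of_nonneg (μ := μ)
    (f := fun ω => (NormedSpace.exp (∑ m ∈ s, θ • A m ω)).trace)
    (Filter.Eventually.of_forall fun ω => trace_exp_nonneg (hsymm ω)) hint (Real.exp (θ * t))
  -- A large value of the form forces a large trace of the exponential, to which Markov's inequality
  -- applies.
  have hsub : {ω | ∃ u, t * (u ⬝ᵥ u) < u ⬝ᵥ (∑ m ∈ s, A m ω) *ᵥ u} ⊆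
      {ω | Real.exp (θ * t) ≤ (NormedSpace.exp (∑ m ∈ s, θ • A m ω)).trace} := by
    rintro ω ⟨u, hu⟩
    refine exp_le_trace_exp (hsymm ω) (u := u) ?_
    rw [← Finset.smul_sum, smul_mulVec, dotProduct_smul, smul_eq_mul, mul_assoc]
    exact mul_lt_mul_of_pos_left hu hθ
  refine (measure_mono hsub).trans ?_
  rw [ENNReal.le_ofReal_iff_toReal_le (measure_ne_top _ _) (by positivity)]
  have hpow : (1 + θ ^ 2 * V) ^ s.card ≤ Real.exp (θ ^ 2 * V * s.card) := by
    rw [mul_comm (θ ^ 2 * V) (s.card : ℝ), Real.exp_nat_mul]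
    refine pow_le_pow_left₀ (by positivity) ?_ _
    linarith [Real.add_one_le_exp (θ ^ 2 * V)]
  have h2 : Real.exp (θ * t) * (μ {ω | Real.exp (θ * t) ≤
      (NormedSpace.exp (∑ m ∈ s, θ • A m ω)).trace}).toReal ≤
      Real.exp (θ ^ 2 * V * s.card) * Fintype.card n := by
    refine (hmarkov.trans key).trans ?_
    gcongr
  rw [Real.exp_sub, ← mul_div_assoc, le_div_iff₀ (Real.exp_pos _)]
  linarith

end Bernstein

end MixedLDS

namespace MixedLDS

/-! ### Exponential moments of Gaussian quadratic forms. -/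

section Chaos

/-- The left side is the exponential moment of `s * (g ^ 2 - 1)` for a standard Gaussian `g`. After
squaring, a lower bound on the exponential leaves a polynomial inequality; the quadratic bound is
needed for `s ≥ 0`, the linear one suffices for `s ≤ 0`. -/
theorem exp_neg_mul_rpow_le {s : ℝ} (hs : |s| ≤ 1 / 4) :
    Real.exp (-s) * Real.sqrt (1 / (1 - 2 * s)) ≤ Real.exp (2 * s ^ 2) := by
  obtain ⟨h1, h2⟩ := abs_le.1 hs
  have hpos : 0 < 1 - 2 * s := by linarith
  have key : 1 / (1 - 2 * s) ≤ Real.exp (2 * s + 4 * s ^ 2) := by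
    rw [div_le_iff₀ hpos]
    rcases le_total 0 s with h | h
    · have h3 := Real.quadratic_le_exp_of_nonneg (x := 2 * s + 4 * s ^ 2) (by positivity)
      refine le_trans ?_ (mul_le_mul_of_nonneg_right h3 hpos.le)
      have : 0 ≤ s ^ 2 * (1 - 2 * s - 4 * s ^ 2 - 8 * s ^ 3) := by
        apply mul_nonneg (sq_nonneg _)
        have : s ^ 2 ≤ 1 / 16 := by nlinarith
        have : s ^ 3 ≤ 1 / 64 := by nlinarith
        linarith
      nlinarith
    · have h3 := Real.add_one_le_exp (2 * s + 4 * s ^ 2)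
      refine le_trans ?_ (mul_le_mul_of_nonneg_right h3 hpos.le)
      have : s ^ 3 ≤ 0 := by nlinarith [sq_nonneg s]
      nlinarith
  have h4 : Real.sqrt (1 / (1 - 2 * s)) ≤ Real.exp (s + 2 * s ^ 2) := by
    rw [Real.sqrt_le_left (Real.exp_pos _).le, ← Real.exp_nat_mul]
    refine key.trans (le_of_eq ?_)
    congr 1; push_cast; ring
  calc Real.exp (-s) * Real.sqrt (1 / (1 - 2 * s))
      ≤ Real.exp (-s) * Real.exp (s + 2 * s ^ 2) := by gcongr
    _ = _ := by rw [← Real.exp_add]; ring_nf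

theorem integrable_exp_sq_sub_one_gaussianReal {s : ℝ} (hs : |s| ≤ 1 / 4) :
    Integrable (fun x => Real.exp (s * (x ^ 2 - 1))) (gaussianReal 0 1) ∧
      ∫ x, Real.exp (s * (x ^ 2 - 1)) ∂(gaussianReal 0 1) ≤ Real.exp (2 * s ^ 2) := by
  have hb : 0 < 1 / 2 - s := by linarith [(abs_le.1 hs).2]
  have hpdf : ∀ x : ℝ, gaussianPDFReal 0 1 x • Real.exp (s * (x ^ 2 - 1)) =
      ((Real.sqrt (2 * Real.pi))⁻¹ * Real.exp (-s)) * Real.exp (-(1 / 2 - s) * x ^ 2) := by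
    intro x
    rw [gaussianPDFReal, smul_eq_mul, mul_assoc, mul_assoc _ (Real.exp _) (Real.exp _),
      ← Real.exp_add, ← Real.exp_add]
    simp only [NNReal.coe_one, mul_one]
    ring_nf
  constructor
  · rw [gaussianReal_of_var_ne_zero 0 one_ne_zero]
    rw [integrable_withDensity_iff_integrable_smul' (measurable_gaussianPDF _ _)
      (Filter.Eventually.of_forall fun _ => gaussianPDF_lt_top)]
    simp only [toReal_gaussianPDF, hpdf]
    exact (integrable_exp_neg_mul_sq hb).const_mul _
  · rw [integral_gaussianReal_eq_integral_smul one_ne_zero]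
    simp only [hpdf]
    rw [integral_const_mul, integral_gaussian]
    refine le_trans (le_of_eq ?_) (exp_neg_mul_rpow_le hs)
    have h5 : Real.pi / (1 / 2 - s) = (2 * Real.pi) * (1 / (1 - 2 * s)) := by
      have : 1 - 2 * s ≠ 0 := by linarith
      field_simp
    have h6 : Real.sqrt (2 * Real.pi) ≠ 0 := by positivity
    rw [h5, Real.sqrt_mul (by positivity : 0 ≤ 2 * Real.pi) (1 / (1 - 2 * s))]
    calc _ = (Real.sqrt (2 * Real.pi))⁻¹ * Real.sqrt (2 * Real.pi) *
          (Real.exp (-s) * Real.sqrt (1 / (1 - 2 * s))) := by ring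
      _ = _ := by rw [inv_mul_cancel₀ h6, one_mul]

variable {ι : Type*} [Fintype ι] [DecidableEq ι]

/-- Rotation invariance: in an eigenbasis of `B` the centered form is a sum of independent terms `l
i * (x i ^ 2 - 1)`, so the moment factors. The condition on `c` gives `|c * l i| ≤ 1 / 4`, the range
of the scalar estimate. -/
theorem integral_exp_quadratic_stdGaussian_le {B : Matrix ι ι ℝ} (hB : B.IsSymm) {c : ℝ}
    (hc : 16 * c ^ 2 * (B * B).trace ≤ 1) :
    Integrable (fun g : EuclideanSpace ℝ ι => Real.exp (c * (g.ofLp ⬝ᵥ B *ᵥ g.ofLp - B.trace)))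
      (stdGaussian (EuclideanSpace ℝ ι)) ∧
    ∫ g : EuclideanSpace ℝ ι, Real.exp (c * (g.ofLp ⬝ᵥ B *ᵥ g.ofLp - B.trace))
      ∂(stdGaussian (EuclideanSpace ℝ ι)) ≤ Real.exp (2 * c ^ 2 * (B * B).trace) := by
  obtain ⟨b, U, l, hb, hU, hU', rfl⟩ := exists_orthonormalBasis_diagonalization hB
  have htr : (U * diagonal l * Uᵀ).trace = ∑ i, l i := by
    rw [Matrix.trace_mul_comm, ← Matrix.mul_assoc, hU, Matrix.one_mul, trace_diagonal]
  have htr2 : (U * diagonal l * Uᵀ * (U * diagonal l * Uᵀ)).trace = ∑ i, l i ^ 2 := by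
    calc _ = (U * diagonal l * (Uᵀ * U) * diagonal l * Uᵀ).trace := by
          simp only [Matrix.mul_assoc]
      _ = ∑ i, l i ^ 2 := by
        rw [hU, Matrix.mul_one, Matrix.mul_assoc U, diagonal_mul_diagonal, Matrix.trace_mul_comm,
          ← Matrix.mul_assoc, hU, Matrix.one_mul, trace_diagonal]
        exact Finset.sum_congr rfl fun i _ => (pow_two _).symm
  rw [htr2] at hc
  rw [htr, htr2]
  have hmeas : Measurable fun x : ι → ℝ => ∑ i, x i • b i := by fun_prop
  have hquad : ∀ x : ι → ℝ, (∑ i, x i • b i).ofLp ⬝ᵥ (U * diagonal l * Uᵀ) *ᵥ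
      (∑ i, x i • b i).ofLp - ∑ i, l i = ∑ i, l i * (x i ^ 2 - 1) := by
    intro x
    have hx : (∑ i, x i • b i).ofLp = U *ᵥ x := by
      ext j
      simp only [WithLp.ofLp_sum, WithLp.ofLp_smul, Finset.sum_apply, Pi.smul_apply, smul_eq_mul,
        mulVec, dotProduct, hb]
      exact Finset.sum_congr rfl fun i _ => mul_comm _ _
    rw [hx, dotProduct_conj_diagonal, mulVec_mulVec, hU, one_mulVec, ← Finset.sum_sub_distrib]
    exact Finset.sum_congr rfl fun i _ => by ring
  have hprod : ∀ x : ι → ℝ, Real.exp (c * ∑ i, l i * (x i ^ 2 - 1)) =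
      ∏ i, Real.exp (c * l i * (x i ^ 2 - 1)) := by
    intro x
    rw [← Real.exp_sum, Finset.mul_sum]
    simp only [mul_assoc]
  have hsmall : ∀ i, |c * l i| ≤ 1 / 4 := by
    intro i
    have h1 : l i ^ 2 ≤ ∑ i, l i ^ 2 :=
      Finset.single_le_sum (f := fun i => l i ^ 2) (fun j _ => sq_nonneg _) (Finset.mem_univ i)
    apply abs_le_of_sq_le_sq _ (by norm_num)
    nlinarith [mul_le_mul_of_nonneg_left h1 (sq_nonneg c)]
  have hF : Continuous fun g : EuclideanSpace ℝ ι => Real.exp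
      (c * (g.ofLp ⬝ᵥ (U * diagonal l * Uᵀ) *ᵥ g.ofLp - ∑ i, l i)) := by fun_prop
  rw [stdGaussian_eq_map_pi_orthonormalBasis b]
  constructor
  · rw [integrable_map_measure hF.aestronglyMeasurable hmeas.aemeasurable]
    simp only [Function.comp_def, hquad, hprod]
    exact Integrable.fintype_prod fun i => (integrable_exp_sq_sub_one_gaussianReal (hsmall i)).1
  · rw [integral_map hmeas.aemeasurable hF.aestronglyMeasurable]
    simp only [hquad, hprod]
    rw [integral_fintype_prod_eq_prod (f := fun i x => Real.exp (c * l i * (x ^ 2 - 1)))]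
    calc _ ≤ ∏ i, Real.exp (2 * (c * l i) ^ 2) :=
          Finset.prod_le_prod (fun i _ => integral_nonneg fun _ => (Real.exp_pos _).le)
            fun i _ => (integrable_exp_sq_sub_one_gaussianReal (hsmall i)).2
      _ = _ := by
        rw [← Real.exp_sum, Finset.mul_sum]
        congr 1
        exact Finset.sum_congr rfl fun i _ => by ring

variable {Ω : Type*} [MeasurableSpace Ω] {μ : Measure Ω}

/-- A Gaussian law is determined by its mean and covariance. -/
theorem map_eq_multivariateGaussian [IsProbabilityMeasure μ] {Z : Ω → EuclideanSpace ℝ ι}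
    (hZ : HasGaussianLaw Z μ) (hmean : ∀ a, ∫ ω, Z ω a ∂μ = 0) {C : Matrix ι ι ℝ}
    (hC : ∀ a b, ∫ ω, Z ω a * Z ω b ∂μ = C a b) :
    C.PosSemidef ∧ μ.map Z = multivariateGaussian 0 C := by
  have hG : IsGaussian (μ.map Z) := hZ.isGaussian_map
  have hm2 : MemLp Z 2 μ := hZ.memLp_two
  have hco : ∀ a, MemLp (fun ω => Z ω a) 2 μ := fun a =>
    (EuclideanSpace.proj (𝕜 := ℝ) a : EuclideanSpace ℝ ι →L[ℝ] ℝ).comp_memLp' hm2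
  have hm2' : MemLp id 2 (μ.map Z) := IsGaussian.memLp_two_id
  have hid : (μ.map Z)[id] = 0 := by
    rw [integral_map hZ.aemeasurable aestronglyMeasurable_id]
    simp only [id]
    ext a
    have := (EuclideanSpace.proj (𝕜 := ℝ) a : EuclideanSpace ℝ ι →L[ℝ] ℝ).integral_comp_comm
      (hm2.integrable one_le_two)
    exact this.symm.trans (hmean a)
  have hcov : ∀ x y : EuclideanSpace ℝ ι, covarianceBilin (μ.map Z) x y = x.ofLp ⬝ᵥ C *ᵥ y.ofLp := by
    intro x y
    rw [covarianceBilin_apply hm2', hid, integral_map hZ.aemeasurable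
      (Continuous.aestronglyMeasurable (by fun_prop))]
    have e : ∀ ω, inner ℝ x (Z ω - 0) * inner ℝ y (Z ω - 0) =
        ∑ a, ∑ b, x a * (Z ω a * Z ω b * y b) := by
      intro ω
      simp only [sub_zero, PiLp.inner_apply, RCLike.inner_apply, conj_trivial, Finset.sum_mul_sum]
      exact Finset.sum_congr rfl fun a _ => Finset.sum_congr rfl fun b _ => by ring
    have hint : ∀ a b, Integrable (fun ω => x a * (Z ω a * Z ω b * y b)) μ := fun a b =>
      (((hco a).integrable_mul (hco b)).mul_const _).const_mul _
    simp_rw [e]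
    rw [integral_finsetSum _ fun a _ => integrable_finsetSum _ fun b _ => hint a b]
    simp only [dotProduct, mulVec, Finset.mul_sum]
    refine Finset.sum_congr rfl fun a _ => ?_
    rw [integral_finsetSum _ fun b _ => hint a b]
    refine Finset.sum_congr rfl fun b _ => ?_
    rw [integral_const_mul, integral_mul_const, hC]
  have hpos : C.PosSemidef := by
    refine Matrix.PosSemidef.of_dotProduct_mulVec_nonneg ?_ fun x => ?_
    · ext a b
      rw [conjTranspose_apply, star_trivial, ← hC, ← hC]
      simp only [mul_comm]
    · have := covarianceBilin_self_nonneg (μ := μ.map Z) (WithLp.toLp 2 x)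
      rw [hcov] at this
      simpa using this
  refine ⟨hpos, IsGaussian.ext (by rw [hid]; simp) ?_⟩
  ext x y
  rw [hcov, covarianceBilin_multivariateGaussian hpos]

/-- In law `Z` is `Q g` with `g` standard and `Q` the square root of `C`. This replaces `J` by `Q *
J * Q`, and cyclicity of the trace expresses the required traces through `J * C`. -/
theorem integral_exp_quadratic_le [IsProbabilityMeasure μ] {Z : Ω → EuclideanSpace ℝ ι}
    (hZ : HasGaussianLaw Z μ) (hmean : ∀ a, ∫ ω, Z ω a ∂μ = 0) {C : Matrix ι ι ℝ}
    (hC : ∀ a b, ∫ ω, Z ω a * Z ω b ∂μ = C a b) {J : Matrix ι ι ℝ} (hJ : J.IsSymm) {c v : ℝ}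
    (hv : (J * C * J * C).trace ≤ v) (hc : 16 * c ^ 2 * v ≤ 1) :
    Integrable (fun ω => Real.exp (c * ((Z ω).ofLp ⬝ᵥ J *ᵥ (Z ω).ofLp - (J * C).trace))) μ ∧
    ∫ ω, Real.exp (c * ((Z ω).ofLp ⬝ᵥ J *ᵥ (Z ω).ofLp - (J * C).trace)) ∂μ ≤
      Real.exp (2 * c ^ 2 * v) := by
  obtain ⟨hpos, hmap⟩ := map_eq_multivariateGaussian hZ hmean hC
  open scoped MatrixOrder in
  obtain ⟨Q, hQs, hQQ, hQ⟩ : ∃ Q : Matrix ι ι ℝ, Qᵀ = Q ∧ Q * Q = C ∧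
      μ.map Z = (stdGaussian (EuclideanSpace ℝ ι)).map
        (fun x => toEuclideanCLM (n := ι) (𝕜 := ℝ) Q x) := by
    refine ⟨CFC.sqrt C, ?_, CFC.sqrt_mul_sqrt_self _ hpos.nonneg, ?_⟩
    · have := (CFC.sqrt_nonneg C).isSelfAdjoint.star_eq
      rwa [star_eq_conjTranspose, conjTranspose_eq_transpose_of_trivial] at this
    · rw [hmap, multivariateGaussian]; simp
  set B := Q * J * Q with hBdef
  have hBs : B.IsSymm := by
    rw [Matrix.IsSymm, hBdef, Matrix.transpose_mul, Matrix.transpose_mul, hQs, hJ.eq,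
      Matrix.mul_assoc]
  have htr : B.trace = (J * C).trace := by
    rw [hBdef, Matrix.mul_assoc, Matrix.trace_mul_comm, Matrix.mul_assoc, hQQ]
  have htr2 : (B * B).trace = (J * C * J * C).trace := by
    calc (B * B).trace = (Q * (J * (Q * Q) * J * Q)).trace := by
          rw [hBdef]; simp only [Matrix.mul_assoc]
      _ = _ := by rw [Matrix.trace_mul_comm, hQQ, Matrix.mul_assoc _ Q Q, hQQ]
  have hc2 : c ^ 2 * (B * B).trace ≤ c ^ 2 * v := by
    rw [htr2]; exact mul_le_mul_of_nonneg_left hv (sq_nonneg c)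
  have hstd := integral_exp_quadratic_stdGaussian_le hBs (c := c) (by linarith)
  have hquad : ∀ g : EuclideanSpace ℝ ι, (toEuclideanCLM (n := ι) (𝕜 := ℝ) Q g).ofLp ⬝ᵥ
      J *ᵥ (toEuclideanCLM (n := ι) (𝕜 := ℝ) Q g).ofLp = g.ofLp ⬝ᵥ B *ᵥ g.ofLp := by
    intro g
    have : (toEuclideanCLM (n := ι) (𝕜 := ℝ) Q g).ofLp = Q *ᵥ g.ofLp := by
      simp [ofLp_toEuclideanCLM]
    rw [this, hBdef, ← mulVec_mulVec, ← mulVec_mulVec, dotProduct_mulVec g.ofLp, ← mulVec_transpose,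
      hQs]
  have hF : Continuous fun z : EuclideanSpace ℝ ι =>
      Real.exp (c * (z.ofLp ⬝ᵥ J *ᵥ z.ofLp - (J * C).trace)) := by fun_prop
  have hmQ : Measurable fun x => toEuclideanCLM (n := ι) (𝕜 := ℝ) Q x := by fun_prop
  constructor
  · have h1 : Integrable (fun z : EuclideanSpace ℝ ι =>
        Real.exp (c * (z.ofLp ⬝ᵥ J *ᵥ z.ofLp - (J * C).trace))) (μ.map Z) := by
      rw [hQ, integrable_map_measure hF.aestronglyMeasurable hmQ.aemeasurable]
      simp only [Function.comp_def, hquad, ← htr]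
      exact hstd.1
    exact h1.comp_aemeasurable hZ.aemeasurable
  · have h2 := integral_map hZ.aemeasurable (hF.aestronglyMeasurable (μ := μ.map Z))
    rw [← h2, hQ, integral_map hmQ.aemeasurable hF.aestronglyMeasurable]
    simp only [hquad, ← htr]
    refine hstd.2.trans (Real.exp_le_exp.2 ?_)
    linarith

end Chaos

end MixedLDS

namespace MixedLDS

/-! ### Exponential moments of bilinear Gaussian forms. -/

theorem trace_fromBlocks {ι : Type*} [Fintype ι] (A B C D : Matrix ι ι ℝ) :
    (fromBlocks A B C D).trace = A.trace + D.trace := by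
  simp [Matrix.trace, Fintype.sum_sum_type]

section BilinearChaos

variable {ι : Type*} [Fintype ι] [DecidableEq ι] {Ω : Type*} [MeasurableSpace Ω] {μ : Measure Ω}

/-- The bilinear form is a quadratic form in the stacked vector `(P, Q)`, whose matrix has half the
identity in each off-diagonal block; `v` bounds the trace of `(J * C) ^ 2`, computed blockwise. -/
theorem integral_exp_bilinear_le [IsProbabilityMeasure μ] {P Q : ι → Ω → ℝ}
    (hZ : HasGaussianLaw (fun ω => (WithLp.toLp 2 (Sum.elim (fun t => P t ω) fun t => Q t ω) :
      EuclideanSpace ℝ (ι ⊕ ι))) μ)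
    (hP : ∀ t, ∫ ω, P t ω ∂μ = 0) (hQ : ∀ t, ∫ ω, Q t ω ∂μ = 0) {Cpp Cpq Cqq : Matrix ι ι ℝ}
    (hpp : ∀ t s, ∫ ω, P t ω * P s ω ∂μ = Cpp t s) (hpq : ∀ t s, ∫ ω, P t ω * Q s ω ∂μ = Cpq t s)
    (hqq : ∀ t s, ∫ ω, Q t ω * Q s ω ∂μ = Cqq t s) {c v : ℝ}
    (hv : ∑ t, ∑ s, (Cpp t s * Cqq s t + Cpq t s * Cpq s t) / 2 ≤ v) (hc : 16 * c ^ 2 * v ≤ 1) :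
    Integrable (fun ω => Real.exp (c * ∑ t, (P t ω * Q t ω - Cpq t t))) μ ∧
    ∫ ω, Real.exp (c * ∑ t, (P t ω * Q t ω - Cpq t t)) ∂μ ≤ Real.exp (2 * c ^ 2 * v) := by
  set C : Matrix (ι ⊕ ι) (ι ⊕ ι) ℝ := fromBlocks Cpp Cpq Cpqᵀ Cqq with hCdef
  set J : Matrix (ι ⊕ ι) (ι ⊕ ι) ℝ :=
    fromBlocks 0 ((1 / 2 : ℝ) • (1 : Matrix ι ι ℝ)) ((1 / 2 : ℝ) • (1 : Matrix ι ι ℝ)) 0 with hJdef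
  have hJs : J.IsSymm := by
    rw [Matrix.IsSymm, hJdef, fromBlocks_transpose]
    simp
  have hJC : J * C = fromBlocks ((1 / 2 : ℝ) • Cpqᵀ) ((1 / 2 : ℝ) • Cqq) ((1 / 2 : ℝ) • Cpp)
      ((1 / 2 : ℝ) • Cpq) := by
    rw [hJdef, hCdef, fromBlocks_multiply]
    simp
  have htr : (J * C).trace = ∑ t, Cpq t t := by
    rw [hJC, trace_fromBlocks]
    simp only [Matrix.trace, Matrix.diag, Matrix.smul_apply, transpose_apply, smul_eq_mul,
      ← Finset.sum_add_distrib]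
    exact Finset.sum_congr rfl fun t _ => by ring
  have htr2 : (J * C * J * C).trace ≤ v := by
    refine le_trans (le_of_eq ?_) hv
    rw [Matrix.mul_assoc, hJC, fromBlocks_multiply, trace_fromBlocks]
    simp only [Matrix.trace, Matrix.diag, Matrix.smul_apply, transpose_apply, smul_eq_mul,
      Matrix.add_apply, Matrix.mul_apply, ← Finset.sum_add_distrib]
    have hsw : ∑ t, ∑ s, Cqq t s * Cpp s t = ∑ t, ∑ s, Cpp t s * Cqq s t := by
      rw [Finset.sum_comm]
      exact Finset.sum_congr rfl fun t _ => Finset.sum_congr rfl fun s _ => by ring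
    have e1 : ∑ x, ∑ y, (1 / 2 * Cpq y x * (1 / 2 * Cpq x y) + 1 / 2 * Cqq x y * (1 / 2 * Cpp y x) +
        (1 / 2 * Cpp x y * (1 / 2 * Cqq y x) + 1 / 2 * Cpq x y * (1 / 2 * Cpq y x))) =
        1 / 2 * (∑ t, ∑ s, Cpq t s * Cpq s t) + 1 / 4 * (∑ t, ∑ s, Cqq t s * Cpp s t) +
        1 / 4 * (∑ t, ∑ s, Cpp t s * Cqq s t) := by
      simp only [Finset.mul_sum, ← Finset.sum_add_distrib]
      exact Finset.sum_congr rfl fun t _ => Finset.sum_congr rfl fun s _ => by ring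
    have e2 : ∑ t, ∑ s, (Cpp t s * Cqq s t + Cpq t s * Cpq s t) / 2 =
        1 / 2 * (∑ t, ∑ s, Cpq t s * Cpq s t) + 1 / 2 * (∑ t, ∑ s, Cpp t s * Cqq s t) := by
      simp only [Finset.mul_sum, ← Finset.sum_add_distrib]
      exact Finset.sum_congr rfl fun t _ => Finset.sum_congr rfl fun s _ => by ring
    rw [e1, e2, hsw]; ring
  have hmean : ∀ a : ι ⊕ ι, ∫ ω, (WithLp.toLp 2 (Sum.elim (fun t => P t ω) fun t => Q t ω) :
      EuclideanSpace ℝ (ι ⊕ ι)) a ∂μ = 0 := by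
    rintro (t | t)
    · exact hP t
    · exact hQ t
  have hcov : ∀ a b : ι ⊕ ι, ∫ ω, (WithLp.toLp 2 (Sum.elim (fun t => P t ω) fun t => Q t ω) :
      EuclideanSpace ℝ (ι ⊕ ι)) a * (WithLp.toLp 2 (Sum.elim (fun t => P t ω) fun t => Q t ω) :
      EuclideanSpace ℝ (ι ⊕ ι)) b ∂μ = C a b := by
    rintro (t | t) (s | s)
    · exact hpp t s
    · exact hpq t s
    · refine Eq.trans ?_ (hpq s t)
      exact integral_congr_ae (Filter.Eventually.of_forall fun ω => mul_comm (Q t ω) (P s ω))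
    · exact hqq t s
  have hquad : ∀ ω, (Sum.elim (fun t => P t ω) fun t => Q t ω) ⬝ᵥ
      J *ᵥ (Sum.elim (fun t => P t ω) fun t => Q t ω) - (J * C).trace =
        ∑ t, (P t ω * Q t ω - Cpq t t) := by
    intro ω
    rw [htr, hJdef, fromBlocks_mulVec]
    simp only [Sum.elim_comp_inl, Sum.elim_comp_inr, zero_mulVec, smul_mulVec, one_mulVec, zero_add,
      add_zero, dotProduct, Fintype.sum_sum_type, Sum.elim_inl, Sum.elim_inr, Pi.smul_apply,
      smul_eq_mul, Finset.sum_sub_distrib, ← Finset.sum_add_distrib]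
    congr 1
    exact Finset.sum_congr rfl fun t _ => by ring
  have := integral_exp_quadratic_le hZ hmean hcov hJs htr2 hc
  simpa only [hquad] using this

end BilinearChaos

/-! ### Second moments and tails from chaos-type exponential moments. -/

section SubExponential

variable {Ω : Type*} [MeasurableSpace Ω] {μ : Measure Ω}

/-- `X` has the exponential moments of a quadratic Gaussian chaos of variance proxy `v`. -/
def HasChaosMGF (X : Ω → ℝ) (v : ℝ) (μ : Measure Ω) : Prop :=
  ∀ c : ℝ, 16 * c ^ 2 * v ≤ 1 → Integrable (fun ω => Real.exp (c * X ω)) μ ∧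
    ∫ ω, Real.exp (c * X ω) ∂μ ≤ Real.exp (2 * c ^ 2 * v)

theorem exp_one_div_eight_le : Real.exp (1 / 8) ≤ 8 / 7 := by
  have h := Real.add_one_le_exp (-(1 / 8 : ℝ))
  rw [Real.exp_neg] at h
  have hp := Real.exp_pos (1 / 8 : ℝ)
  have h2 : (7 / 8 : ℝ) * Real.exp (1 / 8) ≤ 1 := by
    calc (7 / 8 : ℝ) * Real.exp (1 / 8) ≤ (Real.exp (1 / 8))⁻¹ * Real.exp (1 / 8) := by
          gcongr; linarith
      _ = 1 := inv_mul_cancel₀ hp.ne'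
  linarith

/-- The right side is `4 * sinh (x / 2) ^ 2`, and `y ≤ sinh y` for `y ≥ 0`. -/
theorem sq_le_exp_add_exp_neg_sub_two (x : ℝ) : x ^ 2 ≤ Real.exp x + Real.exp (-x) - 2 := by
  wlog h : 0 ≤ x generalizing x with H
  · have := H (-x) (by linarith)
    rw [neg_neg] at this
    linarith [neg_sq x]
  · have h1 : x / 2 ≤ Real.sinh (x / 2) := Real.self_le_sinh_iff.2 (by linarith)
    have h2 : (x / 2) ^ 2 ≤ Real.sinh (x / 2) ^ 2 := pow_le_pow_left₀ (by linarith) h1 2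
    have e1 : Real.exp x = Real.exp (x / 2) ^ 2 := by
      rw [← Real.exp_nat_mul]; congr 1; push_cast; ring
    have e2 : Real.exp (-x) = Real.exp (-(x / 2)) ^ 2 := by
      rw [← Real.exp_nat_mul]; congr 1; push_cast; ring
    have e3 : Real.exp (x / 2) * Real.exp (-(x / 2)) = 1 := by rw [← Real.exp_add]; simp
    rw [Real.sinh_eq] at h2
    rw [e1, e2]
    nlinarith

namespace HasChaosMGF

variable {X : Ω → ℝ} {v : ℝ}

theorem mono {v' : ℝ} (h : HasChaosMGF X v μ) (hv : v ≤ v') : HasChaosMGF X v' μ := by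
  intro c hc
  have h1 : c ^ 2 * v ≤ c ^ 2 * v' := mul_le_mul_of_nonneg_left hv (sq_nonneg c)
  obtain ⟨h2, h3⟩ := h c (by linarith)
  exact ⟨h2, h3.trans (Real.exp_le_exp.2 (by linarith))⟩

theorem const_mul (h : HasChaosMGF X v μ) (a : ℝ) : HasChaosMGF (fun ω => a * X ω)
    (a ^ 2 * v) μ := by
  intro c hc
  obtain ⟨h1, h2⟩ := h (c * a) ((le_of_eq (by ring)).trans hc)
  have e : ∀ ω, c * (a * X ω) = c * a * X ω := fun ω => by ring
  simp only [e]
  exact ⟨h1, h2.trans (le_of_eq (by congr 1; ring))⟩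

/-- The square is dominated by the exponential moments at `c` and `-c`, with the largest admissible
`c = 1 / (4 √v)`; the constant comes from `16 * (2 * exp (1 / 8) - 2) ≤ 5`. -/
theorem integrable_sq_and_le (h : HasChaosMGF X v μ) (hv : 0 < v) (hX : Measurable X)
    [IsProbabilityMeasure μ] : Integrable (fun ω => X ω ^ 2) μ ∧ ∫ ω, X ω ^ 2 ∂μ ≤ 5 * v := by
  set c := 1 / (4 * Real.sqrt v) with hc
  have hsv : 0 < Real.sqrt v := Real.sqrt_pos.2 hv
  have hc2 : c ^ 2 * v = 1 / 16 := by
    rw [hc, div_pow, mul_pow, Real.sq_sqrt hv.le]; field_simp; norm_num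
  have hcpos : 0 < c := by positivity
  obtain ⟨i1, b1⟩ := h c (by linarith)
  obtain ⟨i2, b2⟩ := h (-c) (by rw [neg_sq]; linarith)
  have hle : ∀ ω, c ^ 2 * X ω ^ 2 ≤ Real.exp (c * X ω) + Real.exp (-c * X ω) - 2 := by
    intro ω
    have := sq_le_exp_add_exp_neg_sub_two (c * X ω)
    rw [mul_pow] at this
    simpa only [neg_mul] using this
  have isum : Integrable (fun ω => Real.exp (c * X ω) + Real.exp (-c * X ω) - 2) μ :=
    (i1.add i2).sub (integrable_const _)
  have hint : Integrable (fun ω => c ^ 2 * X ω ^ 2) μ := by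
    refine isum.mono ((hX.pow_const 2).const_mul _).aestronglyMeasurable
      (Filter.Eventually.of_forall fun ω => ?_)
    rw [Real.norm_of_nonneg (by positivity)]
    exact (hle ω).trans (le_abs_self _)
  have hint' : Integrable (fun ω => X ω ^ 2) μ := by
    have := hint.const_mul (c ^ 2)⁻¹
    refine this.congr (Filter.Eventually.of_forall fun ω => ?_)
    field_simp
  refine ⟨hint', ?_⟩
  have h3 : c ^ 2 * ∫ ω, X ω ^ 2 ∂μ ≤ 2 * Real.exp (1 / 8) - 2 := by
    rw [← integral_const_mul]
    refine (integral_mono hint isum hle).trans ?_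
    have e1 : ∫ ω, (Real.exp (c * X ω) + Real.exp (-c * X ω) - 2) ∂μ =
        ∫ ω, Real.exp (c * X ω) ∂μ + ∫ ω, Real.exp (-c * X ω) ∂μ - 2 := by
      have i3 : Integrable (fun ω => Real.exp (c * X ω) + Real.exp (-c * X ω)) μ := i1.add i2
      rw [integral_sub i3 (integrable_const _), integral_add i1 i2]
      simp
    rw [e1]
    have e2 : 2 * c ^ 2 * v = 1 / 8 := by linarith
    have e3 : 2 * (-c) ^ 2 * v = 1 / 8 := by rw [neg_sq]; linarith
    rw [e2] at b1
    rw [e3] at b2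
    linarith
  have h4 := exp_one_div_eight_le
  have h5 : c ^ 2 * ∫ ω, X ω ^ 2 ∂μ ≤ c ^ 2 * (5 * v) := by nlinarith
  exact le_of_mul_le_mul_left h5 (by positivity)

/-- Chernoff's bound on both sides at the extreme admissible parameter; the `3` absorbs `2 * exp (1
/ 8)`. -/
theorem measure_abs_gt_le (h : HasChaosMGF X v μ) (hv : 0 < v) [IsProbabilityMeasure μ] (s : ℝ) :
    μ {ω | 4 * Real.sqrt v * s < |X ω|} ≤ ENNReal.ofReal (3 * Real.exp (-s)) := by
  set c := 1 / (4 * Real.sqrt v) with hc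
  have hsv : 0 < Real.sqrt v := Real.sqrt_pos.2 hv
  have hc2 : c ^ 2 * v = 1 / 16 := by
    rw [hc, div_pow, mul_pow, Real.sq_sqrt hv.le]; field_simp; norm_num
  have hcpos : 0 < c := by positivity
  obtain ⟨i1, b1⟩ := h c (by linarith)
  obtain ⟨i2, b2⟩ := h (-c) (by rw [neg_sq]; linarith)
  have hm := mul_meas_ge_le_integral_of_nonneg (μ := μ)
    (f := fun ω => Real.exp (c * X ω) + Real.exp (-c * X ω))
    (Filter.Eventually.of_forall fun ω => (add_pos (Real.exp_pos _) (Real.exp_pos _)).le)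
    (i1.add i2) (Real.exp s)
  have hsub : {ω | 4 * Real.sqrt v * s < |X ω|} ⊆
      {ω | Real.exp s ≤ Real.exp (c * X ω) + Real.exp (-c * X ω)} := by
    intro ω hω
    simp only [Set.mem_ofPred_eq] at hω ⊢
    have h1 : s < c * |X ω| := by
      rw [hc, one_div, inv_mul_eq_div, lt_div_iff₀ (by positivity)]
      linarith
    rcases abs_cases (X ω) with ⟨h2, -⟩ | ⟨h2, -⟩
    · rw [h2] at h1
      have := Real.exp_le_exp.2 h1.le
      linarith [Real.exp_pos (-c * X ω)]
    · rw [h2] at h1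
      have := Real.exp_le_exp.2 h1.le
      rw [mul_neg, ← neg_mul] at this
      linarith [Real.exp_pos (c * X ω)]
  refine (measure_mono hsub).trans ?_
  rw [ENNReal.le_ofReal_iff_toReal_le (measure_ne_top _ _) (by positivity), Real.exp_neg,
    ← div_eq_mul_inv, le_div_iff₀ (Real.exp_pos _), mul_comm]
  refine hm.trans ?_
  rw [integral_add i1 i2]
  have e2 : 2 * c ^ 2 * v = 1 / 8 := by linarith
  have e3 : 2 * (-c) ^ 2 * v = 1 / 8 := by rw [neg_sq]; linarith
  rw [e2] at b1
  rw [e3] at b2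
  linarith [exp_one_div_eight_le]

end HasChaosMGF

end SubExponential

/-! ### Cauchy–Schwarz and spectral norm estimates. -/

section LinearAlgebra

theorem sq_dotProduct_le {n : Type*} [Fintype n] (u v : n → ℝ) :
    (u ⬝ᵥ v) ^ 2 ≤ (u ⬝ᵥ u) * (v ⬝ᵥ v) := by
  have := Finset.sum_mul_sq_le_sq_mul_sq Finset.univ u v
  simpa only [dotProduct, pow_two] using this

theorem dotProduct_self_nonneg' {n : Type*} [Fintype n] (u : n → ℝ) : 0 ≤ u ⬝ᵥ u :=
  Finset.sum_nonneg fun _ _ => mul_self_nonneg _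

/-- Ordinary Cauchy–Schwarz for the images of `u` and `v` under the square root of `M`. -/
theorem PosSemidef.sq_dotProduct_mulVec_le {n : Type*} [Fintype n] {M : Matrix n n ℝ}
    (hM : M.PosSemidef) (u v : n → ℝ) :
    (u ⬝ᵥ M *ᵥ v) ^ 2 ≤ (u ⬝ᵥ M *ᵥ u) * (v ⬝ᵥ M *ᵥ v) := by
  classical
  open scoped MatrixOrder in
  obtain ⟨Q, hQs, rfl⟩ : ∃ Q : Matrix n n ℝ, Qᵀ = Q ∧ Q * Q = M := by
    refine ⟨CFC.sqrt M, ?_, CFC.sqrt_mul_sqrt_self _ hM.nonneg⟩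
    have := (CFC.sqrt_nonneg M).isSelfAdjoint.star_eq
    rwa [star_eq_conjTranspose, conjTranspose_eq_transpose_of_trivial] at this
  have h : ∀ x y : n → ℝ, x ⬝ᵥ (Q * Q) *ᵥ y = (Q *ᵥ x) ⬝ᵥ (Q *ᵥ y) := fun x y => by
    rw [← mulVec_mulVec, dotProduct_mulVec, ← mulVec_transpose, hQs]
  rw [h, h, h]
  exact sq_dotProduct_le _ _

theorem norm_toLp_sq {n : Type*} [Fintype n] (u : n → ℝ) :
    ‖(WithLp.toLp 2 u : EuclideanSpace ℝ n)‖ ^ 2 = u ⬝ᵥ u := by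
  rw [EuclideanSpace.real_norm_sq_eq]
  simp only [dotProduct, pow_two]

variable {d : ℕ}

theorem mulVec_dotProduct_self_le_specNorm (B : Matrix (Fin d) (Fin d) ℝ) (v : Fin d → ℝ) :
    (B *ᵥ v) ⬝ᵥ (B *ᵥ v) ≤ specNorm B ^ 2 * (v ⬝ᵥ v) := by
  have h := (toEuclideanCLM (n := Fin d) (𝕜 := ℝ) B).le_opNorm (WithLp.toLp 2 v)
  have h2 := pow_le_pow_left₀ (norm_nonneg _) h 2
  have h3 : toEuclideanCLM (n := Fin d) (𝕜 := ℝ) B (WithLp.toLp 2 v) = WithLp.toLp 2 (B *ᵥ v) := by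
    simp
  rw [h3, mul_pow, norm_toLp_sq, norm_toLp_sq] at h2
  exact h2

/-- Since `‖Bᵀ v‖² = ⟨v, B Bᵀ v⟩`, Cauchy–Schwarz and the bound for `B` leave one factor `‖Bᵀ v‖²`
to cancel. -/
theorem transpose_mulVec_dotProduct_self_le_specNorm (B : Matrix (Fin d) (Fin d) ℝ)
    (v : Fin d → ℝ) : (Bᵀ *ᵥ v) ⬝ᵥ (Bᵀ *ᵥ v) ≤ specNorm B ^ 2 * (v ⬝ᵥ v) := by
  have h1 : (Bᵀ *ᵥ v) ⬝ᵥ (Bᵀ *ᵥ v) = v ⬝ᵥ B *ᵥ (Bᵀ *ᵥ v) := by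
    rw [dotProduct_mulVec v, ← mulVec_transpose]
  have h2 := sq_dotProduct_le v (B *ᵥ (Bᵀ *ᵥ v))
  have h3 := mulVec_dotProduct_self_le_specNorm B (Bᵀ *ᵥ v)
  have h4 := dotProduct_self_nonneg' v
  have h5 := dotProduct_self_nonneg' (Bᵀ *ᵥ v)
  rw [← h1] at h2
  rcases h5.eq_or_lt with h6 | h6
  · rw [← h6]; positivity
  · have h7 : ((Bᵀ *ᵥ v) ⬝ᵥ (Bᵀ *ᵥ v)) ^ 2 ≤
        (v ⬝ᵥ v) * (specNorm B ^ 2 * ((Bᵀ *ᵥ v) ⬝ᵥ (Bᵀ *ᵥ v))) :=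
      h2.trans (mul_le_mul_of_nonneg_left h3 h4)
    rw [pow_two] at h7
    have h8 : ((Bᵀ *ᵥ v) ⬝ᵥ (Bᵀ *ᵥ v)) * ((Bᵀ *ᵥ v) ⬝ᵥ (Bᵀ *ᵥ v)) ≤
        (specNorm B ^ 2 * (v ⬝ᵥ v)) * ((Bᵀ *ᵥ v) ⬝ᵥ (Bᵀ *ᵥ v)) := by linarith
    exact le_of_mul_le_mul_right h8 h6

end LinearAlgebra

end MixedLDS

namespace MixedLDS

/-! ### Stationary and finite-time autocovariances of a stable system. -/

section Autocov

variable {d : ℕ} {A W : Matrix (Fin d) (Fin d) ℝ}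

/-- Covariance matrix at time `s` of the linear dynamical system `(A, W)` started at zero. -/
noncomputable def finAutocov (A W : Matrix (Fin d) (Fin d) ℝ) (s : ℕ) : Matrix (Fin d) (Fin d) ℝ :=
  ∑ r ∈ Finset.range s, A ^ r * W * (A ^ r)ᵀ

theorem dotProduct_mul_mul_transpose_mulVec (B M : Matrix (Fin d) (Fin d) ℝ) (u v : Fin d → ℝ) :
    u ⬝ᵥ (B * M * Bᵀ) *ᵥ v = (Bᵀ *ᵥ u) ⬝ᵥ M *ᵥ (Bᵀ *ᵥ v) := by
  rw [← mulVec_mulVec, ← mulVec_mulVec, dotProduct_mulVec u B, ← mulVec_transpose]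

theorem dotProduct_mulVec_le_specNorm (B : Matrix (Fin d) (Fin d) ℝ) (u : Fin d → ℝ) :
    u ⬝ᵥ B *ᵥ u ≤ specNorm B * (u ⬝ᵥ u) := by
  have h0 := dotProduct_self_nonneg' u
  have hs : 0 ≤ specNorm B := norm_nonneg _
  refine le_of_sq_le_sq ?_ (by positivity)
  calc (u ⬝ᵥ B *ᵥ u) ^ 2 ≤ (u ⬝ᵥ u) * ((B *ᵥ u) ⬝ᵥ (B *ᵥ u)) := sq_dotProduct_le _ _
    _ ≤ (u ⬝ᵥ u) * (specNorm B ^ 2 * (u ⬝ᵥ u)) := by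
      gcongr; exact mulVec_dotProduct_self_le_specNorm B u
    _ = _ := by ring

/-- Stability and boundedness of a single linear dynamical system. -/
structure StableSystem (A W : Matrix (Fin d) (Fin d) ℝ) (κ ρ G : ℝ) : Prop where
  posDef : W.PosDef
  one_le_kappa : 1 ≤ κ
  rho_nonneg : 0 ≤ ρ
  rho_lt_one : ρ < 1
  stable : ∀ t : ℕ, 1 ≤ t → specNorm (A ^ t) ≤ κ * ρ ^ t
  bounded : specNorm (autocovZero A W) ≤ G

namespace StableSystem

variable {κ ρ G : ℝ}

theorem G_nonneg (h : StableSystem A W κ ρ G) : 0 ≤ G := (norm_nonneg _).trans h.bounded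

theorem transpose_pow_mulVec_le (h : StableSystem A W κ ρ G) (t : ℕ) (u : Fin d → ℝ) :
    ((A ^ t)ᵀ *ᵥ u) ⬝ᵥ ((A ^ t)ᵀ *ᵥ u) ≤ (κ * ρ ^ t) ^ 2 * (u ⬝ᵥ u) := by
  have h0 := dotProduct_self_nonneg' u
  rcases Nat.eq_zero_or_pos t with rfl | ht
  · have := h.one_le_kappa
    simp only [pow_zero, transpose_one, one_mulVec, mul_one]
    exact le_mul_of_one_le_left h0 (one_le_pow₀ this)
  · refine (transpose_mulVec_dotProduct_self_le_specNorm _ _).trans ?_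
    gcongr
    · exact norm_nonneg _
    · exact h.stable t ht

theorem pow_mulVec_le (h : StableSystem A W κ ρ G) (t : ℕ) (u : Fin d → ℝ) :
    ((A ^ t) *ᵥ u) ⬝ᵥ ((A ^ t) *ᵥ u) ≤ (κ * ρ ^ t) ^ 2 * (u ⬝ᵥ u) := by
  have h0 := dotProduct_self_nonneg' u
  rcases Nat.eq_zero_or_pos t with rfl | ht
  · have := h.one_le_kappa
    simp only [pow_zero, one_mulVec, mul_one]
    exact le_mul_of_one_le_left h0 (one_le_pow₀ this)
  · refine (mulVec_dotProduct_self_le_specNorm _ _).trans ?_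
    gcongr
    · exact norm_nonneg _
    · exact h.stable t ht

theorem term_nonneg (h : StableSystem A W κ ρ G) (t : ℕ) (u : Fin d → ℝ) : 0 ≤ u ⬝ᵥ
    (A ^ t * W * (A ^ t)ᵀ) *ᵥ u := by
  rw [dotProduct_mul_mul_transpose_mulVec]
  simpa using h.posDef.posSemidef.dotProduct_mulVec_nonneg ((A ^ t)ᵀ *ᵥ u)

theorem term_le (h : StableSystem A W κ ρ G) (t : ℕ) (u : Fin d → ℝ) :
    u ⬝ᵥ (A ^ t * W * (A ^ t)ᵀ) *ᵥ u ≤ specNorm W * ((κ * ρ ^ t) ^ 2 * (u ⬝ᵥ u)) := by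
  rw [dotProduct_mul_mul_transpose_mulVec]
  refine (dotProduct_mulVec_le_specNorm _ _).trans ?_
  exact mul_le_mul_of_nonneg_left (h.transpose_pow_mulVec_le t u) (norm_nonneg _)

theorem sq_term_le (h : StableSystem A W κ ρ G) (t : ℕ) (u v : Fin d → ℝ) :
    (u ⬝ᵥ (A ^ t * W * (A ^ t)ᵀ) *ᵥ v) ^ 2 ≤
    (u ⬝ᵥ (A ^ t * W * (A ^ t)ᵀ) *ᵥ u) * (v ⬝ᵥ (A ^ t * W * (A ^ t)ᵀ) *ᵥ v) := by
  simp only [dotProduct_mul_mul_transpose_mulVec]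
  exact PosSemidef.sq_dotProduct_mulVec_le h.posDef.posSemidef _ _

/-- Entrywise, Cauchy–Schwarz for the form and exponential stability give a geometric majorant. -/
theorem summable_terms (h : StableSystem A W κ ρ G) : Summable fun t : ℕ => A ^ t * W *
    (A ^ t)ᵀ := by
  have hρ := h.rho_nonneg
  have hρ1 := h.rho_lt_one
  have hgeom : Summable fun t : ℕ => specNorm W * κ ^ 2 * (ρ ^ 2) ^ t :=
    (summable_geometric_of_lt_one (sq_nonneg ρ) (by nlinarith)).mul_left _
  have hs : 0 ≤ specNorm W := norm_nonneg _
  refine Pi.summable.2 fun i => Pi.summable.2 fun j => ?_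
  refine Summable.of_norm_bounded hgeom fun t => ?_
  have e : (A ^ t * W * (A ^ t)ᵀ) i j =
      Pi.single i 1 ⬝ᵥ (A ^ t * W * (A ^ t)ᵀ) *ᵥ Pi.single j 1 := by simp
  rw [e, Real.norm_eq_abs]
  have hi := h.term_le t (Pi.single i 1)
  have hj := h.term_le t (Pi.single j 1)
  have hj0 := h.term_nonneg t (Pi.single j 1)
  have e1 : ∀ i : Fin d, (Pi.single i 1 : Fin d → ℝ) ⬝ᵥ Pi.single i 1 = 1 := fun i => by simp
  rw [e1] at hi hj
  refine abs_le_of_sq_le_sq ?_ (by positivity)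
  refine (h.sq_term_le t _ _).trans ?_
  have := mul_le_mul hi hj hj0 (by positivity)
  refine this.trans (le_of_eq ?_)
  rw [← pow_mul]; ring

theorem hasSum_dotProduct (h : StableSystem A W κ ρ G) (u v : Fin d → ℝ) :
    HasSum (fun t : ℕ => u ⬝ᵥ (A ^ t * W * (A ^ t)ᵀ) *ᵥ v) (u ⬝ᵥ autocovZero A W *ᵥ v) := by
  let g : Matrix (Fin d) (Fin d) ℝ →+ ℝ :=
    { toFun := fun M => u ⬝ᵥ M *ᵥ v
      map_zero' := by simp
      map_add' := fun M N => by rw [add_mulVec, dotProduct_add] }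
  have hg : Continuous g := by
    change Continuous fun M : Matrix (Fin d) (Fin d) ℝ => u ⬝ᵥ M *ᵥ v
    fun_prop
  exact h.summable_terms.hasSum.map g hg

theorem dotProduct_finAutocov (s : ℕ) (u v : Fin d → ℝ) :
    u ⬝ᵥ finAutocov A W s *ᵥ v = ∑ t ∈ Finset.range s, u ⬝ᵥ (A ^ t * W * (A ^ t)ᵀ) *ᵥ v := by
  rw [finAutocov, sum_mulVec, dotProduct_sum]

theorem dotProduct_finAutocov_nonneg (h : StableSystem A W κ ρ G) (s : ℕ) (u : Fin d → ℝ) :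
    0 ≤ u ⬝ᵥ finAutocov A W s *ᵥ u := by
  rw [dotProduct_finAutocov]
  exact Finset.sum_nonneg fun t _ => h.term_nonneg t u

theorem dotProduct_finAutocov_le (h : StableSystem A W κ ρ G) (s : ℕ) (u : Fin d → ℝ) :
    u ⬝ᵥ finAutocov A W s *ᵥ u ≤ u ⬝ᵥ autocovZero A W *ᵥ u := by
  rw [dotProduct_finAutocov]
  exact sum_le_hasSum _ (fun t _ => h.term_nonneg t u) (h.hasSum_dotProduct u u)

theorem dotProduct_autocovZero_nonneg (h : StableSystem A W κ ρ G) (u : Fin d → ℝ) :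
    0 ≤ u ⬝ᵥ autocovZero A W *ᵥ u :=
  (h.dotProduct_finAutocov_nonneg 0 u).trans (h.dotProduct_finAutocov_le 0 u)

theorem dotProduct_autocovZero_le (h : StableSystem A W κ ρ G) (u : Fin d → ℝ) :
    u ⬝ᵥ autocovZero A W *ᵥ u ≤ G * (u ⬝ᵥ u) :=
  (dotProduct_mulVec_le_specNorm _ u).trans
    (mul_le_mul_of_nonneg_right h.bounded (dotProduct_self_nonneg' u))

theorem G_pos (h : StableSystem A W κ ρ G) (hd : 0 < d) : 0 < G := by
  let e : Fin d → ℝ := Pi.single ⟨0, hd⟩ 1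
  have h1 := (h.dotProduct_finAutocov_le 1 e).trans (h.dotProduct_autocovZero_le e)
  have h2 : e ⬝ᵥ finAutocov A W 1 *ᵥ e = e ⬝ᵥ W *ᵥ e := by simp [finAutocov]
  have h3 : 0 < e ⬝ᵥ W *ᵥ e := by
    have he : e ≠ 0 := fun h0 => by simpa [e] using congrFun h0 ⟨0, hd⟩
    simpa using h.posDef.dotProduct_mulVec_pos he
  have h4 : e ⬝ᵥ e = 1 := by simp [e]
  rw [h2, h4, mul_one] at h1
  linarith

theorem isSymm_term (h : StableSystem A W κ ρ G) (t : ℕ) : (A ^ t * W * (A ^ t)ᵀ).IsSymm := by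
  have hW : Wᵀ = W := by
    have := h.posDef.isHermitian
    rwa [Matrix.IsHermitian, conjTranspose_eq_transpose_of_trivial] at this
  rw [Matrix.IsSymm, transpose_mul, transpose_mul, transpose_transpose, hW, Matrix.mul_assoc]

theorem posSemidef_finAutocov (h : StableSystem A W κ ρ G) (s : ℕ) :
    (finAutocov A W s).PosSemidef := by
  refine Matrix.PosSemidef.of_dotProduct_mulVec_nonneg ?_ fun u => by
    simpa using h.dotProduct_finAutocov_nonneg s u
  rw [Matrix.IsHermitian, conjTranspose_eq_transpose_of_trivial, finAutocov, transpose_sum]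
  exact Finset.sum_congr rfl fun t _ => h.isSymm_term t

theorem isSymm_autocovZero (h : StableSystem A W κ ρ G) : (autocovZero A W).IsSymm := by
  rw [Matrix.IsSymm, autocovZero, Matrix.transpose_tsum]
  exact tsum_congr fun t => h.isSymm_term t

theorem posSemidef_autocovZero (h : StableSystem A W κ ρ G) : (autocovZero A W).PosSemidef := by
  refine Matrix.PosSemidef.of_dotProduct_mulVec_nonneg ?_ fun u => by
    simpa using h.dotProduct_autocovZero_nonneg u
  rw [Matrix.IsHermitian, conjTranspose_eq_transpose_of_trivial]
  exact h.isSymm_autocovZero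

/-- The tail of the series after `s` terms is the whole series conjugated by `A ^ s`. -/
theorem dotProduct_autocovZero_eq (h : StableSystem A W κ ρ G) (s : ℕ) (u v : Fin d → ℝ) :
    u ⬝ᵥ autocovZero A W *ᵥ v = u ⬝ᵥ finAutocov A W s *ᵥ v +
      ((A ^ s)ᵀ *ᵥ u) ⬝ᵥ autocovZero A W *ᵥ ((A ^ s)ᵀ *ᵥ v) := by
  have h1 := h.hasSum_dotProduct u v
  have h2 := h.hasSum_dotProduct ((A ^ s)ᵀ *ᵥ u) ((A ^ s)ᵀ *ᵥ v)
  have h3 : ∀ t : ℕ, ((A ^ s)ᵀ *ᵥ u) ⬝ᵥ (A ^ t * W * (A ^ t)ᵀ) *ᵥ ((A ^ s)ᵀ *ᵥ v) =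
      u ⬝ᵥ (A ^ (t + s) * W * (A ^ (t + s))ᵀ) *ᵥ v := by
    intro t
    rw [dotProduct_mul_mul_transpose_mulVec (A ^ t), dotProduct_mul_mul_transpose_mulVec (A ^ (t + s)),
      mulVec_mulVec u (A ^ t)ᵀ, mulVec_mulVec v (A ^ t)ᵀ, ← transpose_mul, ← pow_add, add_comm s t]
  simp only [h3] at h2
  rw [dotProduct_finAutocov, add_comm]
  exact h1.unique ((hasSum_nat_add_iff s).1 h2)

/-- The removed partial sum is nonnegative, so conjugation by `A ^ s` shrinks the stationary
covariance with no factor `κ`. -/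
theorem pow_dotProduct_autocovZero_le (h : StableSystem A W κ ρ G) (s : ℕ) (u : Fin d → ℝ) :
    ((A ^ s)ᵀ *ᵥ u) ⬝ᵥ autocovZero A W *ᵥ ((A ^ s)ᵀ *ᵥ u) ≤ u ⬝ᵥ autocovZero A W *ᵥ u := by
  rw [h.dotProduct_autocovZero_eq s u u]
  linarith [h.dotProduct_finAutocov_nonneg s u]

theorem pow_dotProduct_autocovZero_le_min (h : StableSystem A W κ ρ G) (s : ℕ) (u : Fin d → ℝ) :
    ((A ^ s)ᵀ *ᵥ u) ⬝ᵥ autocovZero A W *ᵥ ((A ^ s)ᵀ *ᵥ u) ≤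
      G * (min 1 (κ * ρ ^ s)) ^ 2 * (u ⬝ᵥ u) := by
  rcases min_cases 1 (κ * ρ ^ s) with ⟨e, -⟩ | ⟨e, -⟩ <;> rw [e]
  · refine (h.pow_dotProduct_autocovZero_le s u).trans ?_
    simpa using h.dotProduct_autocovZero_le u
  · refine (h.dotProduct_autocovZero_le _).trans ?_
    rw [mul_assoc]
    exact mul_le_mul_of_nonneg_left (h.transpose_pow_mulVec_le s u) h.G_nonneg

/-- Cauchy–Schwarz in the form of `finAutocov`, which is dominated by the stationary form: one
factor decays with the lag, the other is at most `G`. -/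
theorem sq_dotProduct_pow_finAutocov_le (h : StableSystem A W κ ρ G) (k s : ℕ) (u v : Fin d → ℝ) :
    (u ⬝ᵥ (A ^ k * finAutocov A W s) *ᵥ v) ^ 2 ≤
      (G * min 1 (κ * ρ ^ k)) ^ 2 * ((u ⬝ᵥ u) * (v ⬝ᵥ v)) := by
  rw [← mulVec_mulVec, dotProduct_mulVec, ← mulVec_transpose]
  refine (PosSemidef.sq_dotProduct_mulVec_le (h.posSemidef_finAutocov s) _ _).trans ?_
  have h1 := (h.dotProduct_finAutocov_le s _).trans (h.pow_dotProduct_autocovZero_le_min k u)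
  have h2 := (h.dotProduct_finAutocov_le s _).trans (h.dotProduct_autocovZero_le v)
  refine (mul_le_mul h1 h2 (h.dotProduct_finAutocov_nonneg s v) ?_).trans (le_of_eq (by ring))
  have := h.G_nonneg
  have := dotProduct_self_nonneg' u
  positivity

theorem sq_dotProduct_pow_autocovZero_le (h : StableSystem A W κ ρ G) (b : ℕ) (u v : Fin d → ℝ) :
    (u ⬝ᵥ (A ^ b * autocovZero A W) *ᵥ v) ^ 2 ≤ G ^ 2 * ((u ⬝ᵥ u) * (v ⬝ᵥ v)) := by
  rw [← mulVec_mulVec, dotProduct_mulVec, ← mulVec_transpose]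
  refine (PosSemidef.sq_dotProduct_mulVec_le h.posSemidef_autocovZero _ _).trans ?_
  have h1 := (h.pow_dotProduct_autocovZero_le b u).trans (h.dotProduct_autocovZero_le u)
  have h2 := h.dotProduct_autocovZero_le v
  refine (mul_le_mul h1 h2 (h.dotProduct_autocovZero_nonneg v) ?_).trans (le_of_eq (by ring))
  have := h.G_nonneg
  have := dotProduct_self_nonneg' u
  positivity

/-- The difference is the tail of the series. Decay in `s` is taken from the side of `v`; on the
side of `u` the contraction of the stationary form suffices. -/
theorem sq_dotProduct_pow_autocovZero_sub_le (h : StableSystem A W κ ρ G) (b s : ℕ)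
    (u v : Fin d → ℝ) :
    (u ⬝ᵥ (A ^ b * autocovZero A W) *ᵥ v - u ⬝ᵥ (A ^ b * finAutocov A W s) *ᵥ v) ^ 2 ≤
      (G * (κ * ρ ^ s)) ^ 2 * ((u ⬝ᵥ u) * (v ⬝ᵥ v)) := by
  rw [← mulVec_mulVec, ← mulVec_mulVec, dotProduct_mulVec u, dotProduct_mulVec u,
    ← mulVec_transpose, h.dotProduct_autocovZero_eq s, add_sub_cancel_left]
  refine (PosSemidef.sq_dotProduct_mulVec_le h.posSemidef_autocovZero _ _).trans ?_
  have h1 := ((h.pow_dotProduct_autocovZero_le s _).trans (h.pow_dotProduct_autocovZero_le b u)).trans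
    (h.dotProduct_autocovZero_le u)
  have h2 := (h.dotProduct_autocovZero_le ((A ^ s)ᵀ *ᵥ v)).trans
    (mul_le_mul_of_nonneg_left (h.transpose_pow_mulVec_le s v) h.G_nonneg)
  refine (mul_le_mul h1 h2 (h.dotProduct_autocovZero_nonneg _) ?_).trans (le_of_eq (by ring))
  have := h.G_nonneg
  have := dotProduct_self_nonneg' u
  positivity

/-- The first `r₀` terms are at most `1`, the later ones lie below a geometric series. So `κ` enters
the correlation time only through `r₀`, which can be taken logarithmic in `κ`. -/
theorem sum_min_le (h : StableSystem A W κ ρ G) {r₀ : ℕ} (hr : κ * ρ ^ r₀ ≤ 1) (n : ℕ) :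
    ∑ k ∈ Finset.range n, min 1 (κ * ρ ^ k) ≤ r₀ + 1 / (1 - ρ) := by
  have hρ := h.rho_nonneg
  have hκ := h.one_le_kappa
  have h1 : ∑ k ∈ Finset.range n, min 1 (κ * ρ ^ k) ≤
      ∑ k ∈ Finset.range (r₀ + n), min 1 (κ * ρ ^ k) :=
    Finset.sum_le_sum_of_subset_of_nonneg (Finset.range_mono (Nat.le_add_left n r₀))
      fun k _ _ => by positivity
  refine h1.trans ?_
  rw [Finset.sum_range_add]
  refine add_le_add ?_ ?_
  · calc _ ≤ ∑ k ∈ Finset.range r₀, (1 : ℝ) := Finset.sum_le_sum fun k _ => min_le_left _ _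
      _ = r₀ := by simp
  · have h2 : ∀ k, min 1 (κ * ρ ^ (r₀ + k)) ≤ ρ ^ k := fun k => by
      refine (min_le_right _ _).trans ?_
      rw [pow_add, ← mul_assoc]
      exact mul_le_of_le_one_left (by positivity) hr
    refine (Finset.sum_le_sum fun k _ => h2 k).trans ?_
    rw [one_div, ← tsum_geometric_of_lt_one hρ h.rho_lt_one]
    exact (summable_geometric_of_lt_one hρ h.rho_lt_one).sum_le_tsum _ fun k _ => by positivity

end StableSystem

end Autocov

end MixedLDS

namespace MixedLDS

/-! ### Zero-started systems driven by Gaussian noise. -/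

section ZeroStarted

variable {d : ℕ} {A W : Matrix (Fin d) (Fin d) ℝ} {Ω : Type*} [MeasurableSpace Ω] {μ : Measure Ω}

/-- State at time `t` of the linear dynamical system with transition matrix `A`, started at zero and
driven by the noise `w`. -/
noncomputable def zeroState (A : Matrix (Fin d) (Fin d) ℝ) (w : ℕ → EuclideanSpace ℝ (Fin d))
    (t : ℕ) : EuclideanSpace ℝ (Fin d) :=
  ∑ r ∈ Finset.range t, toEuclideanCLM (n := Fin d) (𝕜 := ℝ) (A ^ (t - 1 - r)) (w r)

theorem zeroState_zero (w : ℕ → EuclideanSpace ℝ (Fin d)) : zeroState A w 0 = 0 := by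
  simp [zeroState]

theorem zeroState_succ (w : ℕ → EuclideanSpace ℝ (Fin d)) (t : ℕ) :
    zeroState A w (t + 1) =
      toEuclideanCLM (n := Fin d) (𝕜 := ℝ) A (zeroState A w t) + w t := by
  rw [zeroState, zeroState, Finset.sum_range_succ, map_sum]
  congr 1
  · refine Finset.sum_congr rfl fun r hr => ?_
    have hr' := Finset.mem_range.1 hr
    rw [← mul_apply_eq_comp, ← map_mul, ← pow_succ']
    congr 3
    omega
  · simp

theorem continuous_zeroState (t : ℕ) :
    Continuous fun w : ℕ → EuclideanSpace ℝ (Fin d) => zeroState A w t := by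
  unfold zeroState
  fun_prop

theorem zeroState_congr {w w' : ℕ → EuclideanSpace ℝ (Fin d)} {t : ℕ} (h : ∀ r < t, w r = w' r) :
    zeroState A w t = zeroState A w' t :=
  Finset.sum_congr rfl fun r hr => by rw [h r (Finset.mem_range.1 hr)]

/-- The first `n` noise vectors are independent centered Gaussian vectors with covariance `W`. -/
structure IsGaussianNoise (w : ℕ → Ω → EuclideanSpace ℝ (Fin d)) (W : Matrix (Fin d) (Fin d) ℝ)
    (n : ℕ) (μ : Measure Ω) : Prop where
  measurable : ∀ r, Measurable (w r)
  law : ∀ r < n, HasLaw (w r) (multivariateGaussian 0 W) μ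
  indep : iIndepFun (fun r : Fin n => w r) μ

/-- Coefficient of `w r` in the linear functional `⟨u, zeroState A w t⟩`. -/
def stateCoef (A : Matrix (Fin d) (Fin d) ℝ) (u : Fin d → ℝ) (t r : ℕ) : Fin d → ℝ :=
  if r < t then (A ^ (t - 1 - r))ᵀ *ᵥ u else 0

/-- The sum runs over all `n` noise vectors, with zero coefficients from `t` on, so that states at
different times are linear in one common family. -/
theorem dotProduct_zeroState (w : ℕ → EuclideanSpace ℝ (Fin d)) (u : Fin d → ℝ) {t n : ℕ}
    (ht : t ≤ n) :
    u ⬝ᵥ (zeroState A w t).ofLp = ∑ r : Fin n, stateCoef A u t r ⬝ᵥ (w r).ofLp := by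
  rw [Fin.sum_univ_eq_sum_range (fun r => stateCoef A u t r ⬝ᵥ (w r).ofLp) n, zeroState,
    WithLp.ofLp_sum, dotProduct_sum]
  rw [← Finset.sum_subset (Finset.range_mono ht)]
  · refine Finset.sum_congr rfl fun r hr => ?_
    rw [stateCoef, if_pos (Finset.mem_range.1 hr), ofLp_toEuclideanCLM, dotProduct_mulVec,
      ← mulVec_transpose]
  · intro r _ hr
    rw [stateCoef, if_neg (by simpa using hr), zero_dotProduct]

namespace IsGaussianNoise

variable {w : ℕ → Ω → EuclideanSpace ℝ (Fin d)} {n : ℕ}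

theorem hasGaussianLaw (hw : IsGaussianNoise w W n μ) {r : ℕ} (hr : r < n) :
    HasGaussianLaw (w r) μ := (hw.law r hr).hasGaussianLaw

theorem memLp_dotProduct (hw : IsGaussianNoise w W n μ) (a : Fin d → ℝ) {r : ℕ} (hr : r < n) :
    MemLp (fun ω => a ⬝ᵥ (w r ω).ofLp) 2 μ := by
  have h := ((hw.law r hr).hasGaussianLaw).memLp_two
  have h2 := h.const_inner (𝕜 := ℝ) (WithLp.toLp 2 a)
  refine h2.ae_eq (Filter.Eventually.of_forall fun ω => ?_)
  simp [PiLp.inner_apply, dotProduct, mul_comm]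

theorem integral_dotProduct (hw : IsGaussianNoise w W n μ) (a : Fin d → ℝ) {r : ℕ} (hr : r < n) :
    ∫ ω, a ⬝ᵥ (w r ω).ofLp ∂μ = 0 := by
  have h1 := (hw.law r hr).integral_comp
    (f := fun z : EuclideanSpace ℝ (Fin d) => inner ℝ (WithLp.toLp 2 a) z)
    (Continuous.aestronglyMeasurable (by fun_prop))
  have h2 := integral_inner (𝕜 := ℝ) (μ := multivariateGaussian (0 : EuclideanSpace ℝ (Fin d)) W)
    (f := fun z => z) IsGaussian.integrable_fun_id (WithLp.toLp 2 a)
  rw [integral_id_multivariateGaussian, inner_zero_right] at h2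
  rw [h2] at h1
  refine Eq.trans (integral_congr_ae (Filter.Eventually.of_forall fun ω => ?_)) h1
  simp [PiLp.inner_apply, dotProduct, mul_comm]

theorem integral_dotProduct_mul [IsProbabilityMeasure μ] (hw : IsGaussianNoise w W n μ)
    (hW : W.PosSemidef)
    (a b : Fin d → ℝ) (r q : Fin n) :
    ∫ ω, (a ⬝ᵥ (w r ω).ofLp) * (b ⬝ᵥ (w q ω).ofLp) ∂μ = if r = q then a ⬝ᵥ W *ᵥ b else 0 := by
  split_ifs with h
  · subst h
    have h1 := (hw.law r r.2).integral_comp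
      (f := fun z : EuclideanSpace ℝ (Fin d) => inner ℝ (WithLp.toLp 2 a) z *
        inner ℝ (WithLp.toLp 2 b) z) (Continuous.aestronglyMeasurable (by fun_prop))
    have h2 := covarianceBilin_apply (IsGaussian.memLp_two_id (μ := multivariateGaussian 0 W))
      (WithLp.toLp 2 a) (WithLp.toLp 2 b)
    rw [covarianceBilin_multivariateGaussian hW, integral_id_multivariateGaussian'] at h2
    simp only [sub_zero] at h2
    rw [← h2] at h1
    refine Eq.trans (integral_congr_ae (Filter.Eventually.of_forall fun ω => ?_)) h1
    simp [PiLp.inner_apply, dotProduct, mul_comm]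
  · have hind := hw.indep.indepFun h
    have hm : ∀ a : Fin d → ℝ, Measurable fun z : EuclideanSpace ℝ (Fin d) => a ⬝ᵥ z.ofLp :=
      fun a => Continuous.measurable (by fun_prop)
    have hind2 := hind.comp (hm a) (hm b)
    have := hind2.integral_fun_mul_eq_mul_integral
      ((hm a).comp (hw.measurable r)).aestronglyMeasurable
      ((hm b).comp (hw.measurable q)).aestronglyMeasurable
    simp only [Function.comp_def] at this
    rw [this, hw.integral_dotProduct a r.2, zero_mul]

theorem integral_sum_mul_sum [IsProbabilityMeasure μ] (hw : IsGaussianNoise w W n μ)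
    (hW : W.PosSemidef)
    (a b : Fin n → Fin d → ℝ) :
    ∫ ω, (∑ r, a r ⬝ᵥ (w r ω).ofLp) * (∑ r, b r ⬝ᵥ (w r ω).ofLp) ∂μ =
      ∑ r, a r ⬝ᵥ W *ᵥ b r := by
  have hint : ∀ r q : Fin n, Integrable
      (fun ω => (a r ⬝ᵥ (w r ω).ofLp) * (b q ⬝ᵥ (w q ω).ofLp)) μ := fun r q =>
    (hw.memLp_dotProduct (a r) r.2).integrable_mul (hw.memLp_dotProduct (b q) q.2)
  simp_rw [Finset.sum_mul_sum]
  rw [integral_finsetSum _ fun r _ => integrable_finsetSum _ fun q _ => hint r q]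
  refine Finset.sum_congr rfl fun r _ => ?_
  rw [integral_finsetSum _ fun q _ => hint r q]
  simp_rw [hw.integral_dotProduct_mul hW]
  simp

theorem hasGaussianLaw_linear [IsProbabilityMeasure μ] (hw : IsGaussianNoise w W n μ) {ι : Type*}
    [Fintype ι]
    (c : ι → Fin n → Fin d → ℝ) :
    HasGaussianLaw (fun ω => (WithLp.toLp 2 (fun a => ∑ r, c a r ⬝ᵥ (w r ω).ofLp) :
      EuclideanSpace ℝ ι)) μ := by
  have h1 : HasGaussianLaw (fun ω (r : Fin n) => w r ω) μ :=
    hw.indep.hasGaussianLaw fun r => hw.hasGaussianLaw r.2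
  let L : (Fin n → EuclideanSpace ℝ (Fin d)) →L[ℝ] (ι → ℝ) :=
    ContinuousLinearMap.pi fun a => ∑ r : Fin n,
      (innerSL ℝ (WithLp.toLp 2 (c a r) : EuclideanSpace ℝ (Fin d))).comp
        (ContinuousLinearMap.proj r)
  have h2 := (h1.map_fun L).toLp_pi 2
  convert h2 using 3 with ω
  ext a
  simp [L, PiLp.inner_apply, dotProduct, mul_comm]

theorem integral_dotProduct_zeroState [IsProbabilityMeasure μ] (hw : IsGaussianNoise w W n μ)
    (u : Fin d → ℝ) {t : ℕ}
    (ht : t ≤ n) : ∫ ω, u ⬝ᵥ (zeroState A (fun r => w r ω) t).ofLp ∂μ = 0 := by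
  simp_rw [dotProduct_zeroState _ u ht]
  rw [integral_finsetSum _ fun r _ => (hw.memLp_dotProduct _ r.2).integrable one_le_two]
  exact Finset.sum_eq_zero fun r _ => hw.integral_dotProduct _ r.2

theorem memLp_dotProduct_zeroState (hw : IsGaussianNoise w W n μ) (u : Fin d → ℝ) {t : ℕ}
    (ht : t ≤ n) : MemLp (fun ω => u ⬝ᵥ (zeroState A (fun r => w r ω) t).ofLp) 2 μ := by
  simp_rw [dotProduct_zeroState _ u ht]
  exact memLp_finsetSum _ fun r _ => hw.memLp_dotProduct _ r.2

/-- Only noise before time `s` is shared by the two states. Reflecting the summation index recovers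
the partial sum of autocovariances, with `A ^ k` left over. -/
theorem integral_zeroState_mul [IsProbabilityMeasure μ] (hw : IsGaussianNoise w W n μ)
    (hW : W.PosSemidef)
    (u v : Fin d → ℝ) {s k : ℕ} (ht : s + k ≤ n) :
    ∫ ω, (u ⬝ᵥ (zeroState A (fun r => w r ω) (s + k)).ofLp) *
      (v ⬝ᵥ (zeroState A (fun r => w r ω) s).ofLp) ∂μ = u ⬝ᵥ (A ^ k * finAutocov A W s) *ᵥ v := by
  have hs : s ≤ n := by omega
  simp_rw [dotProduct_zeroState _ u ht, dotProduct_zeroState _ v hs]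
  rw [hw.integral_sum_mul_sum hW,
    Fin.sum_univ_eq_sum_range (fun r => stateCoef A u (s + k) r ⬝ᵥ W *ᵥ stateCoef A v s r) n,
    ← Finset.sum_subset (Finset.range_mono hs), ← Finset.sum_range_reflect, ← mulVec_mulVec,
    dotProduct_mulVec, ← mulVec_transpose, StableSystem.dotProduct_finAutocov]
  · refine Finset.sum_congr rfl fun r hr => ?_
    have hr' := Finset.mem_range.1 hr
    rw [stateCoef, stateCoef, if_pos (by omega), if_pos (by omega),
      dotProduct_mul_mul_transpose_mulVec, mulVec_mulVec u, ← transpose_mul, ← pow_add]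
    congr 4
    · omega
    · congr 2; omega
  · intro r _ hr
    rw [stateCoef, stateCoef, if_neg (by simpa using hr : ¬ r < s), mulVec_zero, dotProduct_zero]

theorem sq_integral_zeroState_mul_le [IsProbabilityMeasure μ] (hw : IsGaussianNoise w W n μ)
    {κ ρ G : ℝ}
    (h : StableSystem A W κ ρ G) (u v : Fin d → ℝ) {t s : ℕ} (ht : t ≤ n) (hs : s ≤ n) :
    (∫ ω, (u ⬝ᵥ (zeroState A (fun r => w r ω) t).ofLp) *
      (v ⬝ᵥ (zeroState A (fun r => w r ω) s).ofLp) ∂μ) ^ 2 ≤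
      (G * min 1 (κ * ρ ^ Nat.dist t s)) ^ 2 * ((u ⬝ᵥ u) * (v ⬝ᵥ v)) := by
  rcases le_total s t with hst | hst
  · obtain ⟨k, rfl⟩ := Nat.exists_eq_add_of_le hst
    have e : Nat.dist (s + k) s = k := by simp [Nat.dist]
    rw [hw.integral_zeroState_mul h.posDef.posSemidef u v ht, e]
    exact h.sq_dotProduct_pow_finAutocov_le k s u v
  · obtain ⟨k, rfl⟩ := Nat.exists_eq_add_of_le hst
    have e : Nat.dist t (t + k) = k := by simp [Nat.dist]
    simp_rw [mul_comm (u ⬝ᵥ _)]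
    rw [hw.integral_zeroState_mul h.posDef.posSemidef v u hs, e]
    exact h.sq_dotProduct_pow_finAutocov_le k t v u

end IsGaussianNoise

/-- Each distance from `t` is attained at most twice, once on either side. -/
theorem sum_dist_le {f : ℕ → ℝ} (hf : ∀ k, 0 ≤ f k) {τ : ℝ}
    (hτ : ∀ m, ∑ k ∈ Finset.range m, f k ≤ τ) (s : Finset ℕ) (t : ℕ) :
    ∑ r ∈ s, f (Nat.dist t r) ≤ 2 * τ := by
  rw [← Finset.sum_filter_add_sum_filter_not s (fun r => r ≤ t)]
  have key : ∀ (s' : Finset ℕ), Set.InjOn (Nat.dist t) s' → ∑ r ∈ s', f (Nat.dist t r) ≤ τ := by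
    intro s' hinj
    rw [← Finset.sum_image (f := f) hinj]
    obtain ⟨m, hm⟩ := (s'.image (Nat.dist t)).exists_nat_subset_range
    exact (Finset.sum_le_sum_of_subset_of_nonneg hm fun k _ _ => hf k).trans (hτ m)
  have h1 := key (s.filter (fun r => r ≤ t)) fun a ha b hb hab => by
    simp only [Finset.coe_filter, Set.mem_ofPred_eq, Nat.dist] at ha hb hab
    omega
  have h2 := key (s.filter (fun r => ¬ r ≤ t)) fun a ha b hb hab => by
    simp only [Finset.coe_filter, Set.mem_ofPred_eq, Nat.dist] at ha hb hab
    omega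
  linarith

/-- The centered empirical covariance over a window is a Gaussian chaos. -/
theorem IsGaussianNoise.hasChaosMGF {w : ℕ → Ω → EuclideanSpace ℝ (Fin d)} {n : ℕ}
    [IsProbabilityMeasure μ] (hw : IsGaussianNoise w W n μ) {κ ρ G τ : ℝ}
    (h : StableSystem A W κ ρ G) (hτ : ∀ m, ∑ k ∈ Finset.range m, min 1 (κ * ρ ^ k) ≤ τ)
    {u v : Fin d → ℝ} (hu : u ⬝ᵥ u ≤ 1) (hv : v ⬝ᵥ v ≤ 1) (s : Finset ℕ) (b : ℕ)
    (hs : ∀ t ∈ s, t + b ≤ n) :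
    HasChaosMGF (fun ω => (s.card : ℝ)⁻¹ * ∑ t ∈ s,
      ((u ⬝ᵥ (zeroState A (fun r => w r ω) (t + b)).ofLp) *
        (v ⬝ᵥ (zeroState A (fun r => w r ω) t).ofLp) -
          u ⬝ᵥ (A ^ b * finAutocov A W t) *ᵥ v)) (2 * G ^ 2 * τ / s.card) μ := by
  classical
  have hG := h.G_nonneg
  have hρ := h.rho_nonneg
  have hκ : 0 ≤ κ := zero_le_one.trans h.one_le_kappa
  set c : ℕ → ℝ := fun k => min 1 (κ * ρ ^ k) with hc
  have hc0 : ∀ k, 0 ≤ c k := fun k => by simp only [hc]; positivity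
  have hc1 : ∀ k, c k ≤ 1 := fun k => min_le_left _ _
  -- For the empty window both the average and the proxy vanish, division by zero being zero.
  rcases s.eq_empty_or_nonempty with rfl | hne
  · intro c hc
    simp
  have hN : (0 : ℝ) < s.card := by exact_mod_cast hne.card_pos
  let Y : (Fin d → ℝ) → ℕ → Ω → ℝ := fun u t ω => u ⬝ᵥ (zeroState A (fun r => w r ω) t).ofLp
  have hcov : ∀ (u v : Fin d → ℝ), u ⬝ᵥ u ≤ 1 → v ⬝ᵥ v ≤ 1 → ∀ t s, t ≤ n → s ≤ n →
      |∫ ω, Y u t ω * Y v s ω ∂μ| ≤ G * c (Nat.dist t s) := by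
    intro u v hu hv t s ht hs
    refine abs_le_of_sq_le_sq ?_ (mul_nonneg hG (hc0 _))
    refine (hw.sq_integral_zeroState_mul_le h u v ht hs).trans ?_
    exact mul_le_of_le_one_right (sq_nonneg _) (mul_le_one₀ hu (dotProduct_self_nonneg' v) hv)
  have hJoint : HasGaussianLaw (fun ω => (WithLp.toLp 2 (Sum.elim
      (fun t : s => Y u (t + b) ω) fun t : s => Y v t ω) : EuclideanSpace ℝ (s ⊕ s))) μ := by
    have := hw.hasGaussianLaw_linear (ι := s ⊕ s) (Sum.elim
      (fun t r => stateCoef A u (t + b) r) fun t r => stateCoef A v t r)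
    convert this using 3 with ω
    ext a
    rcases a with t | t
    · exact dotProduct_zeroState _ u (hs t t.2)
    · exact dotProduct_zeroState _ v ((Nat.le_add_right _ _).trans (hs t t.2))
  have hmgf : HasChaosMGF (fun ω => ∑ t : s, (Y u (t + b) ω * Y v t ω -
      ∫ ω, Y u (t + b) ω * Y v t ω ∂μ)) (s.card * (2 * G ^ 2 * τ)) μ := by
    intro a ha
    refine integral_exp_bilinear_le (P := fun (t : s) ω => Y u (t + b) ω)
      (Q := fun (t : s) ω => Y v t ω)
      (Cpp := Matrix.of fun t s' : s => ∫ ω, Y u (t + b) ω * Y u (s' + b) ω ∂μ)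
      (Cpq := Matrix.of fun t s' : s => ∫ ω, Y u (t + b) ω * Y v s' ω ∂μ)
      (Cqq := Matrix.of fun t s' : s => ∫ ω, Y v t ω * Y v s' ω ∂μ) hJoint
      (fun t => hw.integral_dotProduct_zeroState u (hs t t.2))
      (fun t => hw.integral_dotProduct_zeroState v ((Nat.le_add_right _ _).trans (hs t t.2)))
      (fun _ _ => rfl) (fun _ _ => rfl) (fun _ _ => rfl) ?_ ha
    have hle : ∀ t : s, (t : ℕ) ≤ n := fun t => (Nat.le_add_right _ _).trans (hs t t.2)
    -- In each product of covariances one factor keeps its decay in the time distance and the other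
    -- is bounded by `G`, so row sums are controlled by `τ`.
    have hb : ∀ t s' : s, ((∫ ω, Y u (t + b) ω * Y u (s' + b) ω ∂μ) *
        (∫ ω, Y v s' ω * Y v t ω ∂μ) + (∫ ω, Y u (t + b) ω * Y v s' ω ∂μ) *
        (∫ ω, Y u (s' + b) ω * Y v t ω ∂μ)) / 2 ≤
        G ^ 2 / 2 * (c (Nat.dist t s') + c (Nat.dist (t + b) s')) := by
      intro t s'
      have h1 := hcov u u hu hu _ _ (hs t t.2) (hs s' s'.2)
      have h2 := hcov v v hv hv _ _ (hle s') (hle t)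
      have h3 := hcov u v hu hv _ _ (hs t t.2) (hle s')
      have h4 := hcov u v hu hv _ _ (hs s' s'.2) (hle t)
      rw [Nat.dist_add_add_right] at h1
      have h2' : |∫ ω, Y v s' ω * Y v t ω ∂μ| ≤ G :=
        h2.trans (mul_le_of_le_one_right hG (hc1 _))
      have h4' : |∫ ω, Y u (s' + b) ω * Y v t ω ∂μ| ≤ G :=
        h4.trans (mul_le_of_le_one_right hG (hc1 _))
      have e1 := mul_le_mul h1 h2' (abs_nonneg _) (mul_nonneg hG (hc0 _))
      have e2 := mul_le_mul h3 h4' (abs_nonneg _) (mul_nonneg hG (hc0 _))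
      rw [← abs_mul] at e1 e2
      have e3 := (le_abs_self _).trans e1
      have e4 := (le_abs_self _).trans e2
      nlinarith
    simp only [Matrix.of_apply]
    refine (Finset.sum_le_sum fun t _ => Finset.sum_le_sum fun s' _ => hb t s').trans ?_
    have hrow : ∀ t : ℕ, ∑ s' : s, c (Nat.dist t s') ≤ 2 * τ := fun t => by
      rw [Finset.sum_coe_sort s (fun r => c (Nat.dist t r))]
      exact sum_dist_le hc0 hτ s t
    have : ∀ t : s, ∑ s' : s, G ^ 2 / 2 * (c (Nat.dist t s') + c (Nat.dist (t + b) s')) ≤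
        2 * G ^ 2 * τ := fun t => by
      rw [← Finset.mul_sum, Finset.sum_add_distrib]
      have := mul_le_mul_of_nonneg_left (add_le_add (hrow t) (hrow (t + b)))
        (by positivity : 0 ≤ G ^ 2 / 2)
      linarith
    refine (Finset.sum_le_sum fun t _ => this t).trans (le_of_eq ?_)
    simp
  have hscaled := hmgf.const_mul (s.card : ℝ)⁻¹
  -- The sum has a proxy linear in the window length; averaging divides it by the square of the
  -- length.
  have e1 : ((s.card : ℝ)⁻¹) ^ 2 * (s.card * (2 * G ^ 2 * τ)) = 2 * G ^ 2 * τ / s.card := by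
    field_simp
  rw [e1] at hscaled
  convert hscaled using 3 with ω
  rw [Finset.sum_coe_sort s (fun t => Y u (t + b) ω * Y v t ω -
      ∫ ω, Y u (t + b) ω * Y v t ω ∂μ)]
  refine Finset.sum_congr rfl fun t ht => ?_
  rw [hw.integral_zeroState_mul h.posDef.posSemidef u v (hs t ht)]

end ZeroStarted

end MixedLDS

namespace MixedLDS

/-! ### Gap-free perturbation of top eigenspaces. -/

section Eigenspace

variable {d K : ℕ}

theorem inner_eq_dotProduct (u v : EuclideanSpace ℝ (Fin d)) :
    inner ℝ u v = u.ofLp ⬝ᵥ v.ofLp := by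
  simp [PiLp.inner_apply, dotProduct, mul_comm]

theorem dotProduct_mulVec_eq_sum_eigenbasis {S : Matrix (Fin d) (Fin d) ℝ}
    {b : OrthonormalBasis (Fin d) ℝ (EuclideanSpace ℝ (Fin d))} {lam : Fin d → ℝ}
    (hb : ∀ j, toEuclideanCLM (n := Fin d) (𝕜 := ℝ) S (b j) = lam j • b j)
    (u : EuclideanSpace ℝ (Fin d)) :
    u.ofLp ⬝ᵥ S *ᵥ u.ofLp = ∑ j, lam j * inner ℝ (b j) u ^ 2 := by
  have h1 : u.ofLp ⬝ᵥ S *ᵥ u.ofLp = inner ℝ u (toEuclideanCLM (n := Fin d) (𝕜 := ℝ) S u) := by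
    rw [inner_eq_dotProduct, ofLp_toEuclideanCLM]
  have h2 : toEuclideanCLM (n := Fin d) (𝕜 := ℝ) S u =
      ∑ j, inner ℝ (b j) u • lam j • b j := by
    conv_lhs => rw [← b.sum_repr' u]
    simp only [map_sum, map_smul, hb]
  rw [h1, h2, inner_sum]
  refine Finset.sum_congr rfl fun j _ => ?_
  rw [inner_smul_right, inner_smul_right, real_inner_comm u (b j)]
  ring

theorem dotProduct_self_eq_sum_eigenbasis
    (b : OrthonormalBasis (Fin d) ℝ (EuclideanSpace ℝ (Fin d))) (u : EuclideanSpace ℝ (Fin d)) :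
    u.ofLp ⬝ᵥ u.ofLp = ∑ j, inner ℝ (b j) u ^ 2 := by
  rw [← inner_eq_dotProduct, real_inner_self_eq_norm_sq, b.sum_sq_inner_right]

/-- Dimension count: `K` linear conditions on the span of `K + 1` basis vectors leave a nonzero
solution. -/
theorem exists_ne_zero_orthogonal (hK : K < d)
    (b : OrthonormalBasis (Fin d) ℝ (EuclideanSpace ℝ (Fin d))) (y : Fin K → Fin d → ℝ) :
    ∃ u : EuclideanSpace ℝ (Fin d), u ≠ 0 ∧ (∀ k, y k ⬝ᵥ u.ofLp = 0) ∧
      ∀ j : Fin d, K < (j : ℕ) → inner ℝ (b j) u = 0 := by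
  let g : (Fin (K + 1) → ℝ) →ₗ[ℝ] EuclideanSpace ℝ (Fin d) :=
    Fintype.linearCombination ℝ fun j => b (Fin.castLE hK j)
  have hg : ∀ c, g c = ∑ j, c j • b (Fin.castLE hK j) := fun c =>
    Fintype.linearCombination_apply ℝ _ c
  let f : (Fin (K + 1) → ℝ) →ₗ[ℝ] (Fin K → ℝ) :=
    { toFun := fun c k => y k ⬝ᵥ (g c).ofLp
      map_add' := fun c c' => by ext k; simp [dotProduct_add]
      map_smul' := fun a c => by ext k; simp [dotProduct_smul] }
  have hker := LinearMap.ker_ne_bot_of_finrank_lt (f := f) (by simp)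
  obtain ⟨c, hc, hc0⟩ := Submodule.exists_mem_ne_zero_of_ne_bot hker
  have hin : ∀ j : Fin d, inner ℝ (b j) (g c) =
      ∑ i : Fin (K + 1), c i * if j = Fin.castLE hK i then 1 else 0 := by
    intro j
    rw [hg, inner_sum]
    refine Finset.sum_congr rfl fun i _ => ?_
    rw [inner_smul_right, b.inner_eq_ite]
  refine ⟨g c, fun h0 => hc0 ?_, fun k => ?_, fun j hj => ?_⟩
  · ext i
    have := hin (Fin.castLE hK i)
    rw [h0, inner_zero_right] at this
    simpa [Fin.castLE_inj] using this.symm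
  · exact congrFun (LinearMap.mem_ker.1 hc) k
  · rw [hin]
    refine Finset.sum_eq_zero fun i _ => ?_
    rw [if_neg, mul_zero]
    rintro rfl
    simp at hj
    omega

/-- The projection error onto a top eigenspace of a perturbation of `2 ∑ p_k y_k y_kᵀ` is controlled
without any eigengap. -/
theorem mul_projError_sq_le {S : Matrix (Fin d) (Fin d) ℝ} {V : Matrix (Fin d) (Fin K) ℝ}
    (hV : IsTopEigenspace S V) {y : Fin K → Fin d → ℝ} {p : Fin K → ℝ} (hp : ∀ k, 0 ≤ p k) {ε : ℝ}
    (hS : ∀ u : Fin d → ℝ, |u ⬝ᵥ S *ᵥ u - 2 * ∑ k, p k * (y k ⬝ᵥ u) ^ 2| ≤ ε * (u ⬝ᵥ u))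
    (hε : 0 ≤ ε) (k : Fin K) : p k * projError V (y k) ^ 2 ≤ ε := by
  obtain ⟨hVV, hK, b, lam, hanti, hb, hspan⟩ := hV
  -- The residual of `y k` is orthogonal to the columns of `V`, whence `⟨y k, r⟩ = ⟨r, r⟩`.
  set r : Fin d → ℝ := y k - (V * Vᵀ) *ᵥ y k with hr
  have hVr : Vᵀ *ᵥ r = 0 := by
    rw [hr, mulVec_sub, mulVec_mulVec, ← Matrix.mul_assoc, hVV, Matrix.one_mul, sub_self]
  have hyr : y k ⬝ᵥ r = r ⬝ᵥ r := by
    have h1 : y k = r + V *ᵥ (Vᵀ *ᵥ y k) := by rw [hr, mulVec_mulVec]; simp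
    have h2 : (V *ᵥ (Vᵀ *ᵥ y k)) ⬝ᵥ r = 0 := by
      rw [dotProduct_comm, dotProduct_mulVec, ← mulVec_transpose, hVr, zero_dotProduct]
    conv_lhs => rw [h1, add_dotProduct, h2, add_zero]
  have hperr : projError V (y k) ^ 2 = r ⬝ᵥ r := norm_toLp_sq r
  let R : EuclideanSpace ℝ (Fin d) := WithLp.toLp 2 r
  have horth : ∀ j : Fin K, inner ℝ (b (Fin.castLE hK j)) R = 0 := by
    have h1 : R ∈ (Submodule.span ℝ (Set.range fun k : Fin K =>
        (WithLp.toLp 2 (V.col k) : EuclideanSpace ℝ (Fin d))))ᗮ := by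
      rw [Submodule.mem_orthogonal]
      intro x hx
      induction hx using Submodule.span_induction with
      | mem x hx =>
        obtain ⟨k, rfl⟩ := hx
        rw [inner_eq_dotProduct]
        exact congrFun hVr k
      | zero => exact inner_zero_left _
      | add x z _ _ h1 h2 => rw [inner_add_left, h1, h2, add_zero]
      | smul a x _ h1 => rw [inner_smul_left, h1, mul_zero]
    rw [hspan, Submodule.mem_orthogonal] at h1
    exact fun j => h1 _ (Submodule.subset_span ⟨j, rfl⟩)
  have hrr : r ⬝ᵥ r = ∑ j, inner ℝ (b j) R ^ 2 := dotProduct_self_eq_sum_eigenbasis b R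
  have hrS : r ⬝ᵥ S *ᵥ r = ∑ j, lam j * inner ℝ (b j) R ^ 2 :=
    dotProduct_mulVec_eq_sum_eigenbasis hb R
  rw [hperr]
  rcases hK.eq_or_lt with hKd | hKd
  · have : r ⬝ᵥ r = 0 := by
      rw [hrr]
      refine Finset.sum_eq_zero fun j _ => ?_
      have := horth ⟨j, by omega⟩
      simp only [Fin.castLE_mk, Fin.eta] at this
      rw [this]; norm_num
    rw [this, mul_zero]; exact hε
  -- Index `K` is the first discarded eigenvalue. On a combination of the first `K + 1` eigenvectors
  -- orthogonal to all `y k` the rank-`K` part vanishes and only the perturbation remains.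
  have hlam : lam ⟨K, hKd⟩ ≤ ε := by
    obtain ⟨u, hu0, huy, hub⟩ := exists_ne_zero_orthogonal hKd b y
    have h1 := (abs_le.1 (hS u.ofLp)).2
    have h2 : ∑ k, p k * (y k ⬝ᵥ u.ofLp) ^ 2 = 0 :=
      Finset.sum_eq_zero fun k _ => by rw [huy]; ring
    rw [h2, dotProduct_mulVec_eq_sum_eigenbasis hb u, mul_zero, sub_zero] at h1
    have hpos : 0 < u.ofLp ⬝ᵥ u.ofLp := by
      rw [← inner_eq_dotProduct, real_inner_self_eq_norm_sq]
      have := norm_pos_iff.2 hu0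
      positivity
    have h3 : lam ⟨K, hKd⟩ * (u.ofLp ⬝ᵥ u.ofLp) ≤ ∑ j, lam j * inner ℝ (b j) u ^ 2 := by
      rw [dotProduct_self_eq_sum_eigenbasis b u, Finset.mul_sum]
      refine Finset.sum_le_sum fun j _ => ?_
      rcases le_or_gt (j : ℕ) K with hj | hj
      · exact mul_le_mul_of_nonneg_right (hanti (by simpa [Fin.le_def] using hj)) (sq_nonneg _)
      · rw [hub j hj]; simp
    exact le_of_mul_le_mul_right (h3.trans h1) hpos
  -- `r` has no component along the first `K` eigenvectors, and all other eigenvalues are at most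
  -- `ε`.
  have hSr : r ⬝ᵥ S *ᵥ r ≤ ε * (r ⬝ᵥ r) := by
    rw [hrS, hrr, Finset.mul_sum]
    refine Finset.sum_le_sum fun j _ => ?_
    rcases lt_or_ge (j : ℕ) K with hj | hj
    · have := horth ⟨j, hj⟩
      simp only [Fin.castLE_mk, Fin.eta] at this
      rw [this]; simp
    · refine mul_le_mul_of_nonneg_right ((hanti ?_).trans hlam) (sq_nonneg _)
      simpa [Fin.le_def] using hj
  have h4 := (abs_le.1 (hS r)).1
  have h5 : p k * (y k ⬝ᵥ r) ^ 2 ≤ ∑ k, p k * (y k ⬝ᵥ r) ^ 2 :=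
    Finset.single_le_sum (f := fun k => p k * (y k ⬝ᵥ r) ^ 2)
      (fun k _ => mul_nonneg (hp k) (sq_nonneg _)) (Finset.mem_univ k)
  rw [hyr] at h5
  -- The signal is quartic in `‖r‖`, the perturbation quadratic; this comparison replaces the
  -- eigengap.
  have h6 : p k * (r ⬝ᵥ r) ^ 2 ≤ ε * (r ⬝ᵥ r) := by linarith
  rcases (dotProduct_self_nonneg' r).eq_or_lt with h0 | h0
  · rw [← h0, mul_zero]; exact hε
  · refine le_of_mul_le_mul_right ?_ h0
    linarith [h6, show p k * (r ⬝ᵥ r) ^ 2 = p k * (r ⬝ᵥ r) * (r ⬝ᵥ r) by ring]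

end Eigenspace

end MixedLDS

namespace MixedLDS

/-! ### Concentration for products of independent bounded vectors. -/

section BoundedRankOne

theorem integral_add_six {Ω : Type*} [MeasurableSpace Ω] {μ : Measure Ω} {f₁ f₂ f₃ f₄ f₅ f₆ : Ω → ℝ}
    (h₁ : Integrable f₁ μ) (h₂ : Integrable f₂ μ) (h₃ : Integrable f₃ μ) (h₄ : Integrable f₄ μ)
    (h₅ : Integrable f₅ μ) (h₆ : Integrable f₆ μ) :
    Integrable (fun ω => f₁ ω + f₂ ω + f₃ ω + f₄ ω + f₅ ω + f₆ ω) μ ∧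
    ∫ ω, (f₁ ω + f₂ ω + f₃ ω + f₄ ω + f₅ ω + f₆ ω) ∂μ = ∫ ω, f₁ ω ∂μ + ∫ ω, f₂ ω ∂μ +
      ∫ ω, f₃ ω ∂μ + ∫ ω, f₄ ω ∂μ + ∫ ω, f₅ ω ∂μ + ∫ ω, f₆ ω ∂μ := by
  have k₂ : Integrable (fun ω => f₁ ω + f₂ ω) μ := h₁.add h₂
  have k₃ : Integrable (fun ω => f₁ ω + f₂ ω + f₃ ω) μ := k₂.add h₃
  have k₄ : Integrable (fun ω => f₁ ω + f₂ ω + f₃ ω + f₄ ω) μ := k₃.add h₄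
  have k₅ : Integrable (fun ω => f₁ ω + f₂ ω + f₃ ω + f₄ ω + f₅ ω) μ := k₄.add h₅
  refine ⟨k₅.add h₆, ?_⟩
  rw [integral_add k₅ h₆, integral_add k₄ h₅, integral_add k₃ h₄, integral_add k₂ h₃,
    integral_add h₁ h₂]

variable {n : Type*}

/-- Symmetric part of `(q₁ + a₁) (q₂ + a₂)ᵀ - q₁ q₂ᵀ`. -/
noncomputable def crossMatrix (q₁ q₂ a₁ a₂ : n → ℝ) : Matrix n n ℝ :=
  (1 / 2 : ℝ) • (vecMulVec (q₁ + a₁) (q₂ + a₂) + vecMulVec (q₂ + a₂) (q₁ + a₁) -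
    vecMulVec q₁ q₂ - vecMulVec q₂ q₁)

theorem isSymm_crossMatrix (q₁ q₂ a₁ a₂ : n → ℝ) : (crossMatrix q₁ q₂ a₁ a₂).IsSymm := by
  ext i j
  simp only [crossMatrix, transpose_apply, Matrix.smul_apply, Matrix.sub_apply, Matrix.add_apply,
    vecMulVec_apply, smul_eq_mul]
  ring

theorem crossMatrix_apply (q₁ q₂ a₁ a₂ : n → ℝ) (i j : n) :
    crossMatrix q₁ q₂ a₁ a₂ i j = (1 / 2 : ℝ) * (a₁ i * a₂ j + a₂ i * a₁ j + q₁ i * a₂ j +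
      a₂ i * q₁ j + a₁ i * q₂ j + q₂ i * a₁ j) := by
  simp only [crossMatrix, Matrix.smul_apply, Matrix.sub_apply, Matrix.add_apply,
    vecMulVec_apply, smul_eq_mul, Pi.add_apply]
  ring

variable [Fintype n]

theorem crossMatrix_mulVec (q₁ q₂ a₁ a₂ u : n → ℝ) (i : n) :
    (crossMatrix q₁ q₂ a₁ a₂ *ᵥ u) i = (1 / 2 : ℝ) * (a₁ i * (a₂ ⬝ᵥ u) + a₂ i * (a₁ ⬝ᵥ u) +
      q₁ i * (a₂ ⬝ᵥ u) + a₂ i * (q₁ ⬝ᵥ u) + a₁ i * (q₂ ⬝ᵥ u) + q₂ i * (a₁ ⬝ᵥ u)) := by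
  simp only [mulVec, dotProduct, crossMatrix_apply, Finset.mul_sum, ← Finset.sum_add_distrib]
  exact Finset.sum_congr rfl fun j _ => by ring

theorem dotProduct_crossMatrix (q₁ q₂ a₁ a₂ u : n → ℝ) :
    u ⬝ᵥ crossMatrix q₁ q₂ a₁ a₂ *ᵥ u =
      ((q₁ + a₁) ⬝ᵥ u) * ((q₂ + a₂) ⬝ᵥ u) - (q₁ ⬝ᵥ u) * (q₂ ⬝ᵥ u) := by
  have h : u ⬝ᵥ crossMatrix q₁ q₂ a₁ a₂ *ᵥ u = (1 / 2 : ℝ) * ((a₁ ⬝ᵥ u) * (a₂ ⬝ᵥ u) +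
      (a₂ ⬝ᵥ u) * (a₁ ⬝ᵥ u) + (q₁ ⬝ᵥ u) * (a₂ ⬝ᵥ u) + (a₂ ⬝ᵥ u) * (q₁ ⬝ᵥ u) +
      (a₁ ⬝ᵥ u) * (q₂ ⬝ᵥ u) + (q₂ ⬝ᵥ u) * (a₁ ⬝ᵥ u)) := by
    have e : ∀ a b c : n → ℝ, ∀ x y z x' y' z' : ℝ, ∑ i, u i * ((1 / 2 : ℝ) * (a i * x + b i * y +
        c i * z + b i * x' + a i * y' + (fun i => q₂ i) i * z')) = (1 / 2 : ℝ) * ((a ⬝ᵥ u) * x +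
        (b ⬝ᵥ u) * y + (c ⬝ᵥ u) * z + (b ⬝ᵥ u) * x' + (a ⬝ᵥ u) * y' + (q₂ ⬝ᵥ u) * z') := by
      intro a b c x y z x' y' z'
      simp only [dotProduct, Finset.mul_sum, Finset.sum_mul, ← Finset.sum_add_distrib]
      exact Finset.sum_congr rfl fun i _ => by ring
    rw [dotProduct]
    simp only [crossMatrix_mulVec]
    exact e a₁ a₂ q₁ _ _ _ _ _ _
  rw [h, add_dotProduct, add_dotProduct]
  ring

/-- Cauchy–Schwarz for six summands with prefactor `1 / 2`, whence `6 / 4 = 3 / 2`. -/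
theorem crossMatrix_mulVec_dotProduct_self_le (q₁ q₂ a₁ a₂ u : n → ℝ) :
    (crossMatrix q₁ q₂ a₁ a₂ *ᵥ u) ⬝ᵥ (crossMatrix q₁ q₂ a₁ a₂ *ᵥ u) ≤ (3 / 2 : ℝ) *
      ((a₁ ⬝ᵥ a₁) * (a₂ ⬝ᵥ u) ^ 2 + (a₂ ⬝ᵥ a₂) * (a₁ ⬝ᵥ u) ^ 2 + (q₁ ⬝ᵥ q₁) * (a₂ ⬝ᵥ u) ^ 2 +
        (a₂ ⬝ᵥ a₂) * (q₁ ⬝ᵥ u) ^ 2 + (a₁ ⬝ᵥ a₁) * (q₂ ⬝ᵥ u) ^ 2 +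
          (q₂ ⬝ᵥ q₂) * (a₁ ⬝ᵥ u) ^ 2) := by
  have six : ∀ a b c d e f : ℝ, ((1 / 2 : ℝ) * (a + b + c + d + e + f)) * ((1 / 2 : ℝ) *
      (a + b + c + d + e + f)) ≤ 3 / 2 * (a ^ 2 + b ^ 2 + c ^ 2 + d ^ 2 + e ^ 2 + f ^ 2) := by
    intro a b c d e f
    nlinarith [sq_nonneg (a - b), sq_nonneg (a - c), sq_nonneg (a - d), sq_nonneg (a - e),
      sq_nonneg (a - f), sq_nonneg (b - c), sq_nonneg (b - d), sq_nonneg (b - e), sq_nonneg (b - f),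
      sq_nonneg (c - d), sq_nonneg (c - e), sq_nonneg (c - f), sq_nonneg (d - e), sq_nonneg (d - f),
      sq_nonneg (e - f)]
  generalize h1 : a₂ ⬝ᵥ u = x₁
  generalize h2 : a₁ ⬝ᵥ u = x₂
  generalize h3 : q₁ ⬝ᵥ u = x₃
  generalize h4 : q₂ ⬝ᵥ u = x₄
  rw [dotProduct]
  simp only [crossMatrix_mulVec, h1, h2, h3, h4]
  refine (Finset.sum_le_sum fun i _ => six _ _ _ _ _ _).trans (le_of_eq ?_)
  simp only [dotProduct, Finset.mul_sum, Finset.sum_mul, ← Finset.sum_add_distrib]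
  exact Finset.sum_congr rfl fun i _ => by ring

variable [DecidableEq n] {Ω : Type*} [MeasurableSpace Ω] {μ : Measure Ω}

theorem integrable_of_abs_le [IsProbabilityMeasure μ] {f : Ω → ℝ} (hf : Measurable f) {C : ℝ}
    (h : ∀ ω, |f ω| ≤ C) : Integrable f μ :=
  Integrable.of_bound hf.aestronglyMeasurable C (Filter.Eventually.of_forall h)

/-- Moments of the cross matrix built from two independent centered bounded vectors. -/
theorem integral_crossMatrix [IsProbabilityMeasure μ] {a₁ a₂ : Ω → n → ℝ} (h1 : Measurable a₁)
    (h2 : Measurable a₂) (hind : IndepFun a₁ a₂ μ) {R : ℝ} (hR : 0 ≤ R)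
    (hb1 : ∀ ω, a₁ ω ⬝ᵥ a₁ ω ≤ R ^ 2)
    (hb2 : ∀ ω, a₂ ω ⬝ᵥ a₂ ω ≤ R ^ 2) (hm1 : ∀ i, ∫ ω, a₁ ω i ∂μ = 0)
    (hm2 : ∀ i, ∫ ω, a₂ ω i ∂μ = 0) {v : ℝ} (hv : 0 ≤ v)
    (hv1 : ∀ u, ∫ ω, (a₁ ω ⬝ᵥ u) ^ 2 ∂μ ≤ v * (u ⬝ᵥ u))
    (hv2 : ∀ u, ∫ ω, (a₂ ω ⬝ᵥ u) ^ 2 ∂μ ≤ v * (u ⬝ᵥ u)) {q₁ q₂ : n → ℝ} {G : ℝ}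
    (hG1 : q₁ ⬝ᵥ q₁ ≤ G ^ 2) (hG2 : q₂ ⬝ᵥ q₂ ≤ G ^ 2) :
    (∀ i j, ∫ ω, crossMatrix q₁ q₂ (a₁ ω) (a₂ ω) i j ∂μ = 0) ∧
    ∀ u, ∫ ω, (crossMatrix q₁ q₂ (a₁ ω) (a₂ ω) *ᵥ u) ⬝ᵥ
      (crossMatrix q₁ q₂ (a₁ ω) (a₂ ω) *ᵥ u) ∂μ ≤
        (3 * Fintype.card n * v * (v + 2 * G ^ 2)) * (u ⬝ᵥ u) := by
  have hsup : ∀ (a : Ω → n → ℝ), (∀ ω, a ω ⬝ᵥ a ω ≤ R ^ 2) → ∀ ω i, |a ω i| ≤ R := by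
    intro a ha ω i
    refine abs_le_of_sq_le_sq ?_ hR
    refine le_trans ?_ (ha ω)
    rw [pow_two]
    exact Finset.single_le_sum (f := fun i => a ω i * a ω i) (fun j _ => mul_self_nonneg _)
      (Finset.mem_univ i)
  have hs1 := hsup a₁ hb1
  have hs2 := hsup a₂ hb2
  have me1 : ∀ i, Measurable fun ω => a₁ ω i := fun i => (measurable_pi_apply i).comp h1
  have me2 : ∀ i, Measurable fun ω => a₂ ω i := fun i => (measurable_pi_apply i).comp h2
  have i1 : ∀ i, Integrable (fun ω => a₁ ω i) μ := fun i =>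
    integrable_of_abs_le (me1 i) fun ω => hs1 ω i
  have i2 : ∀ i, Integrable (fun ω => a₂ ω i) μ := fun i =>
    integrable_of_abs_le (me2 i) fun ω => hs2 ω i
  have hindij : ∀ i j, IndepFun (fun ω => a₁ ω i) (fun ω => a₂ ω j) μ := fun i j =>
    hind.comp (measurable_pi_apply i) (measurable_pi_apply j)
  have i12 : ∀ i j, Integrable (fun ω => a₁ ω i * a₂ ω j) μ := fun i j =>
    (hindij i j).integrable_mul (i1 i) (i2 j)
  have e12 : ∀ i j, ∫ ω, a₁ ω i * a₂ ω j ∂μ = 0 := fun i j => by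
    rw [(hindij i j).integral_fun_mul_eq_mul_integral (me1 i).aestronglyMeasurable
      (me2 j).aestronglyMeasurable, hm1, zero_mul]
  constructor
  · intro i j
    have e : ∀ ω, crossMatrix q₁ q₂ (a₁ ω) (a₂ ω) i j = (1 / 2 : ℝ) * (a₁ ω i * a₂ ω j) +
        (1 / 2 : ℝ) * (a₁ ω j * a₂ ω i) + (1 / 2 * q₁ i) * a₂ ω j + (1 / 2 * q₁ j) * a₂ ω i +
        (1 / 2 * q₂ j) * a₁ ω i + (1 / 2 * q₂ i) * a₁ ω j := fun ω => by
      rw [crossMatrix_apply]; ring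
    simp_rw [e]
    rw [(integral_add_six ((i12 i j).const_mul _) ((i12 j i).const_mul _) ((i2 j).const_mul _)
      ((i2 i).const_mul _) ((i1 i).const_mul _) ((i1 j).const_mul _)).2]
    simp only [integral_const_mul, e12, hm1, hm2]
    ring
  · intro u
    have hu := dotProduct_self_nonneg' u
    have mdot : ∀ (a : Ω → n → ℝ), Measurable a → Measurable fun ω => a ω ⬝ᵥ u := fun a ha =>
      (Continuous.measurable (by fun_prop : Continuous fun x : n → ℝ => x ⬝ᵥ u)).comp ha
    have mself : ∀ (a : Ω → n → ℝ), Measurable a → Measurable fun ω => a ω ⬝ᵥ a ω := fun a ha =>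
      (Continuous.measurable (by fun_prop : Continuous fun x : n → ℝ => x ⬝ᵥ x)).comp ha
    have idot : ∀ (a : Ω → n → ℝ), Measurable a → (∀ ω, a ω ⬝ᵥ a ω ≤ R ^ 2) →
        Integrable (fun ω => (a ω ⬝ᵥ u) ^ 2) μ := fun a ha hb =>
      integrable_of_abs_le ((mdot a ha).pow_const 2) (C := R ^ 2 * (u ⬝ᵥ u)) fun ω => by
        rw [abs_of_nonneg (sq_nonneg _)]
        exact (sq_dotProduct_le _ _).trans (mul_le_mul_of_nonneg_right (hb ω) hu)
    have iself : ∀ (a : Ω → n → ℝ), Measurable a → (∀ ω, a ω ⬝ᵥ a ω ≤ R ^ 2) →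
        Integrable (fun ω => a ω ⬝ᵥ a ω) μ := fun a ha hb =>
      integrable_of_abs_le (mself a ha) (C := R ^ 2) fun ω => by
        rw [abs_of_nonneg (dotProduct_self_nonneg' _)]; exact hb ω
    have eself : ∀ (a : Ω → n → ℝ), Measurable a → (∀ ω, a ω ⬝ᵥ a ω ≤ R ^ 2) →
        (∀ i, Integrable (fun ω => (a ω i) ^ 2) μ) →
        (∀ u, ∫ ω, (a ω ⬝ᵥ u) ^ 2 ∂μ ≤ v * (u ⬝ᵥ u)) →
        ∫ ω, a ω ⬝ᵥ a ω ∂μ ≤ Fintype.card n * v := by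
      intro a ha hb hi hva
      simp only [dotProduct, ← pow_two]
      rw [integral_finsetSum _ fun i _ => hi i]
      refine (Finset.sum_le_card_nsmul _ _ v fun i _ => ?_).trans (by simp)
      simpa using hva (Pi.single i 1)
    have isq : ∀ (a : Ω → n → ℝ), (∀ i, Measurable fun ω => a ω i) → (∀ ω i, |a ω i| ≤ R) →
        ∀ i, Integrable (fun ω => (a ω i) ^ 2) μ := fun a ha hb i =>
      integrable_of_abs_le ((ha i).pow_const 2) (C := R ^ 2) fun ω => by
        rw [abs_pow]; exact pow_le_pow_left₀ (abs_nonneg _) (hb ω i) 2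
    have s1 := eself a₁ h1 hb1 (isq a₁ me1 hs1) hv1
    have s2 := eself a₂ h2 hb2 (isq a₂ me2 hs2) hv2
    have j1 := idot a₁ h1 hb1
    have j2 := idot a₂ h2 hb2
    have l1 := iself a₁ h1 hb1
    have l2 := iself a₂ h2 hb2
    have cself : Measurable fun x : n → ℝ => x ⬝ᵥ x := Continuous.measurable (by fun_prop)
    have cdot : Measurable fun x : n → ℝ => (x ⬝ᵥ u) ^ 2 := Continuous.measurable (by fun_prop)
    -- The squared norm of one vector is independent of the projection of the other, so the mean of
    -- the product factors and the dimension enters only to the first power.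
    have ind1 : IndepFun (fun ω => a₁ ω ⬝ᵥ a₁ ω) (fun ω => (a₂ ω ⬝ᵥ u) ^ 2) μ :=
      hind.comp cself cdot
    have ind2 : IndepFun (fun ω => a₂ ω ⬝ᵥ a₂ ω) (fun ω => (a₁ ω ⬝ᵥ u) ^ 2) μ :=
      hind.symm.comp cself cdot
    have p1 := ind1.integral_fun_mul_eq_mul_integral l1.aestronglyMeasurable j2.aestronglyMeasurable
    have p2 := ind2.integral_fun_mul_eq_mul_integral l2.aestronglyMeasurable j1.aestronglyMeasurable
    have ip1 : Integrable (fun ω => (a₁ ω ⬝ᵥ a₁ ω) * (a₂ ω ⬝ᵥ u) ^ 2) μ :=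
      ind1.integrable_mul l1 j2
    have ip2 : Integrable (fun ω => (a₂ ω ⬝ᵥ a₂ ω) * (a₁ ω ⬝ᵥ u) ^ 2) μ :=
      ind2.integrable_mul l2 j1
    have k6 := integral_add_six ip1 ip2 (j2.const_mul (q₁ ⬝ᵥ q₁)) (l2.mul_const ((q₁ ⬝ᵥ u) ^ 2))
      (l1.mul_const ((q₂ ⬝ᵥ u) ^ 2)) (j1.const_mul (q₂ ⬝ᵥ q₂))
    have hle : ∫ ω, (crossMatrix q₁ q₂ (a₁ ω) (a₂ ω) *ᵥ u) ⬝ᵥ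
        (crossMatrix q₁ q₂ (a₁ ω) (a₂ ω) *ᵥ u) ∂μ ≤ _ :=
      integral_mono_of_nonneg (Filter.Eventually.of_forall fun ω => dotProduct_self_nonneg' _)
        (k6.1.const_mul (3 / 2 : ℝ))
        (Filter.Eventually.of_forall fun ω =>
          crossMatrix_mulVec_dotProduct_self_le q₁ q₂ (a₁ ω) (a₂ ω) u)
    refine hle.trans ?_
    rw [integral_const_mul, k6.2, p1, p2]
    simp only [integral_const_mul, integral_mul_const]
    have t1 := hv1 u
    have t2 := hv2 u
    have n1 : 0 ≤ ∫ ω, (a₁ ω ⬝ᵥ u) ^ 2 ∂μ := integral_nonneg fun _ => sq_nonneg _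
    have n2 : 0 ≤ ∫ ω, (a₂ ω ⬝ᵥ u) ^ 2 ∂μ := integral_nonneg fun _ => sq_nonneg _
    have hcard : (0 : ℝ) ≤ Fintype.card n := Nat.cast_nonneg _
    have g1 : (q₁ ⬝ᵥ u) ^ 2 ≤ G ^ 2 * (u ⬝ᵥ u) :=
      (sq_dotProduct_le _ _).trans (mul_le_mul_of_nonneg_right hG1 hu)
    have g2 : (q₂ ⬝ᵥ u) ^ 2 ≤ G ^ 2 * (u ⬝ᵥ u) :=
      (sq_dotProduct_le _ _).trans (mul_le_mul_of_nonneg_right hG2 hu)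
    have b1 := mul_le_mul s1 t2 n2 (by positivity)
    have b2 := mul_le_mul s2 t1 n1 (by positivity)
    have b3 := mul_le_mul hG1 t2 n2 (sq_nonneg G)
    have b4 := mul_le_mul s2 g1 (sq_nonneg _) (by positivity)
    have b5 := mul_le_mul s1 g2 (sq_nonneg _) (by positivity)
    have b6 := mul_le_mul hG2 t1 n1 (sq_nonneg G)
    rcases isEmpty_or_nonempty n with hn | hn
    · simp [dotProduct]
    · have hone : (1 : ℝ) ≤ Fintype.card n := by exact_mod_cast Fintype.card_pos
      have b7 : G ^ 2 * (v * (u ⬝ᵥ u)) ≤ Fintype.card n * (G ^ 2 * (v * (u ⬝ᵥ u))) :=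
        le_mul_of_one_le_left (by positivity) hone
      linarith

/-- Concentration of a sum of products of two independent bounded vectors. -/
theorem measure_exists_lt_abs_sum_mul_sub_le [IsProbabilityMeasure μ] {ι : Type*} [Fintype ι]
    {a : ι → Ω → (n → ℝ) × (n → ℝ)} (ha : ∀ m, Measurable (a m)) (hind : iIndepFun a μ)
    (hpair : ∀ m, IndepFun (fun ω => (a m ω).1) (fun ω => (a m ω).2) μ) {R : ℝ} (hR : 0 ≤ R)
    (hb1 : ∀ m ω, (a m ω).1 ⬝ᵥ (a m ω).1 ≤ R ^ 2) (hb2 : ∀ m ω, (a m ω).2 ⬝ᵥ (a m ω).2 ≤ R ^ 2)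
    (hm1 : ∀ m i, ∫ ω, (a m ω).1 i ∂μ = 0) (hm2 : ∀ m i, ∫ ω, (a m ω).2 i ∂μ = 0) {v : ℝ}
    (hv : 0 ≤ v) (hv1 : ∀ m u, ∫ ω, ((a m ω).1 ⬝ᵥ u) ^ 2 ∂μ ≤ v * (u ⬝ᵥ u))
    (hv2 : ∀ m u, ∫ ω, ((a m ω).2 ⬝ᵥ u) ^ 2 ∂μ ≤ v * (u ⬝ᵥ u))
    {q : ι → (n → ℝ) × (n → ℝ)} {G : ℝ} (hG : 0 ≤ G) (hG1 : ∀ m, (q m).1 ⬝ᵥ (q m).1 ≤ G ^ 2)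
    (hG2 : ∀ m, (q m).2 ⬝ᵥ (q m).2 ≤ G ^ 2) {θ : ℝ} (hθ : 0 < θ)
    (hθR : θ * (2 * G * R + R ^ 2) ≤ 1) (t : ℝ) :
    μ {ω | ∃ u : n → ℝ, t * (u ⬝ᵥ u) < |∑ m, ((((q m).1 + (a m ω).1) ⬝ᵥ u) *
      (((q m).2 + (a m ω).2) ⬝ᵥ u) - ((q m).1 ⬝ᵥ u) * ((q m).2 ⬝ᵥ u))|} ≤
    2 * ENNReal.ofReal (Fintype.card n * Real.exp (θ ^ 2 * (3 * Fintype.card n * v *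
      (v + 2 * G ^ 2)) * Fintype.card ι - θ * t)) := by
  let F : ι → (n → ℝ) × (n → ℝ) → Matrix n n ℝ := fun m x => crossMatrix (q m).1 (q m).2 x.1 x.2
  have hF : ∀ m, Measurable (F m) := fun m => by
    refine measurable_pi_lambda _ fun i => measurable_pi_lambda _ fun j => ?_
    simp only [F, crossMatrix_apply]
    fun_prop
  have hFb : ∀ m ω u, |u ⬝ᵥ F m (a m ω) *ᵥ u| ≤ (2 * G * R + R ^ 2) * (u ⬝ᵥ u) := by
    intro m ω u
    have hu := dotProduct_self_nonneg' u
    simp only [F]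
    rw [dotProduct_crossMatrix]
    have hsq : ∀ (x : n → ℝ) (C : ℝ), 0 ≤ C → x ⬝ᵥ x ≤ C ^ 2 →
        |x ⬝ᵥ u| ≤ C * Real.sqrt (u ⬝ᵥ u) := by
      intro x C hC hx
      refine abs_le_of_sq_le_sq ?_ (by positivity)
      rw [mul_pow, Real.sq_sqrt hu]
      exact (sq_dotProduct_le _ _).trans (mul_le_mul_of_nonneg_right hx hu)
    have k1 := hsq _ _ hR (hb1 m ω)
    have k2 := hsq _ _ hR (hb2 m ω)
    have k3 := hsq _ _ hG (hG1 m)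
    have k4 := hsq _ _ hG (hG2 m)
    rw [add_dotProduct, add_dotProduct]
    generalize (a m ω).1 ⬝ᵥ u = x₁ at *
    generalize (a m ω).2 ⬝ᵥ u = x₂ at *
    generalize (q m).1 ⬝ᵥ u = y₁ at *
    generalize (q m).2 ⬝ᵥ u = y₂ at *
    have e : (y₁ + x₁) * (y₂ + x₂) - y₁ * y₂ = y₁ * x₂ + x₁ * y₂ + x₁ * x₂ := by ring
    have hs : Real.sqrt (u ⬝ᵥ u) * Real.sqrt (u ⬝ᵥ u) = u ⬝ᵥ u := Real.mul_self_sqrt hu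
    have h0 := Real.sqrt_nonneg (u ⬝ᵥ u)
    rw [e]
    refine (abs_add_le _ _).trans ((add_le_add_left (abs_add_le _ _) _).trans ?_)
    rw [abs_mul, abs_mul, abs_mul]
    have m1 := mul_le_mul k3 k2 (abs_nonneg _) (by positivity)
    have m2 := mul_le_mul k1 k4 (abs_nonneg _) (by positivity)
    have m3 := mul_le_mul k1 k2 (abs_nonneg _) (by positivity)
    calc _ ≤ G * √(u ⬝ᵥ u) * (R * √(u ⬝ᵥ u)) + R * √(u ⬝ᵥ u) * (G * √(u ⬝ᵥ u)) +
          R * √(u ⬝ᵥ u) * (R * √(u ⬝ᵥ u)) := by linarith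
      _ = (2 * G * R + R ^ 2) * (√(u ⬝ᵥ u) * √(u ⬝ᵥ u)) := by ring
      _ = _ := by rw [hs]
  have mom := fun m => integral_crossMatrix (μ := μ) (measurable_fst.comp (ha m))
    (measurable_snd.comp (ha m)) (hpair m) hR (hb1 m) (hb2 m) (hm1 m) (hm2 m) hv (hv1 m) (hv2 m)
    (hG1 m) (hG2 m)
  have hindF : iIndepFun (fun m ω => F m (a m ω)) μ := hind.comp F hF
  have hindF' : iIndepFun (fun m ω => -F m (a m ω)) μ :=
    hind.comp (fun m x => -F m x) fun m => (hF m).neg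
  have hsum : ∀ ω u, u ⬝ᵥ (∑ m, F m (a m ω)) *ᵥ u = ∑ m, ((((q m).1 + (a m ω).1) ⬝ᵥ u) *
      (((q m).2 + (a m ω).2) ⬝ᵥ u) - ((q m).1 ⬝ᵥ u) * ((q m).2 ⬝ᵥ u)) := fun ω u => by
    rw [sum_mulVec, dotProduct_sum]
    exact Finset.sum_congr rfl fun m _ => dotProduct_crossMatrix _ _ _ _ _
  have hV : 0 ≤ 3 * (Fintype.card n : ℝ) * v * (v + 2 * G ^ 2) := by positivity
  -- The two-sided bound comes from the upper tails of the sum and of its negative.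
  have up := measure_exists_lt_dotProduct_sum_le (μ := μ) (fun m => (hF m).comp (ha m))
    (fun m ω => isSymm_crossMatrix _ _ _ _) hFb (fun m => (mom m).1) hV (fun m => (mom m).2)
    hindF Finset.univ hθ hθR t
  have lo := measure_exists_lt_dotProduct_sum_le (μ := μ) (A := fun m ω => -F m (a m ω))
    (fun m => ((hF m).comp (ha m)).neg)
    (fun m ω => (isSymm_crossMatrix _ _ _ _).neg)
    (fun m ω u => by rw [neg_mulVec, dotProduct_neg, abs_neg]; exact hFb m ω u)
    (fun m i j => by
      simp only [Matrix.neg_apply, integral_neg]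
      rw [neg_eq_zero]
      exact (mom m).1 i j) hV
    (fun m u => by
      simp only [neg_mulVec, neg_dotProduct, dotProduct_neg, neg_neg]
      exact (mom m).2 u)
    hindF' Finset.univ hθ hθR t
  rw [Finset.card_univ] at up lo
  rw [two_mul]
  refine le_trans (measure_mono ?_) ((measure_union_le _ _).trans (add_le_add up lo))
  rintro ω ⟨u, hu⟩
  rw [← hsum] at hu
  rcases lt_abs.1 hu with h | h
  · exact Or.inl ⟨u, h⟩
  · refine Or.inr ⟨u, ?_⟩
    rw [Finset.sum_neg_distrib, neg_mulVec, dotProduct_neg]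
    exact h

end BoundedRankOne

end MixedLDS

namespace MixedLDS

/-! ### Truncation of vectors with chaos-type tails. -/

section Truncation

variable {Ω : Type*} [MeasurableSpace Ω] {μ : Measure Ω}

/-- The polynomial `x ↦ ∫ (f x + g) ^ 2` is nonnegative, so its discriminant is nonpositive. -/
theorem sq_integral_mul_le {f g : Ω → ℝ} (hf : Integrable (fun ω => f ω ^ 2) μ)
    (hg : Integrable (fun ω => g ω ^ 2) μ) (hfg : Integrable (fun ω => f ω * g ω) μ) :
    (∫ ω, f ω * g ω ∂μ) ^ 2 ≤ (∫ ω, f ω ^ 2 ∂μ) * ∫ ω, g ω ^ 2 ∂μ := by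
  have key : ∀ x : ℝ, 0 ≤ (∫ ω, f ω ^ 2 ∂μ) * (x * x) + (2 * ∫ ω, f ω * g ω ∂μ) * x +
      ∫ ω, g ω ^ 2 ∂μ := by
    intro x
    have h1 : Integrable (fun ω => f ω ^ 2 * (x * x) + f ω * g ω * (2 * x)) μ :=
      (hf.mul_const _).add (hfg.mul_const _)
    have h2 : ∫ ω, (f ω * x + g ω) ^ 2 ∂μ = (∫ ω, f ω ^ 2 ∂μ) * (x * x) +
        (2 * ∫ ω, f ω * g ω ∂μ) * x + ∫ ω, g ω ^ 2 ∂μ := by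
      have e : ∀ ω, (f ω * x + g ω) ^ 2 =
          f ω ^ 2 * (x * x) + f ω * g ω * (2 * x) + g ω ^ 2 := fun ω => by ring
      simp_rw [e]
      rw [integral_add h1 hg, integral_add (hf.mul_const _) (hfg.mul_const _), integral_mul_const,
        integral_mul_const]
      ring
    rw [← h2]
    exact integral_nonneg fun _ => sq_nonneg _
  have := discrim_le_zero key
  rw [discrim] at this
  nlinarith

variable {d : ℕ} [IsProbabilityMeasure μ]

theorem HasChaosMGF.integrable_sq_dotProduct {z : Ω → Fin d → ℝ} (hz : Measurable z) {v : ℝ}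
    (hv : 0 < v) (hmgf : ∀ u : Fin d → ℝ, u ⬝ᵥ u ≤ 1 → HasChaosMGF (fun ω => z ω ⬝ᵥ u) v μ)
    (u : Fin d → ℝ) : Integrable (fun ω => (z ω ⬝ᵥ u) ^ 2) μ ∧
      ∫ ω, (z ω ⬝ᵥ u) ^ 2 ∂μ ≤ 5 * v * (u ⬝ᵥ u) := by
  have hm : ∀ u : Fin d → ℝ, Measurable fun ω => z ω ⬝ᵥ u := fun u =>
    (Continuous.measurable (by fun_prop : Continuous fun x : Fin d → ℝ => x ⬝ᵥ u)).comp hz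
  rcases (dotProduct_self_nonneg' u).eq_or_lt with h0 | h0
  · have hu : u = 0 := dotProduct_self_eq_zero.1 h0.symm
    subst hu
    simp
  · set r := Real.sqrt (u ⬝ᵥ u) with hr
    have hrpos : 0 < r := Real.sqrt_pos.2 h0
    have hr2 : r ^ 2 = u ⬝ᵥ u := Real.sq_sqrt h0.le
    have hunit : (r⁻¹ • u) ⬝ᵥ (r⁻¹ • u) ≤ 1 := by
      rw [smul_dotProduct, dotProduct_smul, smul_eq_mul, smul_eq_mul, ← hr2]
      field_simp
      exact le_refl _
    obtain ⟨i, b⟩ := (hmgf _ hunit).integrable_sq_and_le hv (hm _)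
    have e : ∀ ω, (z ω ⬝ᵥ u) ^ 2 = r ^ 2 * (z ω ⬝ᵥ (r⁻¹ • u)) ^ 2 := fun ω => by
      rw [dotProduct_smul, smul_eq_mul]; field_simp
    simp_rw [e]
    refine ⟨i.const_mul _, ?_⟩
    rw [integral_const_mul, hr2, mul_comm]
    exact mul_le_mul_of_nonneg_right b h0.le

/-- If every coordinate is below its own threshold, the squared norm is at most `d` times the
squared threshold; the union bound over coordinates gives the factor `d`. -/
theorem HasChaosMGF.measure_dotProduct_self_gt_le {z : Ω → Fin d → ℝ} {v : ℝ}
    (hv : 0 < v) (hmgf : ∀ u : Fin d → ℝ, u ⬝ᵥ u ≤ 1 → HasChaosMGF (fun ω => z ω ⬝ᵥ u) v μ)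
    (s : ℝ) :
    μ {ω | (4 * Real.sqrt (d * v) * s) ^ 2 < z ω ⬝ᵥ z ω} ≤
      ENNReal.ofReal (3 * d * Real.exp (-s)) := by
  have hsub : {ω | (4 * Real.sqrt (d * v) * s) ^ 2 < z ω ⬝ᵥ z ω} ⊆
      ⋃ i : Fin d, {ω | 4 * Real.sqrt v * s < |z ω ⬝ᵥ Pi.single i 1|} := by
    intro ω hω
    by_contra hcon
    simp only [Set.mem_iUnion, Set.mem_ofPred_eq, not_exists, not_lt, dotProduct_single,
      mul_one] at hcon hω
    refine absurd hω (not_lt.2 ?_)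
    have h1 : ∀ i, z ω i * z ω i ≤ (4 * Real.sqrt v * s) ^ 2 := fun i => by
      rw [← pow_two, ← sq_abs]
      exact pow_le_pow_left₀ (abs_nonneg _) (hcon i) 2
    refine (Finset.sum_le_card_nsmul _ _ _ fun i _ => h1 i).trans (le_of_eq ?_)
    rw [mul_pow, mul_pow, mul_pow, mul_pow, Real.sq_sqrt hv.le, Real.sq_sqrt (by positivity)]
    simp
    ring
  refine (measure_mono hsub).trans ((measure_iUnion_fintype_le _ _).trans ?_)
  have h2 : ∀ i : Fin d, μ {ω | 4 * Real.sqrt v * s < |z ω ⬝ᵥ Pi.single i 1|} ≤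
      ENNReal.ofReal (3 * Real.exp (-s)) := fun i =>
    (hmgf (Pi.single i 1) (by simp)).measure_abs_gt_le hv s
  refine (Finset.sum_le_sum fun i _ => h2 i).trans (le_of_eq ?_)
  rw [Finset.sum_const, Finset.card_univ, Fintype.card_fin, nsmul_eq_mul,
    ← ENNReal.ofReal_natCast, ← ENNReal.ofReal_mul (Nat.cast_nonneg _)]
  congr 1; ring

/-- Bernstein needs bounded centered vectors: the deviation from `c` is cut off at norm `R` and
recentred by its mean `β`. As `T` acts on values of `X`, independence is inherited. The uncut
deviation has mean zero, so `β` is minus its integral over the cut-off event, exponentially small by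
Cauchy–Schwarz. -/
theorem exists_truncation {X : Ω → Fin d → ℝ} (hX : Measurable X) {c : Fin d → ℝ} {v : ℝ}
    (hv : 0 < v)
    (hmgf : ∀ u : Fin d → ℝ, u ⬝ᵥ u ≤ 1 → HasChaosMGF (fun ω => (X ω - c) ⬝ᵥ u) v μ)
    (hmean : ∀ u : Fin d → ℝ, ∫ ω, (X ω - c) ⬝ᵥ u ∂μ = 0) {s R : ℝ} (hs : 0 ≤ s)
    (hR : R = 4 * Real.sqrt (d * v) * s) :
    ∃ (T : (Fin d → ℝ) → Fin d → ℝ) (β : Fin d → ℝ), Measurable T ∧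
      (∀ x, T x ⬝ᵥ T x ≤ (2 * R) ^ 2) ∧ (∀ i, ∫ ω, T (X ω) i ∂μ = 0) ∧
      (∀ u, ∫ ω, (T (X ω) ⬝ᵥ u) ^ 2 ∂μ ≤ 5 * v * (u ⬝ᵥ u)) ∧
      (∀ u, (β ⬝ᵥ u) ^ 2 ≤ 15 * v * d * Real.exp (-s) * (u ⬝ᵥ u)) ∧
      (∀ x, (x - c) ⬝ᵥ (x - c) ≤ R ^ 2 → x = c + β + T x) ∧
      μ {ω | R ^ 2 < (X ω - c) ⬝ᵥ (X ω - c)} ≤ ENNReal.ofReal (3 * d * Real.exp (-s)) := by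
  have hR0 : 0 ≤ R := by rw [hR]; positivity
  set z : Ω → Fin d → ℝ := fun ω => X ω - c with hz
  have hzm : Measurable z := hX.sub_const c
  let τ : (Fin d → ℝ) → Fin d → ℝ := fun x =>
    if (x - c) ⬝ᵥ (x - c) ≤ R ^ 2 then x - c else 0
  have hset : MeasurableSet {x : Fin d → ℝ | (x - c) ⬝ᵥ (x - c) ≤ R ^ 2} :=
    measurableSet_le (Continuous.measurable (by fun_prop)) measurable_const
  have hτm : Measurable τ := Measurable.ite hset (measurable_id.sub_const c) measurable_const
  have hτb : ∀ x, τ x ⬝ᵥ τ x ≤ R ^ 2 := fun x => by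
    simp only [τ]
    split_ifs with h
    · exact h
    · rw [zero_dotProduct]; positivity
  have mdot : ∀ u : Fin d → ℝ, Measurable fun ω => τ (X ω) ⬝ᵥ u := fun u =>
    (Continuous.measurable (by fun_prop : Continuous fun x : Fin d → ℝ => x ⬝ᵥ u)).comp
      (hτm.comp hX)
  have hsqb : ∀ (u : Fin d → ℝ) x, (τ x ⬝ᵥ u) ^ 2 ≤ R ^ 2 * (u ⬝ᵥ u) := fun u x =>
    (sq_dotProduct_le _ _).trans (mul_le_mul_of_nonneg_right (hτb x) (dotProduct_self_nonneg' u))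
  have isq : ∀ u : Fin d → ℝ, Integrable (fun ω => (τ (X ω) ⬝ᵥ u) ^ 2) μ := fun u =>
    integrable_of_abs_le ((mdot u).pow_const 2) (C := R ^ 2 * (u ⬝ᵥ u)) fun ω => by
      rw [abs_of_nonneg (sq_nonneg _)]; exact hsqb u _
  have hL2 : ∀ u : Fin d → ℝ, MemLp (fun ω => τ (X ω) ⬝ᵥ u) 2 μ := fun u =>
    (memLp_two_iff_integrable_sq (mdot u).aestronglyMeasurable).2 (isq u)
  have hint : ∀ u : Fin d → ℝ, Integrable (fun ω => τ (X ω) ⬝ᵥ u) μ := fun u =>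
    (hL2 u).integrable one_le_two
  have hinti : ∀ i, Integrable (fun ω => τ (X ω) i) μ := fun i => by
    simpa using hint (Pi.single i 1)
  set β : Fin d → ℝ := fun i => ∫ ω, τ (X ω) i ∂μ with hβ
  have hβu : ∀ u : Fin d → ℝ, β ⬝ᵥ u = ∫ ω, τ (X ω) ⬝ᵥ u ∂μ := fun u => by
    simp only [dotProduct]
    rw [integral_finsetSum _ fun i _ => (hinti i).mul_const _]
    simp_rw [integral_mul_const]
    rfl
  have hβsq : ∀ u : Fin d → ℝ, (β ⬝ᵥ u) ^ 2 ≤ ∫ ω, (τ (X ω) ⬝ᵥ u) ^ 2 ∂μ := fun u => by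
    rw [hβu]
    have := sq_integral_mul_le (μ := μ) (f := fun _ => (1 : ℝ)) (g := fun ω => τ (X ω) ⬝ᵥ u)
      (by simp) (isq u) (by simpa using hint u)
    simpa using this
  have hββ : β ⬝ᵥ β ≤ R ^ 2 := by
    have h1 : (β ⬝ᵥ β) ^ 2 ≤ R ^ 2 * (β ⬝ᵥ β) := by
      refine (hβsq β).trans ?_
      have : ∫ ω, (τ (X ω) ⬝ᵥ β) ^ 2 ∂μ ≤ ∫ _, R ^ 2 * (β ⬝ᵥ β) ∂μ :=
        integral_mono (isq β) (integrable_const _) fun ω => hsqb β _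
      simpa using this
    rcases (dotProduct_self_nonneg' β).eq_or_lt with h0 | h0
    · exact h0.symm.le.trans (sq_nonneg R)
    · rw [pow_two] at h1
      exact le_of_mul_le_mul_right h1 h0
  have hmom := HasChaosMGF.integrable_sq_dotProduct hzm hv hmgf
  have hbad := HasChaosMGF.measure_dotProduct_self_gt_le hv hmgf s
  rw [← hR] at hbad
  have hτz : ∀ u ω, (τ (X ω) ⬝ᵥ u) ^ 2 ≤ (z ω ⬝ᵥ u) ^ 2 := fun u ω => by
    simp only [τ]
    split_ifs with h
    · exact le_refl _
    · rw [zero_dotProduct, zero_pow two_ne_zero]; positivity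
  have hvar : ∀ u : Fin d → ℝ, ∫ ω, (τ (X ω) ⬝ᵥ u) ^ 2 ∂μ ≤ 5 * v * (u ⬝ᵥ u) := fun u =>
    (integral_mono (isq u) (hmom u).1 fun ω => hτz u ω).trans (hmom u).2
  -- Recentring at most doubles the radius, since `‖β‖ ≤ R`.
  refine ⟨fun x => τ x - β, β, hτm.sub_const β, fun x => ?_, fun i => ?_, fun u => ?_, fun u => ?_,
    fun x hx => ?_, hbad⟩
  · have h1 : (τ x - β) ⬝ᵥ (τ x - β) + (τ x + β) ⬝ᵥ (τ x + β) = 2 * (τ x ⬝ᵥ τ x) + 2 * (β ⬝ᵥ β) := by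
      simp only [sub_dotProduct, dotProduct_sub, add_dotProduct, dotProduct_add]
      rw [dotProduct_comm β (τ x)]; ring
    have h2 := dotProduct_self_nonneg' (τ x + β)
    have h3 := hτb x
    nlinarith
  · simp only [Pi.sub_apply]
    rw [integral_sub (hinti i) (integrable_const _)]
    simp [hβ]
  · simp only [sub_dotProduct]
    refine le_trans ?_ (hvar u)
    have h1 : Integrable (fun ω => (τ (X ω) ⬝ᵥ u) ^ 2 - 2 * (β ⬝ᵥ u) * (τ (X ω) ⬝ᵥ u)) μ :=
      (isq u).sub ((hint u).const_mul _)
    have e : ∀ ω, (τ (X ω) ⬝ᵥ u - β ⬝ᵥ u) ^ 2 =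
        (τ (X ω) ⬝ᵥ u) ^ 2 - 2 * (β ⬝ᵥ u) * (τ (X ω) ⬝ᵥ u) + (β ⬝ᵥ u) ^ 2 := fun ω => by ring
    simp_rw [e]
    rw [integral_add h1 (integrable_const _), integral_sub (isq u) ((hint u).const_mul _),
      integral_const_mul, ← hβu]
    simp only [integral_const, probReal_univ, one_smul]
    nlinarith [sq_nonneg (β ⬝ᵥ u)]
  · set bad : Set Ω := {ω | R ^ 2 < z ω ⬝ᵥ z ω} with hbaddef
    have hbm : MeasurableSet bad := measurableSet_lt measurable_const
      ((Continuous.measurable (by fun_prop : Continuous fun x : Fin d → ℝ => x ⬝ᵥ x)).comp hzm)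
    have hzu : MemLp (fun ω => z ω ⬝ᵥ u) 2 μ := (memLp_two_iff_integrable_sq
      ((Continuous.measurable (by fun_prop : Continuous fun x : Fin d → ℝ => x ⬝ᵥ u)).comp
        hzm).aestronglyMeasurable).2 (hmom u).1
    have hdec : ∀ ω, τ (X ω) ⬝ᵥ u = z ω ⬝ᵥ u - bad.indicator 1 ω * (z ω ⬝ᵥ u) := fun ω => by
      by_cases h : ω ∈ bad
      · have : ¬ ((X ω - c) ⬝ᵥ (X ω - c) ≤ R ^ 2) := not_le.2 h
        have e : τ (X ω) = 0 := if_neg this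
        rw [e, Set.indicator_of_mem h, zero_dotProduct, Pi.one_apply, one_mul, sub_self]
      · have : (X ω - c) ⬝ᵥ (X ω - c) ≤ R ^ 2 := not_lt.1 h
        have e : τ (X ω) = z ω := if_pos this
        rw [e, Set.indicator_of_notMem h, zero_mul, sub_zero]
    have hind2 : MemLp (bad.indicator (1 : Ω → ℝ)) 2 μ := (memLp_const 1).indicator hbm
    have hprod : Integrable (fun ω => bad.indicator (1 : Ω → ℝ) ω * (z ω ⬝ᵥ u)) μ :=
      hind2.integrable_mul hzu
    have hβbad : β ⬝ᵥ u = - ∫ ω, bad.indicator (1 : Ω → ℝ) ω * (z ω ⬝ᵥ u) ∂μ := by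
      rw [hβu]
      simp_rw [hdec]
      rw [integral_sub (hzu.integrable one_le_two) hprod, hmean u, zero_sub]
    have hindsq : ∀ ω, bad.indicator (1 : Ω → ℝ) ω ^ 2 = bad.indicator 1 ω := fun ω => by
      by_cases h : ω ∈ bad <;> simp [h]
    -- The indicator is its own square; `15` is the `5` of the second moment times the `3` of the
    -- tail.
    have hcs := sq_integral_mul_le (μ := μ) hind2.integrable_sq (hmom u).1 hprod
    simp_rw [hindsq] at hcs
    rw [integral_indicator_one hbm] at hcs
    rw [hβbad, neg_sq]
    refine hcs.trans ?_
    have hp : μ.real bad ≤ 3 * d * Real.exp (-s) :=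
      ENNReal.toReal_le_of_le_ofReal (by positivity) hbad
    refine (mul_le_mul hp (hmom u).2 (integral_nonneg fun _ => sq_nonneg _)
      (by positivity)).trans (le_of_eq (by ring))
  · simp only [τ, if_pos hx]
    abel

/-- Concentration of a sum of products of two independent vectors with chaos-type tails. The bad
event `B₁` controls the size of the summands, the bad event `B₂` their cancellation. -/
theorem exists_sum_mul_concentration {ι : Type*} [Fintype ι]
    {X : ι → Ω → (Fin d → ℝ) × (Fin d → ℝ)} (hX : ∀ m, Measurable (X m)) (hind : iIndepFun X μ)
    (hpair : ∀ m, IndepFun (fun ω => (X m ω).1) (fun ω => (X m ω).2) μ)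
    {c : ι → (Fin d → ℝ) × (Fin d → ℝ)} {v : ℝ} (hv : 0 < v)
    (hmgf1 : ∀ m (u : Fin d → ℝ), u ⬝ᵥ u ≤ 1 →
      HasChaosMGF (fun ω => ((X m ω).1 - (c m).1) ⬝ᵥ u) v μ)
    (hmgf2 : ∀ m (u : Fin d → ℝ), u ⬝ᵥ u ≤ 1 →
      HasChaosMGF (fun ω => ((X m ω).2 - (c m).2) ⬝ᵥ u) v μ)
    (hmean1 : ∀ m (u : Fin d → ℝ), ∫ ω, ((X m ω).1 - (c m).1) ⬝ᵥ u ∂μ = 0)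
    (hmean2 : ∀ m (u : Fin d → ℝ), ∫ ω, ((X m ω).2 - (c m).2) ⬝ᵥ u ∂μ = 0) {G : ℝ} (hG : 0 ≤ G)
    (hc1 : ∀ m, (c m).1 ⬝ᵥ (c m).1 ≤ G ^ 2) (hc2 : ∀ m, (c m).2 ⬝ᵥ (c m).2 ≤ G ^ 2) {s R : ℝ}
    (hs : 0 ≤ s) (hR : R = 4 * Real.sqrt (d * v) * s)
    (hbias : 15 * v * d * Real.exp (-s) ≤ G ^ 2) :
    ∃ (q : ι → (Fin d → ℝ) × (Fin d → ℝ)),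
      (∀ m u, (((q m).1 - (c m).1) ⬝ᵥ u) ^ 2 ≤ 15 * v * d * Real.exp (-s) * (u ⬝ᵥ u)) ∧
      (∀ m u, (((q m).2 - (c m).2) ⬝ᵥ u) ^ 2 ≤ 15 * v * d * Real.exp (-s) * (u ⬝ᵥ u)) ∧
      ∃ B₁ : Set Ω, μ B₁ ≤ 2 * Fintype.card ι * ENNReal.ofReal (3 * d * Real.exp (-s)) ∧
      (∀ ω ∉ B₁, ∀ u : Fin d → ℝ, |∑ m, (((X m ω).1 ⬝ᵥ u) * ((X m ω).2 ⬝ᵥ u) -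
        ((q m).1 ⬝ᵥ u) * ((q m).2 ⬝ᵥ u))| ≤
          Fintype.card ι * (8 * G * R + 4 * R ^ 2) * (u ⬝ᵥ u)) ∧
      ∀ θ t : ℝ, 0 < θ → θ * (8 * G * R + 4 * R ^ 2) ≤ 1 → ∃ B₂ : Set Ω,
        μ B₂ ≤ 2 * ENNReal.ofReal (d * Real.exp (θ ^ 2 * (15 * d * v *
          (5 * v + 8 * G ^ 2)) * Fintype.card ι - θ * t)) ∧
        ∀ ω, ω ∉ B₁ → ω ∉ B₂ → ∀ u : Fin d → ℝ, |∑ m, (((X m ω).1 ⬝ᵥ u) * ((X m ω).2 ⬝ᵥ u) -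
          ((q m).1 ⬝ᵥ u) * ((q m).2 ⬝ᵥ u))| ≤ t * (u ⬝ᵥ u) := by
  have hR0 : 0 ≤ R := by rw [hR]; positivity
  choose T₁ β₁ hT₁ hb₁ hz₁ hv₁ hβ₁ he₁ hbad₁ using fun m =>
    exists_truncation (measurable_fst.comp (hX m)) hv (hmgf1 m) (hmean1 m) hs hR
  choose T₂ β₂ hT₂ hb₂ hz₂ hv₂ hβ₂ he₂ hbad₂ using fun m =>
    exists_truncation (measurable_snd.comp (hX m)) hv (hmgf2 m) (hmean2 m) hs hR
  simp only [Function.comp_apply] at hz₁ hv₁ hbad₁ hz₂ hv₂ hbad₂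
  -- The bias condition keeps the shifted centres `c + β` within radius `2 * G`.
  have hqG : ∀ c β : Fin d → ℝ, c ⬝ᵥ c ≤ G ^ 2 →
      (∀ u, (β ⬝ᵥ u) ^ 2 ≤ 15 * v * d * Real.exp (-s) * (u ⬝ᵥ u)) →
      (c + β) ⬝ᵥ (c + β) ≤ (2 * G) ^ 2 := by
    intro c β hc hβ
    have hββ : β ⬝ᵥ β ≤ G ^ 2 := by
      rcases (dotProduct_self_nonneg' β).eq_or_lt with h0 | h0
      · exact h0.symm.le.trans (sq_nonneg G)
      · have := (hβ β).trans (mul_le_mul_of_nonneg_right hbias h0.le)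
        rw [pow_two] at this
        exact le_of_mul_le_mul_right this h0
    have h1 : (c + β) ⬝ᵥ (c + β) + (c - β) ⬝ᵥ (c - β) = 2 * (c ⬝ᵥ c) + 2 * (β ⬝ᵥ β) := by
      simp only [sub_dotProduct, dotProduct_sub, add_dotProduct, dotProduct_add]
      rw [dotProduct_comm β c]; ring
    have h2 := dotProduct_self_nonneg' (c - β)
    nlinarith
  set a : ι → Ω → (Fin d → ℝ) × (Fin d → ℝ) := fun m ω => (T₁ m (X m ω).1, T₂ m (X m ω).2) with ha
  set q : ι → (Fin d → ℝ) × (Fin d → ℝ) := fun m => ((c m).1 + β₁ m, (c m).2 + β₂ m) with hq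
  set B₁ : Set Ω := ⋃ m, ({ω | R ^ 2 < ((X m ω).1 - (c m).1) ⬝ᵥ ((X m ω).1 - (c m).1)} ∪
    {ω | R ^ 2 < ((X m ω).2 - (c m).2) ⬝ᵥ ((X m ω).2 - (c m).2)}) with hB₁
  have hdec : ∀ ω ∉ B₁, ∀ m, (X m ω).1 = (q m).1 + (a m ω).1 ∧
      (X m ω).2 = (q m).2 + (a m ω).2 := by
    intro ω hω m
    simp only [hB₁, Set.mem_iUnion, Set.mem_union, Set.mem_ofPred_eq, not_exists, not_or,
      not_lt] at hω
    exact ⟨he₁ m _ (hω m).1, he₂ m _ (hω m).2⟩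
  have ham : ∀ m, Measurable (a m) := fun m =>
    ((hT₁ m).comp (measurable_fst.comp (hX m))).prodMk ((hT₂ m).comp (measurable_snd.comp (hX m)))
  have hg1 : ∀ m, (q m).1 ⬝ᵥ (q m).1 ≤ (2 * G) ^ 2 := fun m => hqG _ _ (hc1 m) (hβ₁ m)
  have hg2 : ∀ m, (q m).2 ⬝ᵥ (q m).2 ≤ (2 * G) ^ 2 := fun m => hqG _ _ (hc2 m) (hβ₂ m)
  refine ⟨q, fun m u => by simpa [hq] using hβ₁ m u, fun m u => by simpa [hq] using hβ₂ m u, B₁, ?_,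
    fun ω hω u => ?_, fun θ t hθ hθR => ?_⟩
  · refine (measure_iUnion_fintype_le _ _).trans ?_
    refine (Finset.sum_le_sum fun m _ => (measure_union_le _ _).trans
      (add_le_add (hbad₁ m) (hbad₂ m))).trans (le_of_eq ?_)
    rw [Finset.sum_const, Finset.card_univ, nsmul_eq_mul]
    ring
  -- Off `B₁` a termwise bound holds without any cancellation; it serves when there are few
  -- trajectories.
  · have hu := dotProduct_self_nonneg' u
    refine (Finset.abs_sum_le_sum_abs _ _).trans ?_
    have hterm : ∀ m, |((X m ω).1 ⬝ᵥ u) * ((X m ω).2 ⬝ᵥ u) - ((q m).1 ⬝ᵥ u) * ((q m).2 ⬝ᵥ u)| ≤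
        (8 * G * R + 4 * R ^ 2) * (u ⬝ᵥ u) := by
      intro m
      obtain ⟨e1, e2⟩ := hdec ω hω m
      rw [e1, e2, add_dotProduct (q m).1 (a m ω).1, add_dotProduct (q m).2 (a m ω).2]
      have hsq : ∀ (x : Fin d → ℝ) (C : ℝ), 0 ≤ C → x ⬝ᵥ x ≤ C ^ 2 →
          |x ⬝ᵥ u| ≤ C * Real.sqrt (u ⬝ᵥ u) := by
        intro x C hC hx
        refine abs_le_of_sq_le_sq ?_ (by positivity)
        rw [mul_pow, Real.sq_sqrt hu]
        exact (sq_dotProduct_le _ _).trans (mul_le_mul_of_nonneg_right hx hu)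
      have k1 := hsq (a m ω).1 _ (by positivity) (hb₁ m (X m ω).1)
      have k2 := hsq (a m ω).2 _ (by positivity) (hb₂ m (X m ω).2)
      have k3 := hsq _ _ (by positivity) (hg1 m)
      have k4 := hsq _ _ (by positivity) (hg2 m)
      generalize (a m ω).1 ⬝ᵥ u = x₁ at *
      generalize (a m ω).2 ⬝ᵥ u = x₂ at *
      generalize (q m).1 ⬝ᵥ u = y₁ at *
      generalize (q m).2 ⬝ᵥ u = y₂ at *
      have e : (y₁ + x₁) * (y₂ + x₂) - y₁ * y₂ = y₁ * x₂ + x₁ * y₂ + x₁ * x₂ := by ring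
      have hs : Real.sqrt (u ⬝ᵥ u) * Real.sqrt (u ⬝ᵥ u) = u ⬝ᵥ u := Real.mul_self_sqrt hu
      have h0 := Real.sqrt_nonneg (u ⬝ᵥ u)
      rw [e]
      refine (abs_add_le _ _).trans ((add_le_add_left (abs_add_le _ _) _).trans ?_)
      rw [abs_mul, abs_mul, abs_mul]
      have m1 := mul_le_mul k3 k2 (abs_nonneg _) (by positivity)
      have m2 := mul_le_mul k1 k4 (abs_nonneg _) (by positivity)
      have m3 := mul_le_mul k1 k2 (abs_nonneg _) (by positivity)
      calc _ ≤ 2 * G * √(u ⬝ᵥ u) * (2 * R * √(u ⬝ᵥ u)) + 2 * R * √(u ⬝ᵥ u) *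
            (2 * G * √(u ⬝ᵥ u)) + 2 * R * √(u ⬝ᵥ u) * (2 * R * √(u ⬝ᵥ u)) := by linarith
        _ = (8 * G * R + 4 * R ^ 2) * (√(u ⬝ᵥ u) * √(u ⬝ᵥ u)) := by ring
        _ = _ := by rw [hs]
    refine (Finset.sum_le_card_nsmul _ _ _ fun m _ => hterm m).trans (le_of_eq ?_)
    rw [Finset.card_univ, nsmul_eq_mul]; ring
  -- Substituting the radii `2 * G`, `2 * R` and the second moment `5 * v` yields the stated
  -- condition on `θ` and the stated variance.
  · have hBern := measure_exists_lt_abs_sum_mul_sub_le (μ := μ) ham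
      (hind.comp (fun m x => (T₁ m x.1, T₂ m x.2)) fun m =>
        ((hT₁ m).comp measurable_fst).prodMk ((hT₂ m).comp measurable_snd))
      (fun m => (hpair m).comp (hT₁ m) (hT₂ m)) (by positivity : 0 ≤ 2 * R)
      (fun m ω => hb₁ m _) (fun m ω => hb₂ m _) hz₁ hz₂ (by positivity : 0 ≤ 5 * v) hv₁ hv₂
      (by positivity : 0 ≤ 2 * G) hg1 hg2 hθ ((le_of_eq (by ring)).trans hθR) t
    refine ⟨_, hBern.trans (le_of_eq ?_), fun ω h1 h2 u => ?_⟩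
    · rw [Fintype.card_fin]
      congr 5
      ring
    · simp only [Set.mem_ofPred_eq, not_exists, not_lt] at h2
      have := h2 u
      simp only [← (hdec ω h1 _).1, ← (hdec ω h1 _).2] at this
      exact this

end Truncation

end MixedLDS

namespace MixedLDS

/-! ### Independence of blocks and of trajectories. -/

section Independence

variable {Ω : Type*} [MeasurableSpace Ω] {μ : Measure Ω}

/-- Independence means that the joint law is a product measure, and a product over a sigma type is
an iterated product. -/
theorem iIndepFun_curry {ι : Type*} {κ : ι → Type*} {E : Type*} [MeasurableSpace E]
    {X : (i : ι) → κ i → Ω → E} (mX : ∀ i j, Measurable (X i j))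
    (h : iIndepFun (fun p : (i : ι) × κ i => X p.1 p.2) μ) :
    iIndepFun (fun i ω j => X i j ω) μ := by
  have := h.isProbabilityMeasure
  have h2 : ∀ i, iIndepFun (X i) μ := fun i =>
    h.precomp (g := fun j : κ i => (⟨i, j⟩ : (i : ι) × κ i)) sigma_mk_injective
  have : ∀ i j, IsProbabilityMeasure (μ.map (X i j)) :=
    fun i j => Measure.isProbabilityMeasure_map (mX i j).aemeasurable
  have e : (MeasurableEquiv.piCurry fun (i : ι) (_ : κ i) => E) ∘
      (fun ω (p : (i : ι) × κ i) => X p.1 p.2 ω) = fun ω i j => X i j ω := by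
    ext; simp [Sigma.curry]
  rw [iIndepFun_iff_map_fun_eq_infinitePi_map (by fun_prop)] at h ⊢
  rw [← e, ← Measure.map_map (by fun_prop) (by fun_prop), h,
    Measure.infinitePi_map_piCurry (fun i j => μ.map (X i j))]
  congr 1
  funext i
  rw [(iIndepFun_iff_map_fun_eq_infinitePi_map (by fun_prop)).1 (h2 i)]

variable {d : ℕ} {W : Matrix (Fin d) (Fin d) ℝ}

theorem IsGaussianNoise.shift {w : ℕ → Ω → EuclideanSpace ℝ (Fin d)} {n : ℕ}
    (hw : IsGaussianNoise w W n μ) (a : ℕ) :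
    IsGaussianNoise (fun r => w (a + r)) W (n - a) μ where
  measurable r := hw.measurable _
  law r hr := hw.law _ (by omega)
  indep := hw.indep.precomp (g := fun r : Fin (n - a) => (⟨a + r, by omega⟩ : Fin n))
    fun r r' h => by
      simp only [Fin.mk.injEq] at h
      ext
      omega

/-- Statistics of disjoint blocks of the noise are independent. -/
theorem IsGaussianNoise.indepFun_blocks {w : ℕ → Ω → EuclideanSpace ℝ (Fin d)} {n : ℕ}
    (hw : IsGaussianNoise w W n μ) {a : ℕ} {β : Type*} [MeasurableSpace β]
    {f g : (ℕ → EuclideanSpace ℝ (Fin d)) → β} (hf : Measurable f) (hg : Measurable g)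
    (ha : a ≤ n) (hfd : ∀ y y', (∀ r < a, y r = y' r) → f y = f y')
    (hgd : ∀ y y', (∀ r < n - a, y r = y' r) → g y = g y') :
    IndepFun (fun ω => f fun r => w r ω) (fun ω => g fun r => w (a + r) ω) μ := by
  classical
  let s : Finset (Fin n) := Finset.univ.filter fun r => (r : ℕ) < a
  let t : Finset (Fin n) := Finset.univ.filter fun r => a ≤ (r : ℕ)
  have hst : Disjoint s t := Finset.disjoint_filter.2 fun r _ h h' => by omega
  have key := hw.indep.indepFun_finset s t hst fun r => hw.measurable _
  -- Noise outside the block is set to `0`, which locality of the statistic makes harmless; the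
  -- statistic becomes a function of finitely many vectors.
  let F : (s → EuclideanSpace ℝ (Fin d)) → ℕ → EuclideanSpace ℝ (Fin d) := fun y r =>
    if h : r < a then y ⟨⟨r, h.trans_le ha⟩, by simp [s, h]⟩ else 0
  let G : (t → EuclideanSpace ℝ (Fin d)) → ℕ → EuclideanSpace ℝ (Fin d) := fun y r =>
    if h : r < n - a then y ⟨⟨a + r, by omega⟩, by simp [t]⟩ else 0
  have hF : Measurable F := measurable_pi_lambda _ fun r => by
    by_cases h : r < a
    · simp only [F, dif_pos h]; exact measurable_pi_apply _
    · simp only [F, dif_neg h]; exact measurable_const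
  have hG : Measurable G := measurable_pi_lambda _ fun r => by
    by_cases h : r < n - a
    · simp only [G, dif_pos h]; exact measurable_pi_apply _
    · simp only [G, dif_neg h]; exact measurable_const
  have key2 := key.comp (hf.comp hF) (hg.comp hG)
  convert key2 using 1
  · funext ω
    exact hfd _ _ fun r hr => by simp [F, hr]
  · funext ω
    exact hgd _ _ fun r hr => by simp [G, hr]

/-- Statistics of the noise of different trajectories are independent. -/
theorem iIndepFun_trajectories {ι : Type*} {T : ι → ℕ}
    {w : ι → ℕ → Ω → EuclideanSpace ℝ (Fin d)} (hw : ∀ m t, Measurable (w m t))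
    (hind : iIndepFun (fun p : (Σ m : ι, Fin (T m)) => w p.1 p.2) μ)
    {β : Type*} [MeasurableSpace β] {f : ι → (ℕ → EuclideanSpace ℝ (Fin d)) → β}
    (hf : ∀ m, Measurable (f m)) (hfd : ∀ m y y', (∀ r < T m, y r = y' r) → f m y = f m y') :
    iIndepFun (fun m ω => f m fun r => w m r ω) μ := by
  have key := iIndepFun_curry (X := fun m (t : Fin (T m)) => w m t) (fun m t => hw m t) hind
  let F : ∀ m, (Fin (T m) → EuclideanSpace ℝ (Fin d)) → ℕ → EuclideanSpace ℝ (Fin d) := fun m y r =>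
    if h : r < T m then y ⟨r, h⟩ else 0
  have hF : ∀ m, Measurable (F m) := fun m => measurable_pi_lambda _ fun r => by
    by_cases h : r < T m
    · simp only [F, dif_pos h]; exact measurable_pi_apply _
    · simp only [F, dif_neg h]; exact measurable_const
  have key2 := key.comp (fun m => f m ∘ F m) fun m => (hf m).comp (hF m)
  convert key2 using 1
  funext m ω
  exact hfd _ _ _ fun r hr => by simp [F, hr]

end Independence

/-! ### Lagged window averages, common to both estimators, and their means. -/

section LagVec

variable {d : ℕ}

/-- Average of `(x (t + b))_i • x t` over the window `s`. -/
noncomputable def lagVec (b : ℕ) (s : Finset ℕ) (x : ℕ → EuclideanSpace ℝ (Fin d)) (i : Fin d) :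
    EuclideanSpace ℝ (Fin d) :=
  (s.card : ℝ)⁻¹ • ∑ t ∈ s, (x (t + b) i) • x t

theorem lagVec_dotProduct (b : ℕ) (s : Finset ℕ) (x : ℕ → EuclideanSpace ℝ (Fin d)) (i : Fin d)
    (u : Fin d → ℝ) : (lagVec b s x i).ofLp ⬝ᵥ u =
      (s.card : ℝ)⁻¹ * ∑ t ∈ s, x (t + b) i * ((x t).ofLp ⬝ᵥ u) := by
  simp only [lagVec, WithLp.ofLp_smul, WithLp.ofLp_sum, smul_dotProduct, smul_eq_mul,
    sum_dotProduct]

theorem lagVec_map_add (b a : ℕ) (s : Finset ℕ) (x : ℕ → EuclideanSpace ℝ (Fin d)) (i : Fin d) :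
    lagVec b (s.map (addLeftEmbedding a)) x i = lagVec b s (fun t => x (a + t)) i := by
  simp [lagVec, add_assoc]

theorem lagVec_congr {b : ℕ} {s : Finset ℕ} {x y : ℕ → EuclideanSpace ℝ (Fin d)} {i : Fin d}
    (h : ∀ t ∈ s, x (t + b) = y (t + b) ∧ x t = y t) : lagVec b s x i = lagVec b s y i := by
  unfold lagVec
  congr 1
  exact Finset.sum_congr rfl fun t ht => by rw [(h t ht).1, (h t ht).2]

theorem continuous_lagVec (b : ℕ) (s : Finset ℕ) (i : Fin d) :
    Continuous fun x : ℕ → EuclideanSpace ℝ (Fin d) => lagVec b s x i := by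
  unfold lagVec
  fun_prop

/-- Expectation of `lagVec` for a system started at zero. -/
noncomputable def lagCov (A W : Matrix (Fin d) (Fin d) ℝ) (b : ℕ) (s : Finset ℕ) (i : Fin d) :
    Fin d → ℝ :=
  (s.card : ℝ)⁻¹ • ∑ t ∈ s, (A ^ b * finAutocov A W t).row i

theorem row_dotProduct (B : Matrix (Fin d) (Fin d) ℝ) (i : Fin d) (u : Fin d → ℝ) :
    B.row i ⬝ᵥ u = Pi.single i 1 ⬝ᵥ B *ᵥ u := by
  rw [single_one_dotProduct]; rfl

theorem lagCov_dotProduct (A W : Matrix (Fin d) (Fin d) ℝ) (b : ℕ) (s : Finset ℕ) (i : Fin d)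
    (u : Fin d → ℝ) : lagCov A W b s i ⬝ᵥ u =
      (s.card : ℝ)⁻¹ * ∑ t ∈ s, Pi.single i 1 ⬝ᵥ (A ^ b * finAutocov A W t) *ᵥ u := by
  simp only [lagCov, smul_dotProduct, smul_eq_mul, sum_dotProduct, row_dotProduct]

theorem abs_inv_card_mul_sum_le {s : Finset ℕ} {f : ℕ → ℝ} {C : ℝ} (hC : 0 ≤ C)
    (hf : ∀ t ∈ s, |f t| ≤ C) : |(s.card : ℝ)⁻¹ * ∑ t ∈ s, f t| ≤ C := by
  rw [abs_mul, abs_of_nonneg (by positivity)]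
  have h := (Finset.abs_sum_le_sum_abs f s).trans (Finset.sum_le_card_nsmul s _ C hf)
  rw [nsmul_eq_mul] at h
  refine (mul_le_mul_of_nonneg_left h (by positivity)).trans ?_
  rcases s.eq_empty_or_nonempty with rfl | hs
  · simpa using hC
  · have : (0 : ℝ) < s.card := by exact_mod_cast hs.card_pos
    rw [inv_mul_cancel_left₀ this.ne']

variable {A W : Matrix (Fin d) (Fin d) ℝ} {κ ρ G : ℝ}

theorem StableSystem.abs_lagCov_dotProduct_le (h : StableSystem A W κ ρ G) (b : ℕ) (s : Finset ℕ)
    (i : Fin d) (u : Fin d → ℝ) : |lagCov A W b s i ⬝ᵥ u| ≤ G * Real.sqrt (u ⬝ᵥ u) := by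
  have hG := h.G_nonneg
  have hu := dotProduct_self_nonneg' u
  rw [lagCov_dotProduct]
  refine abs_inv_card_mul_sum_le (by positivity) fun t _ => abs_le_of_sq_le_sq ?_ (by positivity)
  refine (h.sq_dotProduct_pow_finAutocov_le b t _ u).trans ?_
  rw [mul_pow, mul_pow, Real.sq_sqrt hu]
  have h1 : (min 1 (κ * ρ ^ b)) ^ 2 ≤ 1 := by
    have := h.rho_nonneg
    have := h.one_le_kappa
    refine pow_le_one₀ (by positivity) (min_le_left _ _)
  have e : (Pi.single i 1 : Fin d → ℝ) ⬝ᵥ Pi.single i 1 = 1 := by simp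
  rw [e, one_mul]
  nlinarith [mul_nonneg (sq_nonneg G) hu]

/-- The linear bound is tested on the vector itself. -/
theorem StableSystem.lagCov_dotProduct_self_le (h : StableSystem A W κ ρ G) (b : ℕ) (s : Finset ℕ)
    (i : Fin d) : lagCov A W b s i ⬝ᵥ lagCov A W b s i ≤ G ^ 2 := by
  set c := lagCov A W b s i
  have hc := dotProduct_self_nonneg' c
  have h1 := h.abs_lagCov_dotProduct_le b s i c
  rw [abs_of_nonneg hc] at h1
  have hG := h.G_nonneg
  have h2 := Real.sq_sqrt hc
  have h3 := Real.sqrt_nonneg (c ⬝ᵥ c)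
  have h4 : Real.sqrt (c ⬝ᵥ c) ≤ G := by
    rcases h3.eq_or_lt with h0 | h0
    · rw [← h0]; exact hG
    · refine le_of_mul_le_mul_right ?_ h0
      rw [← pow_two, h2]; exact h1
  rw [← h2]
  exact pow_le_pow_left₀ h3 h4 2

/-- The bias is only the transient of the zero start, and `γ` bounds the memory left at every time
of the window. -/
theorem StableSystem.abs_row_dotProduct_sub_lagCov_le (h : StableSystem A W κ ρ G) (b : ℕ)
    {s : Finset ℕ} (hs : s.Nonempty) (i : Fin d) {γ : ℝ} (hγ : ∀ t ∈ s, κ * ρ ^ t ≤ γ)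
    (u : Fin d → ℝ) : |(A ^ b * autocovZero A W).row i ⬝ᵥ u - lagCov A W b s i ⬝ᵥ u| ≤
      G * γ * Real.sqrt (u ⬝ᵥ u) := by
  have hG := h.G_nonneg
  have hu := dotProduct_self_nonneg' u
  have hρ := h.rho_nonneg
  have hκ := h.one_le_kappa
  have hγ0 : 0 ≤ γ := by
    obtain ⟨t, ht⟩ := hs
    exact le_trans (by positivity) (hγ t ht)
  have hcard : (s.card : ℝ) ≠ 0 := by exact_mod_cast hs.card_pos.ne'
  have e : (A ^ b * autocovZero A W).row i ⬝ᵥ u - lagCov A W b s i ⬝ᵥ u = (s.card : ℝ)⁻¹ * ∑ t ∈ s,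
      (Pi.single i 1 ⬝ᵥ (A ^ b * autocovZero A W) *ᵥ u -
        Pi.single i 1 ⬝ᵥ (A ^ b * finAutocov A W t) *ᵥ u) := by
    rw [lagCov_dotProduct, Finset.sum_sub_distrib, Finset.sum_const, nsmul_eq_mul, mul_sub,
      inv_mul_cancel_left₀ hcard, row_dotProduct]
  rw [e]
  refine abs_inv_card_mul_sum_le (by positivity) fun t ht => abs_le_of_sq_le_sq ?_ (by positivity)
  refine (h.sq_dotProduct_pow_autocovZero_sub_le b t _ u).trans ?_
  have e1 : (Pi.single i 1 : Fin d → ℝ) ⬝ᵥ Pi.single i 1 = 1 := by simp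
  rw [mul_pow (G * γ), Real.sq_sqrt hu, e1, one_mul]
  have := hγ t ht
  gcongr

theorem lagVec_sub_lagCov_dotProduct {Ω : Type*} {w : ℕ → Ω → EuclideanSpace ℝ (Fin d)} (b : ℕ)
    (s : Finset ℕ) (i : Fin d) (u : Fin d → ℝ) (ω : Ω) :
    ((lagVec b s (zeroState A fun r => w r ω) i).ofLp - lagCov A W b s i) ⬝ᵥ u =
      (s.card : ℝ)⁻¹ * ∑ t ∈ s,
        ((Pi.single i 1 ⬝ᵥ (zeroState A (fun r => w r ω) (t + b)).ofLp) *
          (u ⬝ᵥ (zeroState A (fun r => w r ω) t).ofLp) -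
            Pi.single i 1 ⬝ᵥ (A ^ b * finAutocov A W t) *ᵥ u) := by
  rw [sub_dotProduct, lagVec_dotProduct, lagCov_dotProduct, ← mul_sub, ← Finset.sum_sub_distrib]
  congr 1
  refine Finset.sum_congr rfl fun t _ => ?_
  rw [single_one_dotProduct _ (zeroState A (fun r => w r ω) (t + b)).ofLp, dotProduct_comm u]

variable {Ω : Type*} [MeasurableSpace Ω] {μ : Measure Ω} [IsProbabilityMeasure μ]
  {w : ℕ → Ω → EuclideanSpace ℝ (Fin d)} {n : ℕ}

theorem IsGaussianNoise.hasChaosMGF_lagVec (hw : IsGaussianNoise w W n μ) {τ : ℝ}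
    (h : StableSystem A W κ ρ G) (hτ : ∀ m, ∑ k ∈ Finset.range m, min 1 (κ * ρ ^ k) ≤ τ)
    {b : ℕ} {s : Finset ℕ} (hs : ∀ t ∈ s, t + b ≤ n) (i : Fin d) {u : Fin d → ℝ}
    (hu : u ⬝ᵥ u ≤ 1) :
    HasChaosMGF (fun ω => ((lagVec b s (zeroState A fun r => w r ω) i).ofLp -
      lagCov A W b s i) ⬝ᵥ u) (2 * G ^ 2 * τ / s.card) μ := by
  simp_rw [lagVec_sub_lagCov_dotProduct]
  exact hw.hasChaosMGF h hτ (by simp) hu s b hs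

theorem IsGaussianNoise.integral_lagVec_sub (hw : IsGaussianNoise w W n μ) (hW : W.PosSemidef)
    {b : ℕ} {s : Finset ℕ} (hs : ∀ t ∈ s, t + b ≤ n) (i : Fin d) (u : Fin d → ℝ) :
    ∫ ω, ((lagVec b s (zeroState A fun r => w r ω) i).ofLp - lagCov A W b s i) ⬝ᵥ u ∂μ = 0 := by
  simp_rw [lagVec_sub_lagCov_dotProduct]
  have hint : ∀ t ∈ s, Integrable (fun ω =>
      (Pi.single i 1 ⬝ᵥ (zeroState A (fun r => w r ω) (t + b)).ofLp) *
        (u ⬝ᵥ (zeroState A (fun r => w r ω) t).ofLp)) μ := fun t ht =>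
    (hw.memLp_dotProduct_zeroState _ (hs t ht)).integrable_mul
      (hw.memLp_dotProduct_zeroState u (by have := hs t ht; omega))
  have hsub : ∀ t ∈ s, Integrable (fun ω =>
      (Pi.single i 1 ⬝ᵥ (zeroState A (fun r => w r ω) (t + b)).ofLp) *
        (u ⬝ᵥ (zeroState A (fun r => w r ω) t).ofLp) -
          Pi.single i 1 ⬝ᵥ (A ^ b * finAutocov A W t) *ᵥ u) μ := fun t ht =>
    (hint t ht).sub (integrable_const _)
  rw [integral_const_mul, integral_finsetSum _ hsub]
  rw [Finset.sum_eq_zero fun t ht => ?_, mul_zero]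
  rw [integral_sub (hint t ht) (integrable_const _), hw.integral_zeroState_mul hW _ _ (hs t ht)]
  simp

end LagVec

end MixedLDS

namespace MixedLDS

/-! ### Concentration over trajectories of the decoupled window statistics. -/

section WindowConcentration

/-- Choice of the parameters of the matrix Bernstein inequality. -/
theorem exists_bernstein_parameter {G e L n R D V : ℝ} (hG : 0 < G) (he : 0 < e) (he1 : e ≤ 1)
    (hL : 1 ≤ L) (hn : L ≤ n) (hR : R ^ 2 ≤ 32768 * G ^ 2 * (n * e ^ 2 / L))
    (hD : D = 8 * G * R + 4 * R ^ 2) (hV : V ≤ 80640 * G ^ 4 * (n * e ^ 2 / L ^ 3)) :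
    ∃ θ : ℝ, 0 < θ ∧ θ * D ≤ 1 ∧ θ ^ 2 * V * n - θ * (700000 * G ^ 2 * e * n) ≤ -(4 * L) := by
  have hn0 : 0 < n := by linarith
  have hL0 : 0 < L := by linarith
  -- `G ^ 2 * z` dominates `D` up to a constant, because `e ≤ z` when `n ≥ L`; `θ` will be a
  -- multiple of its inverse.
  set z := e * n / L with hz
  have hz0 : 0 < z := by positivity
  have hnL : 1 ≤ n / L := (one_le_div hL0).2 hn
  have hez : n * e ^ 2 / L = e * z := by rw [hz]; ring
  have hez' : e ≤ z := by
    rw [hz, mul_div_assoc]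
    exact le_mul_of_one_le_right he.le hnL
  have hR1 : R ≤ 182 * G * z := by
    refine abs_le_of_sq_le_sq' ?_ (by positivity) |>.2
    rw [hez] at hR
    nlinarith [mul_le_mul_of_nonneg_right hez' hz0.le, sq_nonneg G, mul_nonneg (sq_nonneg G) (sq_nonneg z)]
  have hR2 : R ^ 2 ≤ 32768 * G ^ 2 * z := by
    refine hR.trans ?_
    rw [hez]
    have : e * z ≤ z := mul_le_of_le_one_left hz0.le he1
    gcongr
  have hD' : D ≤ 140000 * G ^ 2 * z := by
    rw [hD]
    nlinarith [mul_le_mul_of_nonneg_left hR1 hG.le, mul_pos (pow_pos hG 2) hz0]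
  refine ⟨1 / (140000 * G ^ 2 * z), by positivity, ?_, ?_⟩
  · rw [one_div, inv_mul_le_one₀ (by positivity)]
    exact hD'
  -- The target deviation contributes `-5 * L` and the variance at most `L`, leaving `-4 * L`.
  · have e1 : 1 / (140000 * G ^ 2 * z) * (700000 * G ^ 2 * e * n) = 5 * L := by
      rw [hz]; field_simp; norm_num
    have e2 : (1 / (140000 * G ^ 2 * z)) ^ 2 * V * n ≤ L := by
      calc (1 / (140000 * G ^ 2 * z)) ^ 2 * V * n
          ≤ (1 / (140000 * G ^ 2 * z)) ^ 2 * (80640 * G ^ 4 * (n * e ^ 2 / L ^ 3)) * n := by gcongr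
        _ = 80640 / 140000 ^ 2 / L := by rw [hz]; field_simp
        _ ≤ 1 := by
          rw [div_le_one hL0]; refine le_trans ?_ hL; norm_num
        _ ≤ L := hL
    rw [e1]
    linarith

theorem abs_mul_sub_sq_le {G e r x₁ x₂ y : ℝ} (hG : 0 ≤ G) (he : 0 ≤ e) (he1 : e ≤ 1) (hr : 0 ≤ r)
    (h₁ : |x₁ - y| ≤ 2 * G * e * r) (h₂ : |x₂ - y| ≤ 2 * G * e * r) (h₃ : |y| ≤ G * r) :
    |x₁ * x₂ - y ^ 2| ≤ 8 * G ^ 2 * e * (r * r) := by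
  have e1 : x₁ * x₂ - y ^ 2 = (x₁ - y) * (x₂ - y) + (x₁ - y) * y + y * (x₂ - y) := by ring
  rw [e1]
  refine (abs_add_three _ _ _).trans ?_
  rw [abs_mul, abs_mul, abs_mul]
  have m1 := mul_le_mul h₁ h₂ (abs_nonneg _) (by positivity)
  have m2 := mul_le_mul h₁ h₃ (abs_nonneg _) (by positivity)
  have m3 := mul_le_mul h₃ h₂ (abs_nonneg _) (by positivity)
  have hee : e ^ 2 ≤ e := by nlinarith
  calc _ ≤ 2 * G * e * r * (2 * G * e * r) + 2 * G * e * r * (G * r) +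
        G * r * (2 * G * e * r) := by linarith
    _ = (4 * G ^ 2 * e ^ 2 + 4 * G ^ 2 * e) * (r * r) := by ring
    _ ≤ (4 * G ^ 2 * e + 4 * G ^ 2 * e) * (r * r) := by gcongr
    _ = _ := by ring

variable {Ω : Type*} [MeasurableSpace Ω] {μ : Measure Ω} [IsProbabilityMeasure μ] {d : ℕ}

/-- Statistics of the two windows for the zero-started approximations of the trajectory. -/
noncomputable def windowPair (A : Matrix (Fin d) (Fin d) ℝ) (N b : ℕ) (i : Fin d)
    (w : ℕ → EuclideanSpace ℝ (Fin d)) : (Fin d → ℝ) × (Fin d → ℝ) :=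
  ((lagVec b (Finset.Icc (N + 1) (2 * N)) (zeroState A w) i).ofLp,
    (lagVec b (Finset.Icc N (2 * N - 1)) (zeroState A fun r => w (2 * N + 1 + r)) i).ofLp)

theorem measurable_lagVec_zeroState (A : Matrix (Fin d) (Fin d) ℝ) (b : ℕ) (s : Finset ℕ)
    (i : Fin d) : Measurable fun w : ℕ → EuclideanSpace ℝ (Fin d) =>
      (lagVec b s (zeroState A w) i).ofLp := by
  have h2 : Continuous fun w : ℕ → EuclideanSpace ℝ (Fin d) => zeroState A w :=
    continuous_pi fun t => continuous_zeroState t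
  exact (Continuous.measurable (by fun_prop :
    Continuous fun x : EuclideanSpace ℝ (Fin d) => x.ofLp)).comp
      ((continuous_lagVec b s i).comp h2).measurable

theorem lagVec_zeroState_congr {A : Matrix (Fin d) (Fin d) ℝ} {b n : ℕ} {s : Finset ℕ}
    (hs : ∀ t ∈ s, t + b ≤ n) {i : Fin d} {w w' : ℕ → EuclideanSpace ℝ (Fin d)}
    (h : ∀ r < n, w r = w' r) :
    (lagVec b s (zeroState A w) i).ofLp = (lagVec b s (zeroState A w') i).ofLp := by
  rw [lagVec_congr fun t ht => ⟨zeroState_congr fun r hr => h r (by have := hs t ht; omega),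
    zeroState_congr fun r hr => h r (by have := hs t ht; omega)⟩]

set_option maxHeartbeats 1000000 in
-- `e` is the target accuracy and `σ` stands for mixing time over trajectory length, so each window
-- average has variance proxy `32 * G ^ 2 * σ`. Bernstein controls the fluctuation around the
-- truncated means; truncation bias and transient separate these from the stationary rows by a
-- multiple of `G * e`. In the balance `n * e ^ 2 = σ * d * L ^ 3`, two logarithms come from the
-- squared truncation radius and one from the Bernstein exponent.
theorem exists_windowPair_concentration {ι : Type*} [Fintype ι] {T N : ℕ} (hN : 1 ≤ N)
    (hT : 4 * N + 1 ≤ T) {A W : ι → Matrix (Fin d) (Fin d) ℝ} {κ ρ G : ℝ} (hG : 0 < G)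
    (h : ∀ m, StableSystem (A m) (W m) κ ρ G) {w : ι → ℕ → Ω → EuclideanSpace ℝ (Fin d)}
    (hw : ∀ m, IsGaussianNoise (w m) (W m) T μ)
    (hind : iIndepFun (fun p : (Σ _ : ι, Fin T) => w p.1 p.2) μ) {b : ℕ} (hb : b ≤ 1) (i : Fin d)
    {τ γ L e σ : ℝ} (hτ : ∀ n, ∑ k ∈ Finset.range n, min 1 (κ * ρ ^ k) ≤ τ)
    (hγ : ∀ t, N ≤ t → κ * ρ ^ t ≤ γ) (hL : 1 ≤ L) (hσ : 0 < σ) (hσ1 : σ ≤ 1)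
    (hτN : 2 * τ / N ≤ 32 * σ) (he : 0 < e) (he1 : e ≤ 1)
    (heσ : (Fintype.card ι : ℝ) * e ^ 2 = σ * d * L ^ 3) (hγe : γ ≤ e) (hLe : Real.exp (-L) ≤ e)
    (hL16 : Real.exp (-L) ≤ 1 / 16) (hdL : d * Real.exp (-L) ≤ 1) :
    ∃ B : Set Ω, μ B ≤ ENNReal.ofReal (6 * Fintype.card ι * d * Real.exp (-L) ^ 8 +
        2 * d * Real.exp (-L) ^ 4) ∧
      ∀ ω ∉ B, ∀ u : Fin d → ℝ,
        |∑ m, (((windowPair (A m) N b i fun r => w m r ω).1 ⬝ᵥ u) *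
          ((windowPair (A m) N b i fun r => w m r ω).2 ⬝ᵥ u) -
            ((A m ^ b * autocovZero (A m) (W m)).row i ⬝ᵥ u) ^ 2)| ≤
          Fintype.card ι * (700008 * G ^ 2 * e) * (u ⬝ᵥ u) := by
  set ξ := Real.exp (-L) with hξ
  have hξ0 : 0 < ξ := Real.exp_pos _
  have hξk : ∀ k : ℕ, ξ ^ k = Real.exp (-(k * L)) := fun k => by
    rw [hξ, ← Real.exp_nat_mul]; congr 1; ring
  set n : ℝ := (Fintype.card ι : ℝ) with hn
  have hn0 : 0 ≤ n := Nat.cast_nonneg _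
  have hd0 : (0 : ℝ) ≤ d := Nat.cast_nonneg _
  set v := 32 * G ^ 2 * σ with hv
  have hv0 : 0 < v := by positivity
  have hwin1 : ∀ t ∈ Finset.Icc (N + 1) (2 * N), t + b ≤ 2 * N + 1 := fun t ht => by
    have := Finset.mem_Icc.1 ht; omega
  have hwin2 : ∀ t ∈ Finset.Icc N (2 * N - 1), t + b ≤ T - (2 * N + 1) := fun t ht => by
    have := Finset.mem_Icc.1 ht; omega
  have hc1 : (Finset.Icc (N + 1) (2 * N)).card = N := by rw [Nat.card_Icc]; omega
  have hc2 : (Finset.Icc N (2 * N - 1)).card = N := by rw [Nat.card_Icc]; omega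
  have hvN : 2 * G ^ 2 * τ / N ≤ v := by
    calc 2 * G ^ 2 * τ / N = G ^ 2 * (2 * τ / N) := by ring
      _ ≤ G ^ 2 * (32 * σ) := by gcongr
      _ = v := by rw [hv]; ring
  -- Truncation at level `8 * L` makes all its tails multiples of `exp (-L) ^ 8`.
  have hs : (0 : ℝ) ≤ 8 * L := by linarith
  have hs8 : Real.exp (-(8 * L)) = ξ ^ 8 := by rw [hξk]; norm_num
  set β : ℝ := 15 * v * d * ξ ^ 8 with hβ
  have hβξ : β ≤ (G * ξ) ^ 2 := by
    have h1 : d * ξ ^ 8 ≤ ξ ^ 7 := by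
      have := mul_le_mul_of_nonneg_right hdL (by positivity : 0 ≤ ξ ^ 7)
      nlinarith
    have h2 : ξ ^ 5 ≤ (1 / 16) ^ 5 := pow_le_pow_left₀ hξ0.le hL16 5
    calc β = 480 * G ^ 2 * σ * (d * ξ ^ 8) := by rw [hβ, hv]; ring
      _ ≤ 480 * G ^ 2 * 1 * (ξ ^ 7) := by gcongr
      _ = G ^ 2 * ξ ^ 2 * (480 * ξ ^ 5) := by ring
      _ ≤ G ^ 2 * ξ ^ 2 * 1 := by gcongr; linarith
      _ = (G * ξ) ^ 2 := by ring
  have hbias : 15 * v * d * Real.exp (-(8 * L)) ≤ G ^ 2 := by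
    rw [hs8]
    refine hβξ.trans ?_
    refine pow_le_pow_left₀ (by positivity) (mul_le_of_le_one_right hG.le ?_) 2
    linarith
  set R : ℝ := 4 * Real.sqrt (d * v) * (8 * L) with hR
  have hR0 : 0 ≤ R := by positivity
  have hn_e : n * e ^ 2 / L = σ * d * L ^ 2 := by rw [heσ]; field_simp
  have hn_e3 : n * e ^ 2 / L ^ 3 = σ * d := by rw [heσ]; field_simp
  have hRsq : R ^ 2 ≤ 32768 * G ^ 2 * (n * e ^ 2 / L) := by
    rw [hR, mul_pow, mul_pow, Real.sq_sqrt (by positivity), hn_e, hv]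
    apply le_of_eq; ring
  have hWm := fun m => measurable_lagVec_zeroState (A m) b (Finset.Icc (N + 1) (2 * N)) i
  have hWm2 := fun m => measurable_lagVec_zeroState (A m) b (Finset.Icc N (2 * N - 1)) i
  have hshift : Measurable fun (y : ℕ → EuclideanSpace ℝ (Fin d)) r => y (2 * N + 1 + r) :=
    measurable_pi_lambda _ fun r => measurable_pi_apply _
  have hPm : ∀ m, Measurable (windowPair (A m) N b i) := fun m =>
    (hWm m).prodMk ((hWm2 m).comp hshift)
  have hwm : ∀ m, Measurable fun ω r => w m r ω := fun m =>
    measurable_pi_lambda _ fun r => (hw m).measurable r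
  obtain ⟨q, hq1, hq2, B₁, hB₁, hB₁u, hB₂⟩ := exists_sum_mul_concentration (μ := μ)
    (X := fun m ω => windowPair (A m) N b i fun r => w m r ω)
    (fun m => (hPm m).comp (hwm m))
    (iIndepFun_trajectories (T := fun _ => T) (fun m => (hw m).measurable) hind hPm
      fun m y y' hy => by
        unfold windowPair
        rw [lagVec_zeroState_congr hwin1 fun r hr => hy r (by omega),
          lagVec_zeroState_congr hwin2 fun r hr => hy (2 * N + 1 + r) (by omega)])
    -- With lag one the first window reads the state at time `2 * N + 1`, which involves only
    -- earlier noise; the second system restarts there, so the two statistics use disjoint noise.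
    (fun m => (hw m).indepFun_blocks (a := 2 * N + 1) (hWm m) (hWm2 m) (by omega)
      (fun y y' hy => lagVec_zeroState_congr hwin1 hy)
      (fun y y' hy => lagVec_zeroState_congr hwin2 hy))
    (c := fun m => (lagCov (A m) (W m) b (Finset.Icc (N + 1) (2 * N)) i,
      lagCov (A m) (W m) b (Finset.Icc N (2 * N - 1)) i)) hv0
    (fun m u hu => by
      have := (hw m).hasChaosMGF_lagVec (h m) hτ (s := Finset.Icc (N + 1) (2 * N)) (b := b)
        (fun t ht => (hwin1 t ht).trans (by omega)) i hu
      rw [hc1] at this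
      exact this.mono hvN)
    (fun m u hu => by
      have := ((hw m).shift (2 * N + 1)).hasChaosMGF_lagVec (h m) hτ hwin2 i hu
      rw [hc2] at this
      exact this.mono hvN)
    (fun m u => (hw m).integral_lagVec_sub (h m).posDef.posSemidef
      (fun t ht => (hwin1 t ht).trans (by omega)) i u)
    (fun m u => ((hw m).shift (2 * N + 1)).integral_lagVec_sub (h m).posDef.posSemidef hwin2 i u)
    hG.le (fun m => (h m).lagCov_dotProduct_self_le b _ i)
    (fun m => (h m).lagCov_dotProduct_self_le b _ i) hs hR hbias
  rw [hs8] at hB₁ hq1 hq2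
  have hB₁' : μ B₁ ≤ ENNReal.ofReal (6 * n * d * ξ ^ 8) := by
    refine hB₁.trans (le_of_eq ?_)
    rw [← ENNReal.ofReal_natCast, ← ENNReal.ofReal_ofNat 2, ← ENNReal.ofReal_mul (by norm_num),
      ← ENNReal.ofReal_mul (by positivity)]
    congr 1; ring
  have hmain : ∃ B₂ : Set Ω, μ B₂ ≤ ENNReal.ofReal (2 * d * ξ ^ 4) ∧
      ∀ ω, ω ∉ B₁ → ω ∉ B₂ → ∀ u : Fin d → ℝ,
        |∑ m, (((windowPair (A m) N b i fun r => w m r ω).1 ⬝ᵥ u) *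
          ((windowPair (A m) N b i fun r => w m r ω).2 ⬝ᵥ u) -
            ((q m).1 ⬝ᵥ u) * ((q m).2 ⬝ᵥ u))| ≤ 700000 * G ^ 2 * e * n * (u ⬝ᵥ u) := by
    -- With fewer than `L` trajectories the balance relation already gives `R ≤ 182 * G * e`, and
    -- the termwise bound off `B₁` is enough.
    rcases le_total L n with hLn | hLn
    · obtain ⟨θ, hθ, hθD, hθe⟩ := exists_bernstein_parameter hG he he1 hL hLn hRsq rfl
        -- `80640 = 480 * 168`, from `v = 32 * G ^ 2 * σ` and `σ ≤ 1`.
        (V := 15 * d * v * (5 * v + 8 * G ^ 2)) (by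
          rw [hn_e3, hv]
          have : σ * (σ * d) ≤ 1 * (σ * d) := by gcongr
          have hG4 : 0 ≤ G ^ 4 := by positivity
          nlinarith [mul_le_mul_of_nonneg_left this hG4])
      obtain ⟨B₂, hB, hBu⟩ := hB₂ θ _ hθ hθD
      refine ⟨B₂, hB.trans ?_, hBu⟩
      rw [← ENNReal.ofReal_ofNat 2, ← ENNReal.ofReal_mul (by norm_num), hξk, ← mul_assoc]
      refine ENNReal.ofReal_le_ofReal ?_
      gcongr
      exact_mod_cast hθe
    · refine ⟨∅, by simp, fun ω hω _ u => (hB₁u ω hω u).trans ?_⟩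
      have hu := dotProduct_self_nonneg' u
      refine mul_le_mul_of_nonneg_right ?_ hu
      have h1 : n * e ^ 2 / L ≤ e ^ 2 := by
        rw [div_le_iff₀ (by linarith)]
        nlinarith [sq_nonneg e]
      have h2 : R ^ 2 ≤ 32768 * G ^ 2 * e ^ 2 := hRsq.trans (by gcongr)
      have h3 : R ≤ 182 * G * e := by
        refine abs_le_of_sq_le_sq' ?_ (by positivity) |>.2
        nlinarith [mul_nonneg (sq_nonneg G) (sq_nonneg e)]
      have h4 : 8 * G * R + 4 * R ^ 2 ≤ 700000 * G ^ 2 * e := by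
        have : e ^ 2 ≤ e := by nlinarith
        nlinarith [mul_le_mul_of_nonneg_left h3 hG.le, mul_le_mul_of_nonneg_left this (sq_nonneg G),
          mul_nonneg (sq_nonneg G) he.le]
      calc n * (8 * G * R + 4 * R ^ 2) ≤ n * (700000 * G ^ 2 * e) := by gcongr
        _ = _ := by ring
  obtain ⟨B₂, hB₂, hB₂u⟩ := hmain
  refine ⟨B₁ ∪ B₂, (measure_union_le _ _).trans ?_, fun ω hω u => ?_⟩
  · rw [ENNReal.ofReal_add (by positivity) (by positivity)]
    exact add_le_add hB₁' hB₂
  · rw [Set.mem_union, not_or] at hω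
    have hu := dotProduct_self_nonneg' u
    have hsu := Real.sqrt_nonneg (u ⬝ᵥ u)
    have hbd : ∀ m, |((q m).1 ⬝ᵥ u) * ((q m).2 ⬝ᵥ u) -
        ((A m ^ b * autocovZero (A m) (W m)).row i ⬝ᵥ u) ^ 2| ≤ 8 * G ^ 2 * e * (u ⬝ᵥ u) := by
      intro m
      -- The truncation bias is at most `G * ξ` and the transient at most `G * γ`; each is at most
      -- `G * e`.
      have near : ∀ (s : Finset ℕ) (q' : Fin d → ℝ), s.Nonempty → (∀ t ∈ s, N ≤ t) →
          (((q' - lagCov (A m) (W m) b s i) ⬝ᵥ u) ^ 2 ≤ 15 * v * d * ξ ^ 8 * (u ⬝ᵥ u)) →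
          |q' ⬝ᵥ u - (A m ^ b * autocovZero (A m) (W m)).row i ⬝ᵥ u| ≤
            2 * G * e * Real.sqrt (u ⬝ᵥ u) := by
        intro s q' hsn hsN hq'
        have h1 := (h m).abs_row_dotProduct_sub_lagCov_le b hsn i (γ := γ)
          (fun t ht => hγ t (hsN t ht)) u
        have h2 : |q' ⬝ᵥ u - lagCov (A m) (W m) b s i ⬝ᵥ u| ≤ G * ξ * Real.sqrt (u ⬝ᵥ u) := by
          rw [← sub_dotProduct]
          refine abs_le_of_sq_le_sq ?_ (by positivity)
          rw [mul_pow, Real.sq_sqrt hu]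
          exact hq'.trans (mul_le_mul_of_nonneg_right hβξ hu)
        rw [abs_sub_comm] at h1
        refine (abs_sub_le _ (lagCov (A m) (W m) b s i ⬝ᵥ u) _).trans ((add_le_add h2 h1).trans ?_)
        have : G * ξ * √(u ⬝ᵥ u) ≤ G * e * √(u ⬝ᵥ u) := by gcongr
        have : G * γ * √(u ⬝ᵥ u) ≤ G * e * √(u ⬝ᵥ u) := by gcongr
        linarith
      have k1 := near _ (q m).1 ⟨N + 1, Finset.mem_Icc.2 (by omega)⟩
        (fun t ht => by have := Finset.mem_Icc.1 ht; omega) (hq1 m u)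
      have k2 := near _ (q m).2 ⟨N, Finset.mem_Icc.2 (by omega)⟩
        (fun t ht => (Finset.mem_Icc.1 ht).1) (hq2 m u)
      have k3 : |(A m ^ b * autocovZero (A m) (W m)).row i ⬝ᵥ u| ≤ G * Real.sqrt (u ⬝ᵥ u) := by
        refine abs_le_of_sq_le_sq ?_ (by positivity)
        rw [row_dotProduct, mul_pow, Real.sq_sqrt hu]
        simpa using (h m).sq_dotProduct_pow_autocovZero_le b (Pi.single i 1) u
      have hss : √(u ⬝ᵥ u) * √(u ⬝ᵥ u) = u ⬝ᵥ u := Real.mul_self_sqrt hu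
      rw [← hss, ← mul_assoc]
      exact (abs_mul_sub_sq_le hG.le he.le he1 hsu k1 k2 k3).trans (le_of_eq (by ring))
    have h1 := hB₂u ω hω.1 hω.2 u
    have h2 : |∑ m, (((q m).1 ⬝ᵥ u) * ((q m).2 ⬝ᵥ u) -
        ((A m ^ b * autocovZero (A m) (W m)).row i ⬝ᵥ u) ^ 2)| ≤ n * (8 * G ^ 2 * e * (u ⬝ᵥ u)) := by
      refine (Finset.abs_sum_le_sum_abs _ _).trans
        ((Finset.sum_le_card_nsmul _ _ _ fun m _ => hbd m).trans (le_of_eq ?_))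
      rw [Finset.card_univ, nsmul_eq_mul]
    have h3 := (abs_add_le _ _).trans (add_le_add h1 h2)
    rw [← Finset.sum_add_distrib] at h3
    simp only [sub_add_sub_cancel] at h3
    exact h3.trans (le_of_eq (by ring))

end WindowConcentration

end MixedLDS

namespace MixedLDS

/-! ### Comparison of true trajectories with their zero-started approximations. -/

section Remainder

variable {d : ℕ}

theorem norm_sq_eq_dotProduct (x : EuclideanSpace ℝ (Fin d)) : ‖x‖ ^ 2 = x.ofLp ⬝ᵥ x.ofLp :=
  norm_toLp_sq x.ofLp

theorem abs_ofLp_dotProduct_le (x : EuclideanSpace ℝ (Fin d)) (u : Fin d → ℝ) :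
    |x.ofLp ⬝ᵥ u| ≤ ‖x‖ * Real.sqrt (u ⬝ᵥ u) := by
  refine abs_le_of_sq_le_sq ?_ (by positivity)
  rw [mul_pow, norm_sq_eq_dotProduct, Real.sq_sqrt (dotProduct_self_nonneg' u)]
  exact sq_dotProduct_le _ _

theorem abs_apply_mul_dotProduct_le (x y : EuclideanSpace ℝ (Fin d)) (i : Fin d) (u : Fin d → ℝ) :
    |x i * (y.ofLp ⬝ᵥ u)| ≤ ‖x‖ * ‖y‖ * Real.sqrt (u ⬝ᵥ u) := by
  rw [abs_mul, mul_assoc]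
  exact mul_le_mul (PiLp.norm_apply_le x i) (abs_ofLp_dotProduct_le y u) (abs_nonneg _)
    (norm_nonneg _)

theorem abs_lagVec_dotProduct_le {b : ℕ} {s : Finset ℕ} {y : ℕ → EuclideanSpace ℝ (Fin d)} {B : ℝ}
    (hB : 0 ≤ B) (hy : ∀ t ∈ s, ‖y (t + b)‖ ≤ B ∧ ‖y t‖ ≤ B) (i : Fin d) (u : Fin d → ℝ) :
    |(lagVec b s y i).ofLp ⬝ᵥ u| ≤ B ^ 2 * Real.sqrt (u ⬝ᵥ u) := by
  rw [lagVec_dotProduct]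
  refine abs_inv_card_mul_sum_le (by positivity) fun t ht =>
    (abs_apply_mul_dotProduct_le _ _ i u).trans ?_
  rw [pow_two]
  have := hy t ht
  gcongr
  exacts [this.1, this.2]

theorem abs_lagVec_dotProduct_sub_le {b : ℕ} {s : Finset ℕ} {x y : ℕ → EuclideanSpace ℝ (Fin d)}
    {B r : ℝ} (hB : 0 ≤ B) (hr : 0 ≤ r) (hy : ∀ t ∈ s, ‖y (t + b)‖ ≤ B ∧ ‖y t‖ ≤ B)
    (hxy : ∀ t ∈ s, ‖x (t + b) - y (t + b)‖ ≤ r ∧ ‖x t - y t‖ ≤ r) (i : Fin d) (u : Fin d → ℝ) :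
    |(lagVec b s x i).ofLp ⬝ᵥ u - (lagVec b s y i).ofLp ⬝ᵥ u| ≤
      (2 * r * B + r ^ 2) * Real.sqrt (u ⬝ᵥ u) := by
  rw [lagVec_dotProduct, lagVec_dotProduct, ← mul_sub, ← Finset.sum_sub_distrib]
  refine abs_inv_card_mul_sum_le (by positivity) fun t ht => ?_
  obtain ⟨h1, h2⟩ := hy t ht
  obtain ⟨h3, h4⟩ := hxy t ht
  have e : x (t + b) i * ((x t).ofLp ⬝ᵥ u) - y (t + b) i * ((y t).ofLp ⬝ᵥ u) =
      (x (t + b) - y (t + b)) i * ((x t - y t).ofLp ⬝ᵥ u) +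
        (x (t + b) - y (t + b)) i * ((y t).ofLp ⬝ᵥ u) +
          y (t + b) i * ((x t - y t).ofLp ⬝ᵥ u) := by
    simp only [PiLp.sub_apply, WithLp.ofLp_sub, sub_dotProduct]
    ring
  rw [e]
  refine (abs_add_three _ _ _).trans ?_
  have hs := Real.sqrt_nonneg (u ⬝ᵥ u)
  have k1 := abs_apply_mul_dotProduct_le (x (t + b) - y (t + b)) (x t - y t) i u
  have k2 := abs_apply_mul_dotProduct_le (x (t + b) - y (t + b)) (y t) i u
  have k3 := abs_apply_mul_dotProduct_le (y (t + b)) (x t - y t) i u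
  have j1 : ‖x (t + b) - y (t + b)‖ * ‖x t - y t‖ * √(u ⬝ᵥ u) ≤ r * r * √(u ⬝ᵥ u) := by gcongr
  have j2 : ‖x (t + b) - y (t + b)‖ * ‖y t‖ * √(u ⬝ᵥ u) ≤ r * B * √(u ⬝ᵥ u) := by gcongr
  have j3 : ‖y (t + b)‖ * ‖x t - y t‖ * √(u ⬝ᵥ u) ≤ B * r * √(u ⬝ᵥ u) := by gcongr
  linarith

variable {A W : Matrix (Fin d) (Fin d) ℝ} {κ ρ G : ℝ}

theorem StableSystem.norm_pow_apply_le (h : StableSystem A W κ ρ G) (t : ℕ)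
    (y : EuclideanSpace ℝ (Fin d)) :
    ‖toEuclideanCLM (n := Fin d) (𝕜 := ℝ) (A ^ t) y‖ ≤ κ * ρ ^ t * ‖y‖ := by
  have := h.rho_nonneg
  have := h.one_le_kappa
  refine abs_le_of_sq_le_sq' ?_ (by positivity) |>.2
  rw [mul_pow, norm_sq_eq_dotProduct, norm_sq_eq_dotProduct, ofLp_toEuclideanCLM]
  exact h.pow_mulVec_le t y.ofLp

theorem eq_pow_apply_add_zeroState {x w : ℕ → EuclideanSpace ℝ (Fin d)} {T : ℕ}
    (hx : ∀ t < T, x (t + 1) = toEuclideanCLM (n := Fin d) (𝕜 := ℝ) A (x t) + w t) (a : ℕ) {t : ℕ}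
    (ht : a + t ≤ T) : x (a + t) = toEuclideanCLM (n := Fin d) (𝕜 := ℝ) (A ^ t) (x a) +
      zeroState A (fun r => w (a + r)) t := by
  induction t with
  | zero => simp [zeroState_zero]
  | succ t ih =>
    rw [← add_assoc, hx _ (by omega), ih (by omega), zeroState_succ, map_add, pow_succ', map_mul,
      ← add_assoc]
    rfl

/-- A trajectory differs from the system restarted at `a` by `A ^ t` applied to the state at `a`,
hence by a factor `γ` after `N` steps. The restart states at `0` and `2 * N + 1` have norm at most
`B` and `2 * B`. -/
theorem StableSystem.abs_windows_sub_windowPair_le (h : StableSystem A W κ ρ G)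
    {x w : ℕ → EuclideanSpace ℝ (Fin d)} {T N : ℕ} (hN : 1 ≤ N) (hT : 4 * N + 1 ≤ T)
    (hx : ∀ t < T, x (t + 1) = toEuclideanCLM (n := Fin d) (𝕜 := ℝ) A (x t) + w t) {γ B : ℝ}
    (hγ1 : γ ≤ 1) (hγ : ∀ t, N ≤ t → κ * ρ ^ t ≤ γ) (hx0 : ‖x 0‖ ≤ B)
    (h₁ : ∀ t ≤ 2 * N + 1, ‖zeroState A w t‖ ≤ B)
    (h₂ : ∀ t ≤ 2 * N, ‖zeroState A (fun r => w (2 * N + 1 + r)) t‖ ≤ B) {b : ℕ} (hb : b ≤ 1)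
    (i : Fin d) (u : Fin d → ℝ) :
    |((lagVec b (Finset.Icc (N + 1) (2 * N)) x i).ofLp ⬝ᵥ u) *
        ((lagVec b (Finset.Icc (3 * N + 1) (4 * N)) x i).ofLp ⬝ᵥ u) -
      ((windowPair A N b i w).1 ⬝ᵥ u) * ((windowPair A N b i w).2 ⬝ᵥ u)| ≤
        80 * γ * B ^ 4 * (u ⬝ᵥ u) := by
  have hρ := h.rho_nonneg
  have hκ := h.one_le_kappa
  have hB : 0 ≤ B := (norm_nonneg _).trans hx0
  have hγ0 : 0 ≤ γ := le_trans (by positivity) (hγ N le_rfl)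
  -- Counted from the restart at `2 * N + 1`, the second window begins at `N`: late enough for the
  -- memory to have faded.
  have hmap : Finset.Icc (3 * N + 1) (4 * N) =
      (Finset.Icc N (2 * N - 1)).map (addLeftEmbedding (2 * N + 1)) := by
    rw [Finset.map_add_left_Icc]
    congr 1 <;> omega
  have hmid : ‖x (2 * N + 1)‖ ≤ 2 * B := by
    have e := eq_pow_apply_add_zeroState hx 0 (t := 2 * N + 1) (by omega)
    simp only [zero_add] at e
    rw [e]
    refine (norm_add_le _ _).trans ?_
    have h3 := (h.norm_pow_apply_le (2 * N + 1) (x 0)).trans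
      (mul_le_mul ((hγ (2 * N + 1) (by omega)).trans hγ1) hx0 (norm_nonneg _) zero_le_one)
    have h4 := h₁ _ le_rfl
    linarith
  have near : ∀ a t, a + t ≤ T → N ≤ t → ‖x a‖ ≤ 2 * B →
      ‖x (a + t) - zeroState A (fun r => w (a + r)) t‖ ≤ 2 * γ * B := by
    intro a t hat ht ha
    rw [eq_pow_apply_add_zeroState hx a hat, add_sub_cancel_right]
    refine (h.norm_pow_apply_le t (x a)).trans
      ((mul_le_mul (hγ t ht) ha (norm_nonneg _) hγ0).trans (le_of_eq (by ring)))
  have hr : 0 ≤ 2 * γ * B := by positivity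
  have d1 := abs_lagVec_dotProduct_sub_le (b := b) (s := Finset.Icc (N + 1) (2 * N)) (x := x)
    (y := zeroState A w) hB hr
    (fun t ht => by have := Finset.mem_Icc.1 ht; exact ⟨h₁ _ (by omega), h₁ _ (by omega)⟩)
    (fun t ht => by
      have := Finset.mem_Icc.1 ht
      have n1 := near 0 (t + b) (by omega) (by omega) (by linarith)
      have n2 := near 0 t (by omega) (by omega) (by linarith)
      simp only [zero_add] at n1 n2
      exact ⟨n1, n2⟩) i u
  have d2 := abs_lagVec_dotProduct_sub_le (b := b) (s := Finset.Icc N (2 * N - 1))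
    (x := fun t => x (2 * N + 1 + t)) (y := zeroState A fun r => w (2 * N + 1 + r)) hB hr
    (fun t ht => by have := Finset.mem_Icc.1 ht; exact ⟨h₂ _ (by omega), h₂ _ (by omega)⟩)
    (fun t ht => by
      have := Finset.mem_Icc.1 ht
      exact ⟨near (2 * N + 1) (t + b) (by omega) (by omega) hmid,
        near (2 * N + 1) t (by omega) (by omega) hmid⟩) i u
  have b1 := abs_lagVec_dotProduct_le (b := b) (s := Finset.Icc (N + 1) (2 * N))
    (y := zeroState A w) hB
    (fun t ht => by have := Finset.mem_Icc.1 ht; exact ⟨h₁ _ (by omega), h₁ _ (by omega)⟩) i u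
  have b2 := abs_lagVec_dotProduct_le (b := b) (s := Finset.Icc N (2 * N - 1))
    (y := zeroState A fun r => w (2 * N + 1 + r)) hB
    (fun t ht => by have := Finset.mem_Icc.1 ht; exact ⟨h₂ _ (by omega), h₂ _ (by omega)⟩) i u
  rw [hmap, lagVec_map_add]
  simp only [windowPair]
  have hss : √(u ⬝ᵥ u) * √(u ⬝ᵥ u) = u ⬝ᵥ u := Real.mul_self_sqrt (dotProduct_self_nonneg' u)
  have hsu := Real.sqrt_nonneg (u ⬝ᵥ u)
  rw [← hss]
  generalize √(u ⬝ᵥ u) = q at *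
  generalize (lagVec b (Finset.Icc (N + 1) (2 * N)) x i).ofLp ⬝ᵥ u = p₁ at *
  generalize (lagVec b (Finset.Icc N (2 * N - 1)) (fun t => x (2 * N + 1 + t)) i).ofLp ⬝ᵥ u = p₂ at *
  generalize (lagVec b (Finset.Icc (N + 1) (2 * N)) (zeroState A w) i).ofLp ⬝ᵥ u = q₁ at *
  generalize (lagVec b (Finset.Icc N (2 * N - 1))
    (zeroState A fun r => w (2 * N + 1 + r)) i).ofLp ⬝ᵥ u = q₂ at *
  have hγ2 : γ ^ 2 ≤ γ := by nlinarith
  have hD : (2 * (2 * γ * B) * B + (2 * γ * B) ^ 2) * q ≤ 8 * γ * B ^ 2 * q := by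
    refine mul_le_mul_of_nonneg_right ?_ hsu
    nlinarith [mul_le_mul_of_nonneg_right hγ2 (sq_nonneg B)]
  have e1 : p₁ * p₂ - q₁ * q₂ = (p₁ - q₁) * (p₂ - q₂) + (p₁ - q₁) * q₂ + q₁ * (p₂ - q₂) := by ring
  rw [e1]
  refine (abs_add_three _ _ _).trans ?_
  rw [abs_mul, abs_mul, abs_mul]
  have m1 := mul_le_mul (d1.trans hD) (d2.trans hD) (abs_nonneg _) (by positivity)
  have m2 := mul_le_mul (d1.trans hD) b2 (abs_nonneg _) (by positivity)
  have m3 := mul_le_mul b1 (d2.trans hD) (abs_nonneg _) (by positivity)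
  calc _ ≤ 8 * γ * B ^ 2 * q * (8 * γ * B ^ 2 * q) + 8 * γ * B ^ 2 * q * (B ^ 2 * q) +
        B ^ 2 * q * (8 * γ * B ^ 2 * q) := by linarith
    _ = (64 * γ ^ 2 + 16 * γ) * (B ^ 4 * (q * q)) := by ring
    _ ≤ (64 * γ + 16 * γ) * (B ^ 4 * (q * q)) := by gcongr
    _ = _ := by ring

end Remainder

/-! ### Second moments of states and of initial states. -/

section Moments

/-- Markov's inequality through a measurable majorant `g`, because `f` itself may fail to be
measurable and the majorization holds only on `s`. -/
theorem measure_lt_norm_le {Ω : Type*} [MeasurableSpace Ω] {μ : Measure Ω} {d : ℕ}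
    {f : Ω → EuclideanSpace ℝ (Fin d)} {g : Ω → ENNReal}
    (hg : Measurable g) {s : Set Ω} (hfg : ∀ ω ∈ s, ENNReal.ofReal (‖f ω‖ ^ 2) ≤ g ω) {V B : ℝ}
    (hB : 0 < B) (hV : ∫⁻ ω, g ω ∂μ ≤ ENNReal.ofReal V) :
    μ {ω | ω ∈ s ∧ B < ‖f ω‖} ≤ ENNReal.ofReal (V / B ^ 2) := by
  have hsub : {ω | ω ∈ s ∧ B < ‖f ω‖} ⊆ {ω | ENNReal.ofReal (B ^ 2) ≤ g ω} := fun ω hω =>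
    (ENNReal.ofReal_le_ofReal (pow_le_pow_left₀ hB.le hω.2.le 2)).trans (hfg ω hω.1)
  have hB2 : 0 < B ^ 2 := by positivity
  refine (measure_mono hsub).trans ((meas_ge_le_lintegral_div hg.aemeasurable
    (by simpa using hB.ne') ENNReal.ofReal_ne_top).trans ?_)
  rw [ENNReal.ofReal_div_of_pos hB2]
  gcongr

variable {Ω : Type*} [MeasurableSpace Ω] {μ : Measure Ω} [IsProbabilityMeasure μ] {d : ℕ}
  {A W : Matrix (Fin d) (Fin d) ℝ} {κ ρ G : ℝ}

theorem measurable_zeroState {w : ℕ → Ω → EuclideanSpace ℝ (Fin d)} (hw : ∀ r, Measurable (w r))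
    (t : ℕ) : Measurable fun ω => zeroState A (fun r => w r ω) t :=
  (continuous_zeroState t).measurable.comp (measurable_pi_lambda _ hw)

/-- Each coordinate has variance at most `G`, the finite-time covariance being dominated by the
stationary one. -/
theorem IsGaussianNoise.lintegral_norm_sq_zeroState_le {w : ℕ → Ω → EuclideanSpace ℝ (Fin d)}
    {n : ℕ} (hw : IsGaussianNoise w W n μ) (h : StableSystem A W κ ρ G) {t : ℕ} (ht : t ≤ n) :
    ∫⁻ ω, ENNReal.ofReal (‖zeroState A (fun r => w r ω) t‖ ^ 2) ∂μ ≤ ENNReal.ofReal (d * G) := by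
  have e : ∀ ω, ‖zeroState A (fun r => w r ω) t‖ ^ 2 =
      ∑ i : Fin d, (Pi.single i 1 ⬝ᵥ (zeroState A (fun r => w r ω) t).ofLp) *
        (Pi.single i 1 ⬝ᵥ (zeroState A (fun r => w r ω) t).ofLp) := fun ω => by
    simp only [norm_sq_eq_dotProduct, single_one_dotProduct]
    rfl
  have hint : ∀ i : Fin d, Integrable (fun ω =>
      (Pi.single i 1 ⬝ᵥ (zeroState A (fun r => w r ω) t).ofLp) *
        (Pi.single i 1 ⬝ᵥ (zeroState A (fun r => w r ω) t).ofLp)) μ := fun i =>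
    (hw.memLp_dotProduct_zeroState _ ht).integrable_mul (hw.memLp_dotProduct_zeroState _ ht)
  simp_rw [e]
  rw [← ofReal_integral_eq_lintegral_ofReal (integrable_finsetSum _ fun i _ => hint i)
    (Filter.Eventually.of_forall fun ω => Finset.sum_nonneg fun i _ => mul_self_nonneg _),
    integral_finsetSum _ fun i _ => hint i]
  refine ENNReal.ofReal_le_ofReal ?_
  have hterm : ∀ i : Fin d, ∫ ω, (Pi.single i 1 ⬝ᵥ (zeroState A (fun r => w r ω) t).ofLp) *
      (Pi.single i 1 ⬝ᵥ (zeroState A (fun r => w r ω) t).ofLp) ∂μ ≤ G := fun i => by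
    have h1 := hw.integral_zeroState_mul (A := A) h.posDef.posSemidef (Pi.single i 1)
      (Pi.single i 1) (s := t) (k := 0) (by omega)
    rw [add_zero] at h1
    rw [h1, pow_zero, Matrix.one_mul]
    refine ((h.dotProduct_finAutocov_le t _).trans (h.dotProduct_autocovZero_le _)).trans
      (le_of_eq ?_)
    simp
  refine (Finset.sum_le_card_nsmul _ _ _ fun i _ => hterm i).trans (le_of_eq ?_)
  simp

theorem IsGaussianNoise.measure_lt_norm_zeroState_le {w : ℕ → Ω → EuclideanSpace ℝ (Fin d)}
    {n : ℕ} (hw : IsGaussianNoise w W n μ) (h : StableSystem A W κ ρ G) {t : ℕ} (ht : t ≤ n) {B : ℝ}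
    (hB : 0 < B) : μ {ω | B < ‖zeroState A (fun r => w r ω) t‖} ≤
      ENNReal.ofReal (d * G / B ^ 2) := by
  have := measure_lt_norm_le (s := Set.univ) (f := fun ω => zeroState A (fun r => w r ω) t)
    ((measurable_zeroState hw.measurable t).norm.pow_const 2).ennreal_ofReal
    (fun ω _ => le_rfl) hB (hw.lintegral_norm_sq_zeroState_le h ht)
  simpa using this

/-- Second moments of the initial states of consecutive segments of one trajectory. -/
theorem exists_bound_initial_state {M : ℕ} {A W : Fin M → Matrix (Fin d) (Fin d) ℝ}
    (h : ∀ m, StableSystem (A m) (W m) κ ρ G) {T : Fin M → ℕ}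
    {x w : Fin M → ℕ → Ω → EuclideanSpace ℝ (Fin d)}
    (hw : ∀ m, IsGaussianNoise (w m) (W m) (T m) μ) {s : Set Ω}
    (hx : ∀ ω ∈ s, ∀ m, ∀ t < T m, x m (t + 1) ω =
      toEuclideanCLM (n := Fin d) (𝕜 := ℝ) (A m) (x m t ω) + w m t ω)
    (hstart : ContinuousStart T x) {p : Fin M} (hT : ∀ m < p, κ * ρ ^ T m ≤ 1 / 2) :
    ∃ g : Ω → ENNReal, Measurable g ∧ (∀ ω ∈ s, ENNReal.ofReal (‖x p 0 ω‖ ^ 2) ≤ g ω) ∧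
      ∫⁻ ω, g ω ∂μ ≤ ENNReal.ofReal (4 * (d * G)) := by
  obtain ⟨j, hj⟩ := p
  induction j with
  | zero =>
    refine ⟨0, measurable_const, fun ω _ => ?_, by simp⟩
    rw [hstart.1 ⟨0, hj⟩ rfl ω]
    simp
  | succ j ih =>
    have hj' : j < M := by omega
    obtain ⟨g, hg, hgx, hgi⟩ := ih hj' fun m hm => hT m (hm.trans (by simp [Fin.lt_def]))
    set m : Fin M := ⟨j, hj'⟩ with hm
    have hG := (h m).G_nonneg
    set f : Ω → ENNReal := fun ω => ENNReal.ofReal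
      (‖zeroState (A m) (fun r => w m r ω) (T m)‖ ^ 2) with hf
    have hfm : Measurable f :=
      ((measurable_zeroState (hw m).measurable _).norm.pow_const 2).ennreal_ofReal
    have hfi : ∫⁻ ω, f ω ∂μ ≤ ENNReal.ofReal (d * G) :=
      (hw m).lintegral_norm_sq_zeroState_le (h m) le_rfl
    -- Contraction by one half gives the recursion `v ↦ v / 2 + 2 * d * G`, whose fixed point is `4
    -- * d * G`.
    refine ⟨fun ω => ENNReal.ofReal (1 / 2) * g ω + ENNReal.ofReal 2 * f ω,
      (hg.const_mul _).add (hfm.const_mul _), fun ω hω => ?_, ?_⟩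
    · rw [hstart.2 m ⟨j + 1, hj⟩ rfl ω]
      have e := eq_pow_apply_add_zeroState (A := A m) (x := fun t => x m t ω)
        (w := fun t => w m t ω) (hx ω hω m) 0 (t := T m) (by omega)
      simp only [zero_add] at e
      have h1 := ((h m).norm_pow_apply_le (T m) (x m 0 ω)).trans
        (mul_le_mul_of_nonneg_right (hT m (by simp [hm, Fin.lt_def])) (norm_nonneg _))
      have h2 : ‖x m (T m) ω‖ ^ 2 ≤ 1 / 2 * ‖x m 0 ω‖ ^ 2 +
          2 * ‖zeroState (A m) (fun r => w m r ω) (T m)‖ ^ 2 := by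
        rw [e]
        have h3 := norm_add_le (toEuclideanCLM (n := Fin d) (𝕜 := ℝ) (A m ^ T m) (x m 0 ω))
          (zeroState (A m) (fun r => w m r ω) (T m))
        have h4 := h3.trans (add_le_add_left h1 _)
        have h5 := pow_le_pow_left₀ (norm_nonneg _) h4 2
        refine h5.trans ?_
        nlinarith [sq_nonneg (1 / 2 * ‖x m 0 ω‖ - ‖zeroState (A m) (fun r => w m r ω) (T m)‖)]
      refine (ENNReal.ofReal_le_ofReal h2).trans ?_
      rw [ENNReal.ofReal_add (by positivity) (by positivity),
        ENNReal.ofReal_mul (by norm_num : (0 : ℝ) ≤ 1 / 2),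
        ENNReal.ofReal_mul (by norm_num : (0 : ℝ) ≤ 2)]
      exact add_le_add (mul_le_mul' le_rfl (hgx ω hω)) le_rfl
    · rw [lintegral_add_left (hg.const_mul _), lintegral_const_mul _ hg, lintegral_const_mul _ hfm]
      calc _ ≤ ENNReal.ofReal (1 / 2) * ENNReal.ofReal (4 * (d * G)) +
            ENNReal.ofReal 2 * ENNReal.ofReal (d * G) := by gcongr
        _ = ENNReal.ofReal (4 * (d * G)) := by
          rw [← ENNReal.ofReal_mul (by norm_num), ← ENNReal.ofReal_mul (by norm_num),
            ← ENNReal.ofReal_add (by positivity) (by positivity)]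
          congr 1; ring

end Moments

end MixedLDS

namespace MixedLDS

/-! ### Numerical consequences of the mixing condition. -/

section Parameters

theorem mul_pow_le_mul_exp {κ ρ : ℝ} (hκ : 0 ≤ κ) (hρ : 0 ≤ ρ) {t : ℕ} {c : ℝ}
    (hc : c ≤ (1 - ρ) * t) : κ * ρ ^ t ≤ κ * Real.exp (-c) := by
  refine mul_le_mul_of_nonneg_left ?_ hκ
  have h1 : ρ ≤ Real.exp (-(1 - ρ)) := by
    have := Real.add_one_le_exp (-(1 - ρ)); linarith
  calc ρ ^ t ≤ Real.exp (-(1 - ρ)) ^ t := pow_le_pow_left₀ hρ h1 t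
    _ = Real.exp (-((1 - ρ) * t)) := by rw [← Real.exp_nat_mul]; congr 1; ring
    _ ≤ Real.exp (-c) := Real.exp_le_exp.2 (by linarith)

/-- This is the use of the length condition on segments outside the group: crossing one halves the
influence of its initial state. -/
theorem mul_pow_le_half {κ ρ : ℝ} (hκ : 1 ≤ κ) (hρ : 0 ≤ ρ) (hρ1 : ρ < 1) {t : ℕ}
    (ht : 1 / (1 - ρ) * Real.log (2 * κ) ≤ t) : κ * ρ ^ t ≤ 1 / 2 := by
  have h1 : 0 < 1 - ρ := by linarith
  have hκ0 : 0 < κ := by linarith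
  have hc : Real.log (2 * κ) ≤ (1 - ρ) * t := by
    rw [one_div, inv_mul_le_iff₀ h1] at ht
    exact ht
  refine (mul_pow_le_mul_exp hκ0.le hρ hc).trans (le_of_eq ?_)
  rw [Real.exp_neg, Real.exp_log (by positivity)]
  field_simp

variable {d : ℕ} {A W : Matrix (Fin d) (Fin d) ℝ} {κ ρ G δ : ℝ}

theorem mixingTime_eq (hd : 1 ≤ d) (hκ : 1 ≤ κ) (hδ : 0 < δ) {Ttot : ℝ} (hT : 0 < Ttot) :
    mixingTime d κ ρ Ttot δ = 1 / (1 - ρ) * (Real.log κ + Real.log (Ttot * d / δ)) := by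
  have hd0 : (0 : ℝ) < d := by exact_mod_cast hd
  rw [mixingTime, ← Real.log_mul (by positivity) (by positivity)]
  congr 2
  ring

theorem exp_neg_log_eq (hd : 1 ≤ d) (hδ : 0 < δ) {Ttot : ℝ} (hT : 0 < Ttot) :
    Real.exp (-Real.log (Ttot * d / δ)) = δ / (Ttot * d) := by
  have hd0 : (0 : ℝ) < d := by exact_mod_cast hd
  rw [Real.exp_neg, Real.exp_log (by positivity), inv_div]

/-- The mixing time is `(log κ + L) / (1 - ρ)` with `L` the logarithm of the theorem, and the window
is at least an eighth of the trajectory. Hence `(1 - ρ) * N ≥ 8 * (log κ + L)`: the first part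
absorbs `κ`, the second leaves `exp (-L) ^ 8`. -/
theorem StableSystem.window_parameters (h : StableSystem A W κ ρ G) (hd : 2 ≤ d) (hδ : 0 < δ)
    (hδ1 : δ < 1) {T : ℕ} {Ttot : ℝ} (hT : 1 ≤ T) (hTtot : (T : ℝ) ≤ Ttot)
    (hmix : 64 * mixingTime d κ ρ Ttot δ ≤ T) :
    8 ≤ T ∧ 1 ≤ Real.log (Ttot * d / δ) ∧ Real.exp (-Real.log (Ttot * d / δ)) ≤ 1 / 16 ∧
      1 ≤ mixingTime d κ ρ Ttot δ ∧
      (∀ t, windowLength T ≤ t → κ * ρ ^ t ≤ Real.exp (-Real.log (Ttot * d / δ)) ^ 8) ∧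
      ∃ τ : ℝ, (∀ n, ∑ k ∈ Finset.range n, min 1 (κ * ρ ^ k) ≤ τ) ∧
        2 * τ / windowLength T ≤ 32 * (mixingTime d κ ρ Ttot δ / T) := by
  have hκ := h.one_le_kappa
  have hρ := h.rho_nonneg
  have hρ1 : 0 < 1 - ρ := by linarith [h.rho_lt_one]
  have hκ0 : 0 < κ := by linarith
  have hd0 : (2 : ℝ) ≤ d := by exact_mod_cast hd
  have hT1 : (1 : ℝ) ≤ T := by exact_mod_cast hT
  have hTt : 0 < Ttot := by linarith
  have hr1 : 1 ≤ 1 / (1 - ρ) := (one_le_div hρ1).2 (by linarith)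
  have hlκ : 0 ≤ Real.log κ := Real.log_nonneg hκ
  rw [mixingTime_eq (by omega) hκ hδ hTt] at hmix ⊢
  set L := Real.log (Ttot * d / δ) with hL
  have hexp : Real.exp (-L) = δ / (Ttot * d) := exp_neg_log_eq (by omega) hδ hTt
  -- Because `d ≥ 2`, the logarithm is at least `log 2`. This first yields `T ≥ 8`, then `exp (-L) ≤
  -- 1 / 16`, and finally `L ≥ 1`.
  have hL0 : Real.log 2 ≤ L := by
    refine Real.log_le_log (by norm_num) ?_
    rw [le_div_iff₀ hδ]
    nlinarith
  have hlog2 := Real.log_two_gt_d9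
  have hmixL : Real.log κ + L ≤ 1 / (1 - ρ) * (Real.log κ + L) :=
    le_mul_of_one_le_left (by linarith) hr1
  have hT8 : (8 : ℝ) ≤ T := by linarith
  have hξ16 : Real.exp (-L) ≤ 1 / 16 := by
    rw [hexp, div_le_div_iff₀ (by positivity) (by norm_num)]
    nlinarith
  have hL1 : 1 ≤ L := by
    have h1 : Real.exp (-L) ≤ Real.exp (-1) := by
      refine hξ16.trans ?_
      have := Real.exp_neg_one_gt_d9
      linarith
    linarith [Real.exp_le_exp.1 h1]
  have hT8' : 8 ≤ T := by exact_mod_cast hT8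
  have hN8 : T ≤ 8 * windowLength T := by unfold windowLength; omega
  have hN8' : (T : ℝ) ≤ 8 * windowLength T := by exact_mod_cast hN8
  have hN0 : (0 : ℝ) < windowLength T := by linarith
  refine ⟨hT8', hL1, hξ16, by linarith, fun t ht => ?_, ?_⟩
  · have ht' : (windowLength T : ℝ) ≤ t := by exact_mod_cast ht
    have h1 : 8 * (Real.log κ + L) ≤ (1 - ρ) * t := by
      have h2 : 8 * (1 / (1 - ρ) * (Real.log κ + L)) ≤ t := by linarith
      have h3 := mul_le_mul_of_nonneg_left h2 hρ1.le
      refine le_trans (le_of_eq ?_) h3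
      field_simp
    refine (mul_pow_le_mul_exp hκ0.le hρ h1).trans ?_
    have e1 : Real.exp (-L) ^ 8 = Real.exp (-(8 * L)) := by
      rw [← Real.exp_nat_mul]; congr 1; push_cast; ring
    rw [e1]
    nth_rewrite 1 [← Real.exp_log hκ0]
    rw [← Real.exp_add]
    exact Real.exp_le_exp.2 (by linarith)
  -- The correlation time `r₀ + 1 / (1 - ρ)` is at most twice the mixing time: rounding costs `1`,
  -- and `1 ≤ 1 / (1 - ρ) ≤ L / (1 - ρ)`.
  · set r₀ := ⌈1 / (1 - ρ) * Real.log κ⌉₊ with hr₀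
    have hr1' : (1 / (1 - ρ) * Real.log κ) ≤ r₀ := Nat.le_ceil _
    have hr2 : (r₀ : ℝ) < 1 / (1 - ρ) * Real.log κ + 1 := Nat.ceil_lt_add_one (by positivity)
    have hr : κ * ρ ^ r₀ ≤ 1 := by
      have hc : Real.log κ ≤ (1 - ρ) * r₀ := by
        rw [one_div, inv_mul_le_iff₀ hρ1] at hr1'
        exact hr1'
      refine (mul_pow_le_mul_exp hκ0.le hρ hc).trans (le_of_eq ?_)
      rw [Real.exp_neg, Real.exp_log hκ0, mul_inv_cancel₀ hκ0.ne']
    refine ⟨r₀ + 1 / (1 - ρ), h.sum_min_le hr, ?_⟩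
    set q := 1 / (1 - ρ) with hq
    have h1 : q ≤ q * L := le_mul_of_one_le_right (by linarith) hL1
    have hτ : r₀ + q ≤ 2 * (q * (Real.log κ + L)) := by
      nlinarith [mul_nonneg (by linarith : 0 ≤ q) hlκ]
    rw [← mul_div_assoc, div_le_div_iff₀ hN0 (by linarith)]
    have hpos : 0 ≤ q * (Real.log κ + L) := by positivity
    calc 2 * (r₀ + q) * T ≤ 2 * (2 * (q * (Real.log κ + L))) * (8 * windowLength T) := by gcongr
      _ = _ := by ring

end Parameters

/-! ### From quadratic forms to projection errors. -/

section Projection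

variable {d K : ℕ}

/-- Pythagoras: the squared error is `‖y‖² - ‖Vᵀ y‖²`. -/
theorem projError_le {V : Matrix (Fin d) (Fin K) ℝ} (hV : Vᵀ * V = 1) {y : Fin d → ℝ} {C : ℝ}
    (hC : 0 ≤ C) (hy : y ⬝ᵥ y ≤ C ^ 2) : projError V y ≤ C := by
  rw [projError]
  refine abs_le_of_sq_le_sq' ?_ hC |>.2
  rw [norm_toLp_sq]
  have e1 : y ⬝ᵥ (V * Vᵀ) *ᵥ y = (Vᵀ *ᵥ y) ⬝ᵥ (Vᵀ *ᵥ y) := by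
    rw [← mulVec_mulVec, dotProduct_mulVec, ← mulVec_transpose]
  have e2 : ((V * Vᵀ) *ᵥ y) ⬝ᵥ (V * Vᵀ) *ᵥ y = (Vᵀ *ᵥ y) ⬝ᵥ (Vᵀ *ᵥ y) := by
    rw [← mulVec_mulVec, dotProduct_mulVec, ← mulVec_transpose, mulVec_mulVec, hV, one_mulVec]
  have h0 := dotProduct_self_nonneg' (Vᵀ *ᵥ y)
  rw [sub_dotProduct, dotProduct_sub, dotProduct_sub, e1, e2,
    dotProduct_comm ((V * Vᵀ) *ᵥ y), e1]
  linarith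

theorem projError_eq_zero {V : Matrix (Fin d) (Fin K) ℝ} (hV : Vᵀ * V = 1) (hK : K = d)
    (y : Fin d → ℝ) : projError V y = 0 := by
  subst hK
  rw [projError, mul_eq_one_comm.1 hV, one_mulVec, sub_self]
  simp

variable {A W : Matrix (Fin d) (Fin d) ℝ} {κ ρ G : ℝ}

theorem StableSystem.row_dotProduct_self_le (h : StableSystem A W κ ρ G) (b : ℕ) (i : Fin d) :
    (A ^ b * autocovZero A W).row i ⬝ᵥ (A ^ b * autocovZero A W).row i ≤ G ^ 2 := by
  set y := (A ^ b * autocovZero A W).row i with hy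
  have h1 := h.sq_dotProduct_pow_autocovZero_le b (Pi.single i 1) y
  rw [← row_dotProduct, ← hy] at h1
  simp only [single_one_dotProduct, Pi.single_eq_same, one_mul] at h1
  rcases (dotProduct_self_nonneg' y).eq_or_lt with h0 | h0
  · rw [← h0]; exact sq_nonneg G
  · rw [pow_two] at h1
    exact le_of_mul_le_mul_right h1 h0

variable {M : ℕ}

/-- Common form of `Hhat` and `Ghat`. -/
noncomputable def lagHat (b : ℕ) (S : Finset (Fin M)) (T : ℕ)
    (x : Fin M → ℕ → EuclideanSpace ℝ (Fin d)) (i : Fin d) : Matrix (Fin d) (Fin d) ℝ :=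
  (S.card : ℝ)⁻¹ • ∑ m ∈ S, Matrix.vecMulVec (lagVec b (windowOne T) (x m) i).ofLp
    (lagVec b (windowTwo T) (x m) i).ofLp

theorem dotProduct_lagHat_add_transpose (b : ℕ) (S : Finset (Fin M)) (T : ℕ)
    (x : Fin M → ℕ → EuclideanSpace ℝ (Fin d)) (i : Fin d) (u : Fin d → ℝ) :
    u ⬝ᵥ (lagHat b S T x i + (lagHat b S T x i)ᵀ) *ᵥ u = 2 * ((S.card : ℝ)⁻¹ * ∑ m ∈ S,
      ((lagVec b (windowOne T) (x m) i).ofLp ⬝ᵥ u) *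
        ((lagVec b (windowTwo T) (x m) i).ofLp ⬝ᵥ u)) := by
  have e : u ⬝ᵥ (lagHat b S T x i)ᵀ *ᵥ u = u ⬝ᵥ lagHat b S T x i *ᵥ u := by
    rw [mulVec_transpose, dotProduct_comm, ← dotProduct_mulVec]
  rw [add_mulVec, dotProduct_add, e, ← two_mul]
  congr 1
  rw [lagHat, smul_mulVec, dotProduct_smul, sum_mulVec, dotProduct_sum, smul_eq_mul]
  congr 1
  refine Finset.sum_congr rfl fun m _ => ?_
  rw [vecMulVec_mulVec, dotProduct_smul, MulOpposite.smul_eq_mul_unop, MulOpposite.unop_op,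
    dotProduct_comm u]

theorem sum_label_eq (S : Finset (Fin M)) (label : Fin M → Fin K) (f : Fin K → ℝ) :
    (S.card : ℝ)⁻¹ * ∑ m ∈ S, f (label m) =
      ∑ k, ((S.filter fun m => label m = k).card : ℝ) / S.card * f k := by
  rw [← Finset.sum_fiberwise S label, Finset.mul_sum]
  refine Finset.sum_congr rfl fun k _ => ?_
  rw [Finset.sum_congr rfl fun m hm => by rw [(Finset.mem_filter.1 hm).2], Finset.sum_const,
    nsmul_eq_mul]
  ring

/-- Closeness of the quadratic forms, over the trajectories, implies closeness of the estimated
subspace to the rows of the stationary autocovariances. -/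
theorem projError_le_of_abs_sum_le {S : Finset (Fin M)} (hS : S.Nonempty) {label : Fin M → Fin K}
    {b T : ℕ} {x : Fin M → ℕ → EuclideanSpace ℝ (Fin d)} {i : Fin d}
    {V : Matrix (Fin d) (Fin K) ℝ}
    (hV : IsTopEigenspace (lagHat b S T x i + (lagHat b S T x i)ᵀ) V) {y : Fin K → Fin d → ℝ}
    {ε pmin : ℝ} (hε : 0 ≤ ε) (hp : 0 < pmin)
    (hpmin : ∀ k, pmin ≤ ((S.filter fun m => label m = k).card : ℝ) / S.card)
    (h : ∀ u : Fin d → ℝ, |∑ m ∈ S, (((lagVec b (windowOne T) (x m) i).ofLp ⬝ᵥ u) *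
      ((lagVec b (windowTwo T) (x m) i).ofLp ⬝ᵥ u) - (y (label m) ⬝ᵥ u) ^ 2)| ≤
        S.card * ε * (u ⬝ᵥ u)) (k : Fin K) :
    projError V (y k) ^ 2 ≤ 2 * ε / pmin := by
  have hn : (0 : ℝ) < S.card := by exact_mod_cast hS.card_pos
  have key := mul_projError_sq_le hV (y := y)
    (p := fun k => ((S.filter fun m => label m = k).card : ℝ) / S.card)
    (fun k => by positivity) (ε := 2 * ε) (fun u => by
      rw [dotProduct_lagHat_add_transpose, ← sum_label_eq S label fun k => (y k ⬝ᵥ u) ^ 2,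
        ← mul_sub, ← mul_sub, ← Finset.sum_sub_distrib, abs_mul, abs_mul,
        abs_of_nonneg (by norm_num : (0 : ℝ) ≤ 2), abs_of_nonneg (by positivity), mul_assoc 2]
      refine mul_le_mul_of_nonneg_left ?_ (by norm_num)
      rw [inv_mul_le_iff₀ hn, ← mul_assoc]
      exact h u) (by positivity) k
  rw [le_div_iff₀ hp, mul_comm]
  exact (mul_le_mul_of_nonneg_right (hpmin k) (sq_nonneg _)).trans key

end Projection

/-! ### Measurable versions of the noise. -/

section Noise

variable {Ω : Type*} [MeasurableSpace Ω] {μ : Measure Ω} {d K M : ℕ}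
  {A W : Fin K → Matrix (Fin d) (Fin d) ℝ}

theorem ModelAssumptions.stableSystem {κ ρ G : ℝ} (h : ModelAssumptions A W κ ρ G) (k : Fin K) :
    StableSystem (A k) (W k) κ ρ G where
  posDef := h.posDef k
  one_le_kappa := h.one_le_kappa
  rho_nonneg := h.rho_nonneg
  rho_lt_one := h.rho_lt_one
  stable := h.stable k
  bounded := h.bounded k

/-- The laws provide only almost everywhere measurability. Measurable versions keep laws and
independence, and as there are finitely many noise vectors the recursion survives off one null set.
-/
theorem IsMixedLDS.exists_measurable_noise {label : Fin M → Fin K} {T : Fin M → ℕ}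
    {x w : Fin M → ℕ → Ω → EuclideanSpace ℝ (Fin d)} (h : IsMixedLDS μ A W label T x w) :
    ∃ (w' : Fin M → ℕ → Ω → EuclideanSpace ℝ (Fin d)) (s : Set Ω), μ sᶜ = 0 ∧
      (∀ ω ∈ s, ∀ m, ∀ t < T m, x m (t + 1) ω =
        toEuclideanCLM (n := Fin d) (𝕜 := ℝ) (A (label m)) (x m t ω) + w' m t ω) ∧
      (∀ m, IsGaussianNoise (w' m) (W (label m)) (T m) μ) ∧
      iIndepFun (fun p : (Σ m : Fin M, Fin (T m)) => w' p.1 p.2) μ := by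
  classical
  let w' : Fin M → ℕ → Ω → EuclideanSpace ℝ (Fin d) := fun m t =>
    if ht : t < T m then (h.law m t ht).aemeasurable.mk (w m t) else 0
  have hm : ∀ m t, Measurable (w' m t) := fun m t => by
    simp only [w']
    split_ifs with ht
    · exact (h.law m t ht).aemeasurable.measurable_mk
    · exact measurable_const
  have hae : ∀ m t, t < T m → w m t =ᵐ[μ] w' m t := fun m t ht => by
    simp only [w', dif_pos ht]
    exact (h.law m t ht).aemeasurable.ae_eq_mk
  have hind : iIndepFun (fun p : (Σ m : Fin M, Fin (T m)) => w' p.1 p.2) μ :=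
    h.indep.congr fun p => hae p.1 p.2 p.2.2
  refine ⟨w', {ω | ∀ p : (Σ m : Fin M, Fin (T m)), w p.1 p.2 ω = w' p.1 p.2 ω}, ?_, ?_, fun m => ?_,
    hind⟩
  · exact ae_all_iff.2 fun p => hae p.1 p.2 p.2.2
  · intro ω hω m t ht
    rw [h.step m t ht ω, hω ⟨m, ⟨t, ht⟩⟩]
  · exact ⟨hm m, fun r hr => (h.law m r hr).congr (hae m r hr).symm,
      hind.precomp (g := fun t : Fin (T m) => (⟨m, t⟩ : Σ m : Fin M, Fin (T m)))
        fun a b hab => by simpa using hab⟩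

end Noise

end MixedLDS

namespace MixedLDS

/-! ### The good event and its probability. -/

section Event

variable {Ω : Type*} [MeasurableSpace Ω] {μ : Measure Ω} [IsProbabilityMeasure μ] {d K M : ℕ}

/-- All states of the zero-started approximations in both windows are bounded. -/
theorem exists_bounded_states_event {A W : Matrix (Fin d) (Fin d) ℝ} {κ ρ G : ℝ} (hG : 0 ≤ G)
    (h : StableSystem A W κ ρ G) {T N : ℕ} (hT8 : 8 ≤ T) (hT : 4 * N + 1 ≤ T)
    {w : ℕ → Ω → EuclideanSpace ℝ (Fin d)} (hw : IsGaussianNoise w W T μ)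
    {x₀ : Ω → EuclideanSpace ℝ (Fin d)} {s : Set Ω} {g : Ω → ENNReal} (hg : Measurable g)
    (hgx : ∀ ω ∈ s, ENNReal.ofReal (‖x₀ ω‖ ^ 2) ≤ g ω)
    (hgi : ∫⁻ ω, g ω ∂μ ≤ ENNReal.ofReal (4 * (d * G))) {B : ℝ} (hB : 0 < B) :
    ∃ E : Set Ω, μ E ≤ ENNReal.ofReal (2 * T * (d * G / B ^ 2)) ∧ ∀ ω ∈ s, ω ∉ E → ‖x₀ ω‖ ≤ B ∧
      (∀ t ≤ 2 * N + 1, ‖zeroState A (fun r => w r ω) t‖ ≤ B) ∧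
      ∀ t ≤ 2 * N, ‖zeroState A (fun r => w (2 * N + 1 + r) ω) t‖ ≤ B := by
  have hq : 0 ≤ d * G / B ^ 2 := by positivity
  refine ⟨{ω | ω ∈ s ∧ B < ‖x₀ ω‖} ∪
    ((⋃ t ∈ Finset.range (2 * N + 2), {ω | B < ‖zeroState A (fun r => w r ω) t‖}) ∪
      ⋃ t ∈ Finset.range (2 * N + 1), {ω | B < ‖zeroState A (fun r => w (2 * N + 1 + r) ω) t‖}),
    ?_, fun ω hs hω => ?_⟩
  · have m0 := measure_lt_norm_le hg hgx hB hgi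
    have m1 : μ (⋃ t ∈ Finset.range (2 * N + 2), {ω | B < ‖zeroState A (fun r => w r ω) t‖}) ≤
        ENNReal.ofReal ((2 * N + 2 : ℕ) * (d * G / B ^ 2)) := by
      refine (measure_biUnion_finset_le _ _).trans ((Finset.sum_le_card_nsmul _ _ _ fun t ht =>
        hw.measure_lt_norm_zeroState_le h (by have := Finset.mem_range.1 ht; omega) hB).trans
          (le_of_eq ?_))
      rw [Finset.card_range, nsmul_eq_mul, ENNReal.ofReal_mul (Nat.cast_nonneg _),
        ENNReal.ofReal_natCast]
    have m2 : μ (⋃ t ∈ Finset.range (2 * N + 1),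
        {ω | B < ‖zeroState A (fun r => w (2 * N + 1 + r) ω) t‖}) ≤
        ENNReal.ofReal ((2 * N + 1 : ℕ) * (d * G / B ^ 2)) := by
      refine (measure_biUnion_finset_le _ _).trans ((Finset.sum_le_card_nsmul _ _ _ fun t ht =>
        (hw.shift (2 * N + 1)).measure_lt_norm_zeroState_le h
          (by have := Finset.mem_range.1 ht; omega) hB).trans (le_of_eq ?_))
      rw [Finset.card_range, nsmul_eq_mul, ENNReal.ofReal_mul (Nat.cast_nonneg _),
        ENNReal.ofReal_natCast]
    refine (measure_union_le _ _).trans ((add_le_add m0 ((measure_union_le _ _).trans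
      (add_le_add m1 m2))).trans ?_)
    rw [← ENNReal.ofReal_add (by positivity) (by positivity),
      ← ENNReal.ofReal_add (by positivity) (by positivity)]
    refine ENNReal.ofReal_le_ofReal ?_
    have hT' : (4 * N + 1 : ℝ) ≤ T := by exact_mod_cast hT
    have hT8' : (8 : ℝ) ≤ T := by exact_mod_cast hT8
    push_cast
    -- The initial state counts four times, the two families of states `2 * N + 2` and `2 * N + 1`
    -- times.
    calc _ = (4 * N + 7) * (d * G / B ^ 2) := by ring
      _ ≤ 2 * T * (d * G / B ^ 2) := by gcongr; linarith
  · simp only [Set.mem_union, Set.mem_iUnion, Set.mem_ofPred_eq, not_or, not_and, not_exists,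
      not_lt, Finset.mem_range] at hω
    exact ⟨hω.1 hs, fun t ht => hω.2.1 t (by omega), fun t ht => hω.2.2 t (by omega)⟩

variable {A W : Fin K → Matrix (Fin d) (Fin d) ℝ} {κ ρ G : ℝ}

/-- Union bound over the two lags and the coordinates for the concentration of the decoupled
statistics, and over the trajectories for boundedness of the states; the comparison with true
trajectories adds `80` to the constant `700008`. -/
theorem exists_subspace_event (hG : 0 < G) (h : ∀ k, StableSystem (A k) (W k) κ ρ G)
    {label : Fin M → Fin K} {S : Finset (Fin M)} {T : Fin M → ℕ} {T₀ : ℕ}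
    (hTS : ∀ m ∈ S, T m = T₀) (hT8 : 8 ≤ T₀)
    {x w : Fin M → ℕ → Ω → EuclideanSpace ℝ (Fin d)} {s : Set Ω} (hs : μ sᶜ = 0)
    (hx : ∀ ω ∈ s, ∀ m, ∀ t < T m, x m (t + 1) ω =
        toEuclideanCLM (n := Fin d) (𝕜 := ℝ) (A (label m)) (x m t ω) + w m t ω)
    (hw : ∀ m, IsGaussianNoise (w m) (W (label m)) (T m) μ)
    (hind : iIndepFun (fun p : (Σ m : Fin M, Fin (T m)) => w p.1 p.2) μ)
    (hinit : ∀ m ∈ S, ∃ g : Ω → ENNReal, Measurable g ∧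
      (∀ ω ∈ s, ENNReal.ofReal (‖x m 0 ω‖ ^ 2) ≤ g ω) ∧
        ∫⁻ ω, g ω ∂μ ≤ ENNReal.ofReal (4 * (d * G)))
    {τ L e σ : ℝ} (hτ : ∀ n, ∑ k ∈ Finset.range n, min 1 (κ * ρ ^ k) ≤ τ)
    (hγ : ∀ t, windowLength T₀ ≤ t → κ * ρ ^ t ≤ Real.exp (-L) ^ 8) (hL : 1 ≤ L) (hσ : 0 < σ)
    (hσ1 : σ ≤ 1) (hτN : 2 * τ / windowLength T₀ ≤ 32 * σ) (he : 0 < e) (he1 : e ≤ 1)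
    (heσ : (S.card : ℝ) * e ^ 2 = σ * d * L ^ 3) (hLe : Real.exp (-L) ≤ e)
    (hL16 : Real.exp (-L) ≤ 1 / 16) (hdL : d * Real.exp (-L) ≤ 1) :
    ∃ B : Set Ω, μ B ≤ ENNReal.ofReal (2 * d * (6 * S.card * d * Real.exp (-L) ^ 8 +
        2 * d * Real.exp (-L) ^ 4) + S.card * (2 * T₀ * (d * Real.exp (-L) ^ 3))) ∧
      ∀ ω ∉ B, ∀ b ≤ 1, ∀ (i : Fin d) (u : Fin d → ℝ),
        |∑ m ∈ S, (((lagVec b (windowOne T₀) (fun t => x m t ω) i).ofLp ⬝ᵥ u) *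
          ((lagVec b (windowTwo T₀) (fun t => x m t ω) i).ofLp ⬝ᵥ u) -
            ((A (label m) ^ b * autocovZero (A (label m)) (W (label m))).row i ⬝ᵥ u) ^ 2)| ≤
          S.card * (700088 * G ^ 2 * e) * (u ⬝ᵥ u) := by
  set ξ := Real.exp (-L) with hξ
  have hξ0 : 0 < ξ := Real.exp_pos _
  set N := windowLength T₀ with hN
  have hN1 : 1 ≤ N := by rw [hN, windowLength]; omega
  have hNT : 4 * N + 1 ≤ T₀ := by rw [hN, windowLength]; omega
  have hγ1 : ξ ^ 8 ≤ 1 := pow_le_one₀ hξ0.le (by linarith)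
  have hξe : ξ ^ 8 ≤ e := by
    refine le_trans ?_ hLe
    exact pow_le_of_le_one hξ0.le (by linarith) (by norm_num)
  have hwS : ∀ m : S, IsGaussianNoise (w m) (W (label m)) T₀ μ := fun m => by
    have := hw m
    rwa [hTS m m.2] at this
  have hindS : iIndepFun (fun p : (Σ _ : S, Fin T₀) => w p.1 p.2) μ :=
    hind.precomp (g := fun p : (Σ _ : S, Fin T₀) =>
      (⟨p.1, ⟨p.2, by rw [hTS p.1 p.1.2]; exact p.2.2⟩⟩ : Σ m : Fin M, Fin (T m))) fun p q hpq => by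
        obtain ⟨⟨m, hm⟩, t⟩ := p
        obtain ⟨⟨m', hm'⟩, t'⟩ := q
        simp only [Sigma.mk.injEq] at hpq
        obtain ⟨rfl, h2⟩ := hpq
        have h3 := eq_of_heq h2
        simp only [Fin.mk.injEq] at h3
        have h4 : t = t' := Fin.ext h3
        rw [h4]
  -- This radius makes the Chebyshev failure `d * G / B ^ 2` equal to `d * ξ ^ 3`, while the
  -- comparison error `80 * ξ ^ 8 * B ^ 4 = 80 * G ^ 2 * ξ ^ 2` stays negligible.
  set B : ℝ := Real.sqrt (G / ξ ^ 3) with hB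
  have hB0 : 0 < B := Real.sqrt_pos.2 (by positivity)
  have hB2 : B ^ 2 = G / ξ ^ 3 := Real.sq_sqrt (by positivity)
  have hGB : d * G / B ^ 2 = d * ξ ^ 3 := by rw [hB2]; field_simp
  have hB4 : 80 * ξ ^ 8 * B ^ 4 ≤ 80 * G ^ 2 * e := by
    have e1 : 80 * ξ ^ 8 * B ^ 4 = 80 * G ^ 2 * ξ ^ 2 := by
      rw [show B ^ 4 = (B ^ 2) ^ 2 by ring, hB2]
      field_simp
    rw [e1]
    gcongr
    refine le_trans ?_ hLe
    exact pow_le_of_le_one hξ0.le (by linarith) (by norm_num)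
  choose g hg hgx hgi using fun m : S => hinit m m.2
  choose E hE hEx using fun m : S => exists_bounded_states_event hG.le (h (label m)) hT8 hNT (hwS m)
    (hg m) (hgx m) (hgi m) hB0
  have hcon := fun p : Fin 2 × Fin d =>
    exists_windowPair_concentration hN1 hNT hG (fun m : S => h (label m)) hwS hindS
      (Nat.le_of_lt_succ p.1.2) p.2 hτ hγ hL hσ hσ1 hτN he he1
      (by rw [Fintype.card_coe]; exact heσ) hξe hLe hL16 hdL
  choose F hF hFx using hcon
  refine ⟨sᶜ ∪ ((⋃ p, F p) ∪ ⋃ m, E m), ?_, fun ω hω b hb i u => ?_⟩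
  · refine (measure_union_le _ _).trans ?_
    rw [hs, zero_add]
    refine (measure_union_le _ _).trans ?_
    have m1 : μ (⋃ p, F p) ≤ ENNReal.ofReal (2 * d * (6 * S.card * d * ξ ^ 8 + 2 * d * ξ ^ 4)) := by
      refine (measure_iUnion_fintype_le _ _).trans
        ((Finset.sum_le_card_nsmul _ _ _ fun p _ => hF p).trans (le_of_eq ?_))
      rw [Finset.card_univ, Fintype.card_prod, Fintype.card_fin, Fintype.card_fin, nsmul_eq_mul,
        Fintype.card_coe, ← ENNReal.ofReal_natCast, ← ENNReal.ofReal_mul (Nat.cast_nonneg _)]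
      push_cast
      rfl
    have m2 : μ (⋃ m, E m) ≤ ENNReal.ofReal (S.card * (2 * T₀ * (d * ξ ^ 3))) := by
      refine (measure_iUnion_fintype_le _ _).trans
        ((Finset.sum_le_card_nsmul _ _ _ fun m _ => hE m).trans (le_of_eq ?_))
      rw [Finset.card_univ, nsmul_eq_mul, Fintype.card_coe, hGB, ← ENNReal.ofReal_natCast,
        ← ENNReal.ofReal_mul (Nat.cast_nonneg _)]
    rw [ENNReal.ofReal_add (by positivity) (by positivity)]
    exact add_le_add m1 m2
  · simp only [Set.mem_union, Set.mem_iUnion, not_or, not_exists, Set.mem_compl_iff,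
      not_not] at hω
    obtain ⟨hωs, hωF, hωE⟩ := hω
    have h1 := hFx (⟨b, Nat.lt_succ_of_le hb⟩, i) ω (hωF _) u
    rw [Fintype.card_coe] at h1
    have h2 := fun m : S => (h (label m)).abs_windows_sub_windowPair_le (x := fun t => x m t ω)
      (w := fun t => w m t ω) hN1 hNT (fun t ht => hx ω hωs m t (by rw [hTS m m.2]; exact ht))
      hγ1 hγ (hEx m ω hωs (hωE m)).1 (hEx m ω hωs (hωE m)).2.1 (hEx m ω hωs (hωE m)).2.2 hb i u
    rw [← Finset.sum_coe_sort S]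
    have hu := dotProduct_self_nonneg' u
    have h3 : |∑ m : S, (((lagVec b (windowOne T₀) (fun t => x m t ω) i).ofLp ⬝ᵥ u) *
          ((lagVec b (windowTwo T₀) (fun t => x m t ω) i).ofLp ⬝ᵥ u) -
        ((windowPair (A (label m)) N b i fun r => w m r ω).1 ⬝ᵥ u) *
          ((windowPair (A (label m)) N b i fun r => w m r ω).2 ⬝ᵥ u))| ≤
        S.card * (80 * G ^ 2 * e * (u ⬝ᵥ u)) := by
      refine (Finset.abs_sum_le_sum_abs _ _).trans
        ((Finset.sum_le_card_nsmul _ _ _ fun m _ =>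
          (h2 m).trans (mul_le_mul_of_nonneg_right hB4 hu)).trans (le_of_eq ?_))
      rw [Finset.card_univ, nsmul_eq_mul, Fintype.card_coe]
    have h4 := (abs_add_le _ _).trans (add_le_add h3 h1)
    rw [← Finset.sum_add_distrib] at h4
    simp only [sub_add_sub_cancel] at h4
    exact h4.trans (le_of_eq (by ring))

/-- As `Ttot * d * ξ = δ`, the counts in the union bound are paid by factors `ξ`; a remaining `ξ ^
2` absorbs the constants, since `18 / 16 ^ 2 < 1`. -/
theorem failure_probability_le {d n T : ℕ} {Ttot δ ξ : ℝ} (hd : 1 ≤ d) (hδ1 : δ < 1)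
    (hT : 1 ≤ T) (hn : 1 ≤ n) (hTtot : (T : ℝ) * n ≤ Ttot) (hξ0 : 0 < ξ)
    (hξ : ξ = δ / (Ttot * d)) (hξ16 : ξ ≤ 1 / 16) :
    2 * d * (6 * n * d * ξ ^ 8 + 2 * d * ξ ^ 4) + n * (2 * T * (d * ξ ^ 3)) ≤ δ := by
  have hd0 : (1 : ℝ) ≤ d := by exact_mod_cast hd
  have hT0 : (1 : ℝ) ≤ T := by exact_mod_cast hT
  have hn0 : (1 : ℝ) ≤ n := by exact_mod_cast hn
  have hTn : (n : ℝ) ≤ Ttot := le_trans (le_mul_of_one_le_left (by linarith) hT0) hTtot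
  have hTt : 1 ≤ Ttot := hn0.trans hTn
  have hδξ : Ttot * (d * ξ) = δ := by rw [hξ]; field_simp
  have hdξ0 : 0 ≤ d * ξ := by positivity
  have h1 : d * ξ ≤ δ := by rw [← hδξ]; exact le_mul_of_one_le_left hdξ0 hTt
  have h2 : n * (d * ξ) ≤ δ := by rw [← hδξ]; gcongr
  have h3 : T * n * (d * ξ) ≤ δ := by rw [← hδξ]; gcongr
  have hδ0 : 0 ≤ δ := hdξ0.trans h1
  have hξ2 : ξ ^ 2 ≤ (1 / 16) ^ 2 := pow_le_pow_left₀ hξ0.le hξ16 2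
  have hξ6 : ξ ^ 6 ≤ ξ ^ 2 := pow_le_pow_of_le_one hξ0.le (by linarith) (by norm_num)
  have k1 : n * (d * ξ) * (d * ξ) * ξ ^ 6 ≤ δ * 1 * ξ ^ 2 := by gcongr; linarith
  have k2 : (d * ξ) * (d * ξ) * ξ ^ 2 ≤ δ * 1 * ξ ^ 2 := by gcongr; linarith
  have k3 : T * n * (d * ξ) * ξ ^ 2 ≤ δ * ξ ^ 2 := by gcongr
  calc _ = 12 * (n * (d * ξ) * (d * ξ) * ξ ^ 6) + 4 * ((d * ξ) * (d * ξ) * ξ ^ 2) +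
        2 * (T * n * (d * ξ) * ξ ^ 2) := by ring
    _ ≤ 18 * (δ * ξ ^ 2) := by linarith
    _ ≤ 18 * (δ * (1 / 16) ^ 2) := by gcongr
    _ ≤ δ := by linarith

end Event

end MixedLDS

namespace MixedLDS

/-! ### Final parameters, easy regimes and the theorem. -/

section Assembly

variable {d K M : ℕ}

theorem Hhat_eq_lagHat (S : Finset (Fin M)) (T : ℕ) (x : Fin M → ℕ → EuclideanSpace ℝ (Fin d))
    (i : Fin d) : Hhat S T x i = lagHat 0 S T x i := rfl

theorem Ghat_eq_lagHat (S : Finset (Fin M)) (T : ℕ) (x : Fin M → ℕ → EuclideanSpace ℝ (Fin d))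
    (i : Fin d) : Ghat S T x i = lagHat 1 S T x i := rfl

/-- Taking square roots, with `2 * 700088 ≤ 1225 ^ 2` and `1 ≤ K`, turns `√η` into the fourth root
of `η`. -/
theorem le_mul_sqrt_mul_rpow_of_sq_le {G ε η pmin r : ℝ} (hG : 0 ≤ G) (hη : 0 ≤ η) (hK : 1 ≤ K)
    (hp : 0 < pmin) (hε : ε = 700088 * G ^ 2 * Real.sqrt η) (h : r ^ 2 ≤ 2 * ε / pmin) :
    r ≤ 1225 * G * Real.sqrt (K / pmin) * η ^ (1 / 4 : ℝ) := by
  have hK1 : (1 : ℝ) ≤ K := by exact_mod_cast hK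
  have hq : (η ^ (1 / 4 : ℝ)) ^ 2 = Real.sqrt η := by
    rw [← Real.rpow_natCast, ← Real.rpow_mul hη, Real.sqrt_eq_rpow]; norm_num
  refine abs_le_of_sq_le_sq' (h.trans ?_)
    (by have := Real.rpow_nonneg hη (1 / 4 : ℝ); positivity) |>.2
  rw [mul_pow, mul_pow, mul_pow, hq, Real.sq_sqrt (by positivity), hε]
  have hs := Real.sqrt_nonneg η
  have : 2 * (700088 * G ^ 2 * √η) / pmin = 1400176 * G ^ 2 * (1 / pmin) * √η := by ring
  rw [this]
  gcongr
  norm_num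

variable {Ω : Type*} [MeasurableSpace Ω] {μ : Measure Ω} [IsProbabilityMeasure μ]
  {A W : Fin K → Matrix (Fin d) (Fin d) ℝ} {κ ρ G : ℝ}

/-- When `η ≥ 1` the right side already exceeds `G`, which bounds the norm of the row and hence its
projection error. -/
theorem projError_row_le {S : Matrix (Fin d) (Fin d) ℝ} (hG : 1 ≤ K)
    (h : ∀ k, StableSystem (A k) (W k) κ ρ G) {pmin η : ℝ} (hp : 0 < pmin) (hp1 : pmin ≤ 1)
    (hη : 1 ≤ η) {V : Matrix (Fin d) (Fin K) ℝ} (hV : IsTopEigenspace S V) (b : ℕ) (k : Fin K)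
    (i : Fin d) : projError V ((A k ^ b * autocovZero (A k) (W k)).row i) ≤
      1225 * G * Real.sqrt (K / pmin) * η ^ (1 / 4 : ℝ) := by
  have hG0 := (h k).G_nonneg
  have hK1 : (1 : ℝ) ≤ K := by exact_mod_cast hG
  refine (projError_le hV.1 hG0 ((h k).row_dotProduct_self_le b i)).trans ?_
  have h1 : 1 ≤ Real.sqrt (K / pmin) := by
    rw [Real.one_le_sqrt, one_le_div hp]
    linarith
  have h2 : 1 ≤ η ^ (1 / 4 : ℝ) := Real.one_le_rpow hη (by norm_num)
  calc G = 1 * G * 1 * 1 := by ring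
    _ ≤ 1225 * G * Real.sqrt (K / pmin) * η ^ (1 / 4 : ℝ) := by gcongr; norm_num

/-- Event of high probability on which the estimated quadratic forms are accurate. -/
theorem exists_accurate_event (hd : 2 ≤ d) (h : ∀ k, StableSystem (A k) (W k) κ ρ G)
    {label : Fin M → Fin K} {S : Finset (Fin M)} (hS : S.Nonempty) {T : Fin M → ℕ} {T₀ : ℕ}
    (hT₀ : 1 ≤ T₀) (hTS : ∀ m ∈ S, T m = T₀) {δ : ℝ} (hδ : 0 < δ) (hδ1 : δ < 1)
    {x w : Fin M → ℕ → Ω → EuclideanSpace ℝ (Fin d)} (hx : IsMixedLDS μ A W label T x w)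
    (hstart : ZeroStart x ∨ (ContinuousStart T x ∧ ∀ m m' : Fin M, m ∉ S → m' ∈ S → m < m' →
      1 / (1 - ρ) * Real.log (2 * κ) ≤ (T m : ℝ))) {Ttot η : ℝ}
    (hTtot : (T₀ : ℝ) * S.card ≤ Ttot) (hmix : 64 * mixingTime d κ ρ Ttot δ ≤ T₀)
    (hη : η = mixingTime d κ ρ Ttot δ * d / (T₀ * S.card) * Real.log (Ttot * d / δ) ^ 3)
    (hη1 : η ≤ 1) :
    ∃ B : Set Ω, μ B ≤ ENNReal.ofReal δ ∧
      ∀ ω ∉ B, ∀ b ≤ 1, ∀ (i : Fin d) (u : Fin d → ℝ),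
        |∑ m ∈ S, (((lagVec b (windowOne T₀) (fun t => x m t ω) i).ofLp ⬝ᵥ u) *
          ((lagVec b (windowTwo T₀) (fun t => x m t ω) i).ofLp ⬝ᵥ u) -
            ((A (label m) ^ b * autocovZero (A (label m)) (W (label m))).row i ⬝ᵥ u) ^ 2)| ≤
          S.card * (700088 * G ^ 2 * Real.sqrt η) * (u ⬝ᵥ u) := by
  obtain ⟨m₀, hm₀⟩ := hS
  have hn : 1 ≤ S.card := Finset.card_pos.2 ⟨m₀, hm₀⟩
  have hn' : (1 : ℝ) ≤ S.card := by exact_mod_cast hn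
  have hd' : (2 : ℝ) ≤ d := by exact_mod_cast hd
  have hT₀' : (1 : ℝ) ≤ T₀ := by exact_mod_cast hT₀
  have hTT : (T₀ : ℝ) ≤ Ttot := (le_mul_of_one_le_right (by linarith) hn').trans hTtot
  have hTt : 1 ≤ Ttot := hT₀'.trans hTT
  have h₀ := h (label m₀)
  have hG := h₀.G_pos (by omega)
  obtain ⟨hT8, hL1, hξ16, htm1, hγ, τ, hτ, hτN⟩ := h₀.window_parameters hd hδ hδ1 hT₀ hTT hmix
  have hexp := exp_neg_log_eq (Ttot := Ttot) (by omega : 1 ≤ d) hδ (by linarith)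
  set L := Real.log (Ttot * d / δ) with hL
  set tm := mixingTime d κ ρ Ttot δ with htm
  have hη0 : 0 < η := by rw [hη]; positivity
  obtain ⟨w', s, hs, hxs, hw', hind⟩ := hx.exists_measurable_noise
  have hinit : ∀ m ∈ S, ∃ g : Ω → ENNReal, Measurable g ∧
      (∀ ω ∈ s, ENNReal.ofReal (‖x m 0 ω‖ ^ 2) ≤ g ω) ∧
        ∫⁻ ω, g ω ∂μ ≤ ENNReal.ofReal (4 * (d * G)) := by
    intro m hm
    rcases hstart with h0 | ⟨hc, hlen⟩
    · exact ⟨0, measurable_const, fun ω _ => by simp [h0 m ω], by simp⟩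
    · refine exists_bound_initial_state (A := fun m => A (label m)) (W := fun m => W (label m))
        (fun m => h (label m)) hw' hxs hc fun m' hm' => ?_
      -- An earlier trajectory of the group contracts by the mixing condition, any other one by the
      -- length assumption.
      by_cases hmS : m' ∈ S
      · rw [hTS m' hmS]
        refine (hγ T₀ (by unfold windowLength; omega)).trans ?_
        refine (pow_le_of_le_one (Real.exp_pos _).le (by linarith) (by norm_num)).trans ?_
        linarith
      · exact mul_pow_le_half h₀.one_le_kappa h₀.rho_nonneg h₀.rho_lt_one (hlen m' m hmS hm hm')
  have hee : Real.sqrt η ^ 2 = η := Real.sq_sqrt hη0.le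
  have he1 : Real.sqrt η ≤ 1 := Real.sqrt_le_one.2 hη1
  have hηe : η ≤ Real.sqrt η := by
    have := Real.sqrt_nonneg η
    nlinarith
  -- Mixing time, dimension and logarithm are at least `1`, so `η ≥ 1 / (T₀ * |S|)`, whereas `exp
  -- (-L) = δ / (Ttot * d)` is smaller.
  have hξη : Real.exp (-L) ≤ η := by
    have hd1 : (1 : ℝ) ≤ d := by linarith
    calc Real.exp (-L) = δ / (Ttot * d) := hexp
      _ ≤ 1 / (Ttot * 1) := by gcongr
      _ ≤ 1 / (T₀ * S.card) := by rw [mul_one]; gcongr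
      _ = 1 * 1 / (T₀ * S.card) * 1 ^ 3 := by ring
      _ ≤ η := by rw [hη]; gcongr
  -- With `e = √η` and `σ = tm / T₀` the definition of `η` is exactly the balance `|S| * e ^ 2 = σ *
  -- d * L ^ 3`.
  obtain ⟨B, hB, hBu⟩ := exists_subspace_event (e := Real.sqrt η) (σ := tm / T₀) hG h hTS hT8 hs hxs
    hw' hind hinit hτ hγ hL1 (by positivity) (by rw [div_le_one (by linarith)]; linarith) hτN
    (Real.sqrt_pos.2 hη0) he1 (by rw [hee, hη]; field_simp) (hξη.trans hηe) hξ16 (by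
      rw [hexp, ← mul_div_assoc, div_le_one (by positivity)]
      nlinarith)
  exact ⟨B, hB.trans (ENNReal.ofReal_le_ofReal (failure_probability_le (by omega) hδ1 hT₀ hn hTtot
    (Real.exp_pos _) hexp hξ16)), hBu⟩

end Assembly

end MixedLDS

theorem theorem3 :
    ∃ C₁ C₂ C₃ : ℝ, 0 < C₁ ∧ 0 < C₂ ∧ 0 < C₃ ∧
      ∀ (Ω : Type*) [MeasurableSpace Ω] (μ : Measure Ω) [IsProbabilityMeasure μ]
        (d K M : ℕ) (A W : Fin K → Matrix (Fin d) (Fin d) ℝ) (κ ρ Γmax pmin δ : ℝ)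
        (label : Fin M → Fin K) (stage : Fin M → MixedLDS.Stage) (len : MixedLDS.Stage → ℕ)
        (x w : Fin M → ℕ → Ω → EuclideanSpace ℝ (Fin d))
        (T : Fin M → ℕ) (S : Finset (Fin M)) (Ttot Tsub tmix : ℝ),
        -- trajectory lengths, the subspace group, total lengths, mixing time
        T = (fun m => len (stage m)) →
        S = Finset.univ.filter (fun m => stage m = MixedLDS.Stage.subspace) →
        Ttot = ((∑ m, T m : ℕ) : ℝ) →
        Tsub = (len MixedLDS.Stage.subspace : ℝ) * (S.card : ℝ) →
        tmix = MixedLDS.mixingTime d κ ρ Ttot δ →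
        -- standing assumptions
        K ≤ d →
        1 ≤ len MixedLDS.Stage.subspace →
        0 < δ → δ < 1 →
        MixedLDS.ModelAssumptions A W κ ρ Γmax →
        0 < pmin →
        (∀ k, pmin ≤ ((S.filter (fun m => label m = k)).card : ℝ) / (S.card : ℝ)) →
        MixedLDS.IsMixedLDS μ A W label T x w →
        (MixedLDS.ZeroStart x ∨
          (MixedLDS.ContinuousStart T x ∧
            ∀ m m' : Fin M, m ∉ S → m' ∈ S → m < m' →
              1 / (1 - ρ) * Real.log (2 * κ) ≤ (T m : ℝ))) →
        -- conditions on the data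
        C₁ * tmix ≤ (len MixedLDS.Stage.subspace : ℝ) →
        C₂ * (tmix * d * Real.log (Ttot * d / δ)) ≤ Tsub →
        ∃ E : Set Ω, MeasurableSet E ∧ 1 - δ ≤ μ.real E ∧
          ∀ ω ∈ E, ∀ V U : Fin d → Matrix (Fin d) (Fin K) ℝ,
            MixedLDS.IsSubspaceOutput S (len MixedLDS.Stage.subspace)
              (fun m t => x m t ω) V U →
            ∀ (k : Fin K) (i : Fin d),
              max (MixedLDS.projError (V i) ((MixedLDS.autocovZero (A k) (W k)).row i))
                  (MixedLDS.projError (U i) ((MixedLDS.autocovOne (A k) (W k)).row i)) ≤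
                C₃ * Γmax * Real.sqrt (K / pmin) *
                  (tmix * d / Tsub * Real.log (Ttot * d / δ) ^ 3) ^ (1 / 4 : ℝ) := by
  refine ⟨64, 1, 1225, by norm_num, by norm_num, by norm_num, ?_⟩
  intro Ω _ μ _ d K M A W κ ρ Γmax pmin δ label stage len x w T S Ttot Tsub tmix hT hS hTtot hTsub
    htmix hKd hlen hδ hδ1 hmodel hp hpmin hx hstart hmix _
  have h := hmodel.stableSystem
  rcases Nat.eq_zero_or_pos K with rfl | hK
  · exact ⟨Set.univ, MeasurableSet.univ, by simpa using hδ.le, fun ω _ V U _ k => k.elim0⟩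
  -- With an empty group all label frequencies would be `0` by division by zero, against `pmin > 0`.
  have hSn : S.Nonempty := by
    by_contra hcon
    rw [Finset.not_nonempty_iff_eq_empty] at hcon
    have := hpmin ⟨0, hK⟩
    rw [hcon] at this
    simp only [Finset.filter_empty, Finset.card_empty, Nat.cast_zero, div_zero] at this
    linarith
  have hn : (1 : ℝ) ≤ S.card := by exact_mod_cast hSn.card_pos
  have hp1 : pmin ≤ 1 := (hpmin ⟨0, hK⟩).trans
    (div_le_one_of_le₀ (by exact_mod_cast Finset.card_filter_le _ _) (by linarith))
  set T₀ := len MixedLDS.Stage.subspace with hT₀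
  have hTS : ∀ m ∈ S, T m = T₀ := fun m hm => by
    rw [hS, Finset.mem_filter] at hm
    rw [hT, hT₀, ← hm.2]
  have hTtot' : (T₀ : ℝ) * S.card ≤ Ttot := by
    have h1 : ∑ m ∈ S, T m ≤ ∑ m, T m := Finset.sum_le_sum_of_subset (Finset.subset_univ S)
    rw [Finset.sum_congr rfl hTS, Finset.sum_const, smul_eq_mul, mul_comm] at h1
    rw [hTtot]
    exact_mod_cast h1
  have hlen' : (1 : ℝ) ≤ T₀ := by exact_mod_cast hlen
  have hTt1 : 1 ≤ Ttot := by nlinarith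
  have hΓ : 0 ≤ Γmax := (h ⟨0, hK⟩).G_nonneg
  have hd0 : (1 : ℝ) ≤ d := by exact_mod_cast hK.trans_le hKd
  have hTd : 1 ≤ Ttot * d := by nlinarith
  have hlog : 0 ≤ Real.log (Ttot * d / δ) :=
    Real.log_nonneg ((one_le_div hδ).2 (hδ1.le.trans hTd))
  have htmix0 : 0 ≤ tmix := by
    rw [htmix, MixedLDS.mixingTime_eq (hK.trans_le hKd) hmodel.one_le_kappa hδ (by linarith)]
    have := sub_pos.2 hmodel.rho_lt_one
    have := Real.log_nonneg hmodel.one_le_kappa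
    positivity
  have hη0 : 0 ≤ tmix * d / Tsub * Real.log (Ttot * d / δ) ^ 3 := by
    rw [hTsub]
    positivity
  set η := tmix * d / Tsub * Real.log (Ttot * d / δ) ^ 3 with hη
  have hη' : η = MixedLDS.mixingTime d κ ρ Ttot δ * d / (T₀ * S.card) *
      Real.log (Ttot * d / δ) ^ 3 := by rw [← htmix, ← hTsub]
  clear_value η T₀
  -- For `d = 1` also `K = d`, and the projection is the identity. From `d ≥ 2` on the logarithm is
  -- bounded away from zero.
  by_cases hd : d = 1
  · refine ⟨Set.univ, MeasurableSet.univ, by simpa using hδ.le, fun ω _ V U hVU k i => ?_⟩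
    have hKd' : K = d := by omega
    rw [MixedLDS.projError_eq_zero (hVU i).1.1 hKd', MixedLDS.projError_eq_zero (hVU i).2.1 hKd',
      max_self]
    have := Real.rpow_nonneg hη0 (1 / 4)
    positivity
  have hrow : ∀ k i, (MixedLDS.autocovZero (A k) (W k)).row i =
      (A k ^ 0 * MixedLDS.autocovZero (A k) (W k)).row i := fun k i => by
    rw [pow_zero, Matrix.one_mul]
  have hrow1 : ∀ k i, (MixedLDS.autocovOne (A k) (W k)).row i =
      (A k ^ 1 * MixedLDS.autocovZero (A k) (W k)).row i := fun k i => by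
    rw [pow_one, MixedLDS.autocovOne]
  rcases le_total 1 η with hη1 | hη1
  · refine ⟨Set.univ, MeasurableSet.univ, by simpa using hδ.le, fun ω _ V U hVU k i => ?_⟩
    rw [hrow, hrow1]
    exact max_le (MixedLDS.projError_row_le hK h hp hp1 hη1 (hVU i).1 0 k i)
      (MixedLDS.projError_row_le hK h hp hp1 hη1 (hVU i).2 1 k i)
  obtain ⟨B, hB, hBu⟩ := MixedLDS.exists_accurate_event (by omega) h hSn hlen hTS hδ hδ1 hx hstart
    hTtot' (htmix ▸ hmix) hη' hη1
  -- The bad set need not be measurable; its measurable hull has the same measure.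
  refine ⟨(toMeasurable μ B)ᶜ, (measurableSet_toMeasurable μ B).compl, ?_,
    fun ω hω V U hVU k i => ?_⟩
  · rw [measureReal_compl (measurableSet_toMeasurable μ B), probReal_univ]
    have h1 : μ.real (toMeasurable μ B) ≤ δ := by
      rw [measureReal_def, measure_toMeasurable]
      exact ENNReal.toReal_le_of_le_ofReal hδ.le hB
    linarith
  · have hωB : ω ∉ B := fun hmem => hω (subset_toMeasurable μ B hmem)
    have hε : 0 ≤ 700088 * Γmax ^ 2 * Real.sqrt η := by positivity
    rw [hrow, hrow1]
    have hV := (hVU i).1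
    have hU := (hVU i).2
    rw [MixedLDS.Hhat_eq_lagHat] at hV
    rw [MixedLDS.Ghat_eq_lagHat] at hU
    have hB0 := hBu ω hωB 0 (by norm_num) i
    have hB1 := hBu ω hωB 1 le_rfl i
    refine max_le ?_ ?_
    · exact MixedLDS.le_mul_sqrt_mul_rpow_of_sq_le hΓ hη0 hK hp rfl
        (MixedLDS.projError_le_of_abs_sum_le hSn hV
          (y := fun k => (A k ^ 0 * MixedLDS.autocovZero (A k) (W k)).row i) hε hp hpmin
          hB0 k)
    · exact MixedLDS.le_mul_sqrt_mul_rpow_of_sq_le hΓ hη0 hK hp rfl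
        (MixedLDS.projError_le_of_abs_sum_le hSn hU
          (y := fun k => (A k ^ 1 * MixedLDS.autocovZero (A k) (W k)).row i) hε hp hpmin
          hB1 k)
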